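/- Setting. Let $D\ge 0$ and let $U\subseteq\mathbb R^D$ be a nonempty open star-shaped set (the coordinate range of the matter fields). The fields are the commuting fields $X^\mu$ ($\mu=1,\dots,D$, with values in $U$) and $h_{++},h_{--}$, and the anticommuting ghosts $c^+,c^-$; put $y=h_{++}h_{--}\neq 1$. A local function is a real function of these fields and their derivatives $\partial_+^m\partial_-^n$ which is smooth in the undifferentiated $X^\mu,h_{\pm\pm}$ and polynomial in all the other variables. The operator $\mathcal S$ is the left antiderivation on local functions that commutes with $\partial_\pm$ and satisfies $$\mathcal S c^\pm=c^\pm\partial_\pm c^\pm,\qquad \mathcal S h_{\pm\pm}=\partial_\pm c^\mp-h_{\pm\pm}\partial_\mp c^\mp+(\partial_\mp h_{\pm\pm})c^\mp,$$ $$\mathcal S X^\mu=\tfrac1{1-y}\bigl(c^+(\partial_+-h_{++}\partial_-)X^\mu+c^-(\partial_--h_{--}\partial_+)X^\mu\bigr).$$ For $m\ge -1$ put $c^\pm_m=\frac1{(m+1)!}\partial_\pm^{m+1}c^\pm$ and $L^\pm_m=\frac{\partial}{\partial c^\pm_m}\mathcal S+\mathcal S\frac{\partial}{\partial c^\pm_m}$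 (left derivatives), and for $m,n\ge 0$ put $X^\mu_{m,n}=\bigl(\frac{\partial}{\partial c^+}\mathcal S\bigr)^m\bigl(\frac{\partial}{\partial c^-}\mathcal S\bigr)^nX^\mu$. Let $\mathcal C^\Phi$ be the space of those local functions of the $c^\pm_m$ and $X^\mu_{m,n}$ (smooth in $X^\mu=X^\mu_{0,0}$, polynomial in the others) that are annihilated by $L^+_0$ and $L^-_0$. Let $\Theta^\pm=c^\pm_0$ and $z^A=(X^\mu,\Theta^+,\Theta^-)$, with $(-)^\mu=1$, $(-)^\pm=-1$, and $(-)^{AB}=-1$ if both $A,B\in\{+,-\}$, $(-)^{AB}=1$ otherwise. A superfield is $H(z)=H(X)+H^+(X)\Theta^++H^-(X)\Theta^-+H^{+-}(X)\Theta^+\Theta^-$ with coefficients in $C^\infty(U)$, and $\partial_A=\partial/\partial z^A$ (left derivatives). Put $$T^\mu=c^+X^\mu_{1,0}+c^-X^\mu_{0,1},\qquad R^\mu=c^+X^\mu_{1,0}-c^-X^\mu_{0,1},\qquad T^\pm=2c^\pm_{-1}c^\pm_1 .$$ Let $\omega^0,a_{++},a_{--}$ be real constants, and let $\mathcal F_{AB}$,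 $\mathcal N_{\mu\nu}$ be superfields with $\mathcal F_{AB}=-(-)^{AB}\mathcal F_{BA}$, $\mathcal F_{++}=\mathcal F_{--}=0$, $\mathcal N_{\mu\nu}=\mathcal N_{\nu\mu}$. Write $$\rho[\omega^0,a,\mathcal F,\mathcal N]=\omega^0+a_{++}T^+\Theta^++a_{--}T^-\Theta^--\tfrac12T^AT^B\mathcal F_{BA}(z)(-)^A+\tfrac12R^\mu T^\nu\mathcal N_{\mu\nu}(z),$$ with summation over repeated indices. Lemma 7.2. (i) A local function $\omega$ satisfies $\omega\in\mathcal C^\Phi$ and $\mathcal S\omega=0$ if and only if $\omega=\rho[\omega^0,a,\mathcal F,\mathcal N]+\mathcal S\eta$ for some $\omega^0,a_{\pm\pm},\mathcal F_{AB},\mathcal N_{\mu\nu}$ as above and some $\eta\in\mathcal C^\Phi$. (ii) Two such representatives $\rho[\omega^0,a,\mathcal F,\mathcal N]$ and $\rho[\omega'^0,a',\mathcal F',\mathcal N']$ differ by an element of $\mathcal S\mathcal C^\Phi$ if and only if $\omega'^0=\omega^0$, $a'_{\pm\pm}=a_{\pm\pm}$, $\mathcal N'_{\mu\nu}=\mathcal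 N_{\mu\nu}$, and $\mathcal F'$ and $\mathcal F$ differ by a super-curl: there are superfields $\mathcal B'_A$ with $$\mathcal F'_{AB}=\mathcal F_{AB}+\partial_A\mathcal B'_B-(-)^{AB}\partial_B\mathcal B'_A\qquad\text{for all }(A,B)\ne(+,+),(-,-).$$ -/

import Mathlib

open scoped TensorProduct
open TopologicalSpace

namespace BRST

noncomputable section

/-! ## Smooth functions on an open subset of `ℝ^ι` -/

/-- Extension by zero of a function on an open set. -/
def ext {ι : Type} {O : Opens (ι → ℝ)} (f : O → ℝ) : (ι → ℝ) → ℝ :=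
  Function.extend Subtype.val f 0

theorem ext_apply {ι : Type} {O : Opens (ι → ℝ)} (f : O → ℝ) (x : ι → ℝ) (hx : x ∈ O) :
    ext f x = f ⟨x, hx⟩ :=
  Subtype.val_injective.extend_apply f 0 ⟨x, hx⟩

/-- The algebra `C^∞(O)` of smooth real functions on the open set `O ⊆ ℝ^ι`. -/
def SmoothFun {ι : Type} [Fintype ι] (O : Opens (ι → ℝ)) : Subalgebra ℝ (O → ℝ) where
  carrier := {f | ContDiffOn ℝ (⊤ : ℕ∞) (ext f) O}
  mul_mem' := by
    intro f g hf hg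
    refine (ContDiffOn.mul hf hg).congr fun x hx => ?_
    simp [ext_apply _ x hx]
  add_mem' := by
    intro f g hf hg
    refine (ContDiffOn.add hf hg).congr fun x hx => ?_
    simp [ext_apply _ x hx]
  algebraMap_mem' := by
    intro r
    refine (contDiffOn_const (c := r)).congr fun x hx => ?_
    simp [ext_apply _ x hx]

theorem mem_smoothFun_of {ι : Type} [Fintype ι] {O : Opens (ι → ℝ)} (f : O → ℝ)
    (g : (ι → ℝ) → ℝ) (hg : ContDiffOn ℝ (⊤ : ℕ∞) g O) (h : ∀ x : O, f x = g x) :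
    f ∈ SmoothFun O :=
  hg.congr fun x hx => by rw [ext_apply f x hx, h ⟨x, hx⟩]

open Classical in
/-- The partial derivative `∂/∂x^i` on `C^∞(O)`. -/
def partialD {ι : Type} [Fintype ι] (O : Opens (ι → ℝ)) (i : ι) :
    SmoothFun O →ₗ[ℝ] SmoothFun O where
  toFun f := ⟨fun x => fderiv ℝ (ext f.1) x.1 (Pi.single i 1),
    mem_smoothFun_of _ (fun x => fderiv ℝ (ext f.1) x (Pi.single i 1))
      ((ContDiffOn.fderiv_of_isOpen (m := (⊤ : ℕ∞)) f.2 O.isOpen (by simp)).clm_apply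
        contDiffOn_const) (fun _ => rfl)⟩
  map_add' := by
    intro f g
    ext x
    have hd : ∀ h : SmoothFun O, DifferentiableAt ℝ (ext h.1) x.1 := fun h =>
      (ContDiffOn.contDiffAt h.2 (O.isOpen.mem_nhds x.2)).differentiableAt (by simp)
    have he : ext (f.1 + g.1) =ᶠ[nhds x.1] ext f.1 + ext g.1 := by
      filter_upwards [O.isOpen.mem_nhds x.2] with y hy
      simp [ext_apply _ y hy]
    simp [he.fderiv_eq, fderiv_add (hd f) (hd g)]
  map_smul' := by
    intro r f
    ext x
    have hd : DifferentiableAt ℝ (ext f.1) x.1 :=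
      (ContDiffOn.contDiffAt f.2 (O.isOpen.mem_nhds x.2)).differentiableAt (by simp)
    have he : ext (r • f.1) =ᶠ[nhds x.1] r • ext f.1 := by
      filter_upwards [O.isOpen.mem_nhds x.2] with y hy
      simp [ext_apply _ y hy]
    simp [he.fderiv_eq, fderiv_const_smul hd r]

/-! ## Local functions of the fields

`U ⊆ ℝ^D` is the range of the matter fields `X^μ`. Throughout, the world-sheet indices `+` and `-`
are encoded by `true` and `false`. -/

/-- The bosonic fields: `inl μ` is `X^μ`, `inr true` is `h_{++}`, `inr false` is `h_{--}`. -/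
abbrev Boson (D : ℕ) : Type := Fin D ⊕ Bool

/-- Labels of the derivatives `∂_+^m ∂_-^n`, `(m, n) ≠ (0, 0)`, of the bosonic fields. -/
abbrev DerJet (D : ℕ) : Type := Boson D × {p : ℕ × ℕ // p ≠ (0, 0)}

/-- Labels of the ghosts and their derivatives: `(α, m, n)` is `∂_+^m ∂_-^n c^α`. -/
abbrev GhostJet : Type := Bool × ℕ × ℕ

variable {D : ℕ}

/-- The allowed values of the undifferentiated bosonic fields: `X ∈ U` and
`y = h_{++} h_{--} ≠ 1`. -/
def fieldRange (U : Opens (Fin D → ℝ)) : Opens (Boson D → ℝ) where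
  carrier := {v | (fun μ => v (Sum.inl μ)) ∈ U ∧ v (Sum.inr true) * v (Sum.inr false) ≠ 1}
  is_open' := by
    refine IsOpen.inter (U.isOpen.preimage (by fun_prop)) ?_
    exact isOpen_ne_fun (by fun_prop) (by fun_prop)

/-- The algebra of antifield independent local functions: smooth in the undifferentiated `X^μ`,
`h_{±±}`, polynomial in their derivatives and in the anticommuting ghosts and their derivatives. -/
def LocalFun (U : Opens (Fin D → ℝ)) : Type :=
  SmoothFun (fieldRange U) ⊗[ℝ]
    (MvPolynomial (DerJet D) ℝ ⊗[ℝ] ExteriorAlgebra ℝ (GhostJet →₀ ℝ))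

instance (U : Opens (Fin D → ℝ)) : Ring (LocalFun U) :=
  inferInstanceAs (Ring (SmoothFun (fieldRange U) ⊗[ℝ]
    (MvPolynomial (DerJet D) ℝ ⊗[ℝ] ExteriorAlgebra ℝ (GhostJet →₀ ℝ))))

instance (U : Opens (Fin D → ℝ)) : Algebra ℝ (LocalFun U) :=
  inferInstanceAs (Algebra ℝ (SmoothFun (fieldRange U) ⊗[ℝ]
    (MvPolynomial (DerJet D) ℝ ⊗[ℝ] ExteriorAlgebra ℝ (GhostJet →₀ ℝ))))

/-- The product `f · p · γ` of a smooth function `f` of the undifferentiated bosonic fields, a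
polynomial `p` in their derivatives and a Grassmann polynomial `γ` in the ghost variables. -/
def LocalFun.mk {U : Opens (Fin D → ℝ)} (f : SmoothFun (fieldRange U))
    (p : MvPolynomial (DerJet D) ℝ) (γ : ExteriorAlgebra ℝ (GhostJet →₀ ℝ)) : LocalFun U :=
  f ⊗ₜ[ℝ] (p ⊗ₜ[ℝ] γ)

variable {U : Opens (Fin D → ℝ)}

/-- Smooth functions of the undifferentiated bosonic fields as local functions. -/
def ofSmooth (f : SmoothFun (fieldRange U)) : LocalFun U := LocalFun.mk f 1 1

/-- The undifferentiated bosonic field with label `b`. -/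
def coord (U : Opens (Fin D → ℝ)) (b : Boson D) : SmoothFun (fieldRange U) :=
  ⟨fun v => v.1 b, mem_smoothFun_of _ (fun v => v b) (by fun_prop) (fun _ => rfl)⟩

/-- The function `1 / (1 - y)`, `y = h_{++} h_{--}`. -/
def invOneSubY (U : Opens (Fin D → ℝ)) : SmoothFun (fieldRange U) :=
  ⟨fun v => (1 - v.1 (Sum.inr true) * v.1 (Sum.inr false))⁻¹,
    mem_smoothFun_of _ (fun v => (1 - v (Sum.inr true) * v (Sum.inr false))⁻¹)
      (ContDiffOn.inv (by fun_prop) (fun v hv => sub_ne_zero.2 (Ne.symm hv.2)))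
      (fun _ => rfl)⟩

open Classical in
/-- `∂_+^m ∂_-^n φ_b` for the bosonic field with label `b`, where `p = (m, n)`. -/
def jet (b : Boson D) (p : ℕ × ℕ) : LocalFun U :=
  if h : p = (0, 0) then ofSmooth (coord U b)
  else LocalFun.mk 1 (MvPolynomial.X (b, ⟨p, h⟩)) 1

/-- `∂_+^m ∂_-^n c^α`, where `p = (m, n)`. -/
def ghost (α : Bool) (p : ℕ × ℕ) : LocalFun U :=
  LocalFun.mk 1 1 (ExteriorAlgebra.ι ℝ (Finsupp.single (α, p) 1))

/-- Partial derivative with respect to an undifferentiated bosonic field. -/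
def dField (b : Boson D) : LocalFun U →ₗ[ℝ] LocalFun U :=
  LinearMap.rTensor _ (partialD (fieldRange U) b)

/-- Partial derivative with respect to a derivative of a bosonic field. -/
def dJet (j : DerJet D) : LocalFun U →ₗ[ℝ] LocalFun U :=
  LinearMap.lTensor _ (LinearMap.rTensor _ (MvPolynomial.pderiv j).toLinearMap)

/-- Left derivative with respect to a ghost or a derivative of a ghost. -/
def dGhost (g : GhostJet) : LocalFun U →ₗ[ℝ] LocalFun U :=
  LinearMap.lTensor _ (LinearMap.lTensor _
    (CliffordAlgebra.contractLeft (Q := (0 : QuadraticForm ℝ (GhostJet →₀ ℝ)))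
      (Finsupp.lapply g)))

/-- The (anti)derivation sending `∂_+^m ∂_-^n φ_b` to `V b (m, n)` and `∂_+^m ∂_-^n c^α` to
`W α (m, n)`. A local function depends on finitely many generators, so the sums are finite. -/
def derivationOf (V : Boson D → ℕ × ℕ → LocalFun U) (W : Bool → ℕ × ℕ → LocalFun U)
    (ω : LocalFun U) : LocalFun U :=
  ∑ b, V b (0, 0) * dField b ω + ∑ᶠ j : DerJet D, V j.1 j.2.1 * dJet j ω
    + ∑ᶠ g : GhostJet, W g.1 g.2 * dGhost g ω

/-- `step α k (m, n)` raises by `k` the order of the derivative `∂_α` in `∂_+^m ∂_-^n`. -/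
def step (α : Bool) (k : ℕ) (p : ℕ × ℕ) : ℕ × ℕ :=
  if α then (p.1 + k, p.2) else (p.1, p.2 + k)

/-- The total derivative `∂_α` with respect to the world-sheet coordinate `x^α`. -/
def totalD (α : Bool) : LocalFun U → LocalFun U :=
  derivationOf (fun b p => jet b (step α 1 p)) (fun β p => ghost β (step α 1 p))

/-- `∇_α X^μ = ∂_α X^μ - h_{αα} ∂_{-α} X^μ`. -/
def nablaX (α : Bool) (μ : Fin D) : LocalFun U :=
  jet (Sum.inl μ) (step α 1 (0, 0))
    - jet (Sum.inr α) (0, 0) * jet (Sum.inl μ) (step (!α) 1 (0, 0))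

/-- BRST transformation of the undifferentiated bosonic fields:
`S X^μ = (1 - y)⁻¹ (c^+ ∇_+ X^μ + c^- ∇_- X^μ)`,
`S h_{αα} = ∇_α c^{-α} = ∂_α c^{-α} - h_{αα} ∂_{-α} c^{-α} + (∂_{-α} h_{αα}) c^{-α}`. -/
def brstBoson : Boson D → LocalFun U
  | Sum.inl μ => ofSmooth (invOneSubY U) *
      (ghost true (0, 0) * nablaX true μ + ghost false (0, 0) * nablaX false μ)
  | Sum.inr α => ghost (!α) (step α 1 (0, 0))
      - jet (Sum.inr α) (0, 0) * ghost (!α) (step (!α) 1 (0, 0))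
      + jet (Sum.inr α) (step (!α) 1 (0, 0)) * ghost (!α) (0, 0)

/-- BRST transformation of the undifferentiated ghosts: `S c^α = c^α ∂_α c^α`. -/
def brstGhost (α : Bool) : LocalFun U := ghost α (0, 0) * ghost α (step α 1 (0, 0))

/-- The operator `S` on antifield independent local functions (where it is the BRST operator):
the left antiderivation which commutes with `∂_±` and acts on the undifferentiated fields as
above. -/
def S : LocalFun U → LocalFun U :=
  derivationOf (fun b p => (totalD true)^[p.1] ((totalD false)^[p.2] (brstBoson b)))
    (fun α p => (totalD true)^[p.1] ((totalD false)^[p.2] (brstGhost α)))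

/-! ## Covariant ghosts, chiral tensor fields and the space `C^Φ` -/

/-- The covariant ghost variables, with the index shifted by one:
`covGhost α k = c^α_{k-1} = (∂_α)^k c^α / k!`, `k = 0, 1, 2, …`. -/
def covGhost (α : Bool) (k : ℕ) : LocalFun U :=
  ((Nat.factorial k : ℝ)⁻¹) • ghost α (step α k (0, 0))

/-- `∂/∂c^α_{k-1}` for the covariant ghost variables (index shifted as in `covGhost`). -/
def dCovGhost (α : Bool) (k : ℕ) (ω : LocalFun U) : LocalFun U :=
  (Nat.factorial k : ℝ) • dGhost (α, step α k (0, 0)) ω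

/-- The Virasoro operators `L^α_{k-1} = (∂/∂c^α_{k-1}) S + S (∂/∂c^α_{k-1})`. -/
def virasoro (α : Bool) (k : ℕ) (ω : LocalFun U) : LocalFun U :=
  dCovGhost α k (S ω) + S (dCovGhost α k ω)

/-- The chiral tensor fields `X^μ_{m,n} = ((∂/∂c^+) S)^m ((∂/∂c^-) S)^n X^μ`. -/
def chiralX (μ : Fin D) (m n : ℕ) : LocalFun U :=
  (fun ω => dCovGhost true 0 (S ω))^[m]
    ((fun ω => dCovGhost false 0 (S ω))^[n] (jet (Sum.inl μ) (0, 0)))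

/-- A smooth function `f(X)` of the matter fields alone, as a local function. -/
def ofX (f : SmoothFun U) : LocalFun U :=
  ofSmooth ⟨fun v => f.1 ⟨fun μ => v.1 (Sum.inl μ), v.2.1⟩,
    mem_smoothFun_of _ (fun v => ext f.1 (fun μ => v (Sum.inl μ)))
      (ContDiffOn.comp (t := (U : Set (Fin D → ℝ))) f.2
        (f := fun (v : Boson D → ℝ) (μ : Fin D) => v (Sum.inl μ)) (by fun_prop)
        (fun v hv => hv.1))
      (fun v => (ext_apply f.1 _ v.2.1).symm)⟩

/-- The local functions `ω(c^α_m, X^μ_{m,n})` of the covariant ghost variables and of the antifield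
independent chiral tensor fields, smooth in `X^μ = X^μ_{0,0}`, polynomial in all the others. -/
def covariantFun (U : Opens (Fin D → ℝ)) : Subalgebra ℝ (LocalFun U) :=
  Algebra.adjoin ℝ
    (Set.range (ofX : SmoothFun U → LocalFun U)
      ∪ Set.range (fun p : Fin D × ℕ × ℕ => chiralX p.1 p.2.1 p.2.2)
      ∪ Set.range (fun p : Bool × ℕ => covGhost p.1 p.2))

/-- The space `C^Φ`: antifield independent functions of the covariant ghost variables and of the
chiral tensor fields which are annihilated by `L^+_0` and `L^-_0`. -/
def CPhi (U : Opens (Fin D → ℝ)) : Set (LocalFun U) :=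
  {ω | ω ∈ covariantFun U ∧ virasoro true 1 ω = 0 ∧ virasoro false 1 ω = 0}

/-! ## Superfields -/

/-- Superfields `H(z)`: `H a b ∈ C^∞(U)` is the coefficient of `(Θ^+)^a (Θ^-)^b`, with exponent
`1` for `true` and `0` for `false`. -/
abbrev Superfield (U : Opens (Fin D → ℝ)) : Type := Bool → Bool → SmoothFun U

/-- Superspace indices `A`: `inl μ` for `z^μ = X^μ`, `inr α` for `z^α = Θ^α`. -/
abbrev SIndex (D : ℕ) : Type := Fin D ⊕ Bool

/-- `Θ^α = c^α_0`. -/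
def Theta (α : Bool) : LocalFun U := covGhost α 1

/-- The superfield as a local function:
`H(X) + H^+(X) Θ^+ + H^-(X) Θ^- + H^{+-}(X) Θ^+ Θ^-`. -/
def Superfield.eval (H : Superfield U) : LocalFun U :=
  ofX (H false false) + ofX (H true false) * Theta true + ofX (H false true) * Theta false
    + ofX (H true true) * (Theta true * Theta false)

/-- The derivative `∂_A = ∂/∂z^A` of superfields (a left derivative for `z^A = Θ^±`). -/
def sderiv : SIndex D → Superfield U → Superfield U
  | Sum.inl μ, H => fun a b => partialD U μ (H a b)
  | Sum.inr true, H => fun a b => if a then 0 else H true b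
  | Sum.inr false, H => fun a b => if b then 0 else if a then -H a true else H a true

/-- The sign `(-)^A`: `1` for `A = μ` and `-1` for `A = ±`. -/
def sgn : SIndex D → ℝ
  | Sum.inl _ => 1
  | Sum.inr _ => -1

/-- The sign `(-)^{AB}`: `-1` if both `z^A` and `z^B` are odd, else `1`. -/
def sgn₂ : SIndex D → SIndex D → ℝ
  | Sum.inr _, Sum.inr _ => -1
  | _, _ => 1

/-- The super-curl `∂_A B_B - (-)^{AB} ∂_B B_A`. -/
def superCurl (B : SIndex D → Superfield U) (i j : SIndex D) : Superfield U :=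
  sderiv i (B j) - sgn₂ i j • sderiv j (B i)

/-- `T^μ = c^+ X^μ_{1,0} + c^- X^μ_{0,1}` and `T^± = 2 c^±_{-1} c^±_1`. -/
def T : SIndex D → LocalFun U
  | Sum.inl μ => covGhost true 0 * chiralX μ 1 0 + covGhost false 0 * chiralX μ 0 1
  | Sum.inr α => (2 : ℝ) • (covGhost α 0 * covGhost α 2)

/-- `R^μ = c^+ X^μ_{1,0} - c^- X^μ_{0,1}`. -/
def R (μ : Fin D) : LocalFun U :=
  covGhost true 0 * chiralX μ 1 0 - covGhost false 0 * chiralX μ 0 1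

/-- The families `F_{AB}`: graded antisymmetric, `F_{AB} = -(-)^{AB} F_{BA}`, with
`F_{++} = F_{--} = 0`. -/
def IsSuperTwoForm (F : SIndex D → SIndex D → Superfield U) : Prop :=
  (∀ i j, F i j = -(sgn₂ i j • F j i)) ∧ ∀ α, F (Sum.inr α) (Sum.inr α) = 0

/-- The families `N_{μν}`: symmetric. -/
def IsSymm (N : Fin D → Fin D → Superfield U) : Prop := ∀ μ ν, N μ ν = N ν μ

/-- `ω⁰ + a_{++} T^+ Θ^+ + a_{--} T^- Θ^- - ½ T^A T^B F_{BA}(z) (-)^A + ½ R^μ T^ν N_{μν}(z)`,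
with `a true = a_{++}` and `a false = a_{--}`. -/
def representative (ω₀ : ℝ) (a : Bool → ℝ) (F : SIndex D → SIndex D → Superfield U)
    (N : Fin D → Fin D → Superfield U) : LocalFun U :=
  algebraMap ℝ (LocalFun U) ω₀
    + a true • (T (Sum.inr true) * Theta true) + a false • (T (Sum.inr false) * Theta false)
    - (1 / 2 : ℝ) • ∑ i : SIndex D, ∑ j : SIndex D, sgn i • (T i * T j * (F j i).eval)
    + (1 / 2 : ℝ) • ∑ μ : Fin D, ∑ ν : Fin D, R μ * T (Sum.inl ν) * (N μ ν).eval

end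

end BRST

/-!
Two facts carry the proof: an explicit description of `C^Φ`, and a super-Poincaré lemma.

*Weights.* The operators `L^±_0` are derivations for which the generators are eigenvectors:
`c^±_m` has weight `m` under `L^±_0`, `X^μ_{m,n}` has weight `m` under `L^+_0` and `n` under
`L^-_0`, and functions of `X^μ` have weight zero. Only the undifferentiated ghosts
`c^± = c^±_{-1}` have negative weight, and they are nilpotent. Hence a monomial of vanishing weights
contains, besides functions of `X^μ` and `Θ^± = c^±_0`, either no `c^α`, or `c^α` together with one
partner of weight one, which is `c^α_1` or `X^μ_{1,0}` (`X^μ_{0,1}` for `α = -`), or `c^+ c^-`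
together with `X^μ_{1,1}` or with one partner of each ghost. In other words, `C^Φ` is spanned over
the superfields by `1`, the one-forms `u^+_μ = c^+ X^μ_{1,0}`, `u^-_μ = c^- X^μ_{0,1}` and
`u^α = 2 c^α c^α_1`, the elements `c^+ c^- X^μ_{1,1}`, and the products `u^+_i u^-_j`, where `i` and
`j` run over the values `μ` and one further value for `u^α` (`mem_CPhi_iff`). It is even free on these
generators (`normalForm_eq_zero`), as one sees by evaluating at field configurations with
`h_{±±} = 0`.

*The differential.* On superfields `S` is the exterior derivative with `S X^μ = u^+_μ + u^-_μ` and
`S Θ^α = u^α`; moreover `S u^-_μ = -S u^+_μ = c^+ c^- X^μ_{1,1}`, and all other generators are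
cocycles (`S_normalForm`). The generators `c^+ c^- X^μ_{1,1}` therefore force a cocycle to have
equal coefficients of `u^+_μ` and `u^-_μ`, that is, to be a one-form in `T^A = S z^A` up to degree
two. The closed one-forms are exact by the Poincaré lemma on the star-shaped set `U`, except for
`T^α Θ^α`, which is closed because `T^α T^α = 0` but has no primitive, since `Θ^α Θ^α = 0`
(`exists_formDeriv_eq`). Every two-form `u^+_i u^-_j G_{ij}` is a cocycle, and it is a coboundary if
and only if it is the exterior derivative of a one-form in `T^A`, so that its coefficients are a
super-curl (`curlCoeff_superIndex`). The graded antisymmetric and the symmetric part of `G` are the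
coefficients `F_{AB}` and `N_{μν}` of the representatives (`representative_eq`), and since
super-curls are graded antisymmetric, the symmetric part is unique.
-/

namespace BRST

noncomputable section

variable {D : ℕ} {U : Opens (Fin D → ℝ)}

/-! ### Calculus of smooth functions -/

section Smooth

variable {ι : Type} [Fintype ι] {O : Opens (ι → ℝ)}

theorem differentiableAt_ext (f : SmoothFun O) (x : O) : DifferentiableAt ℝ (ext f.1) x.1 :=
  (ContDiffOn.contDiffAt f.2 (O.isOpen.mem_nhds x.2)).differentiableAt (by simp)

theorem ext_partialD (i : ι) (f : SmoothFun O) (x : ι → ℝ) (hx : x ∈ O) [DecidableEq ι] :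
    ext (partialD O i f).1 x = fderiv ℝ (ext f.1) x (Pi.single i 1) := by
  rw [ext_apply _ x hx]
  simp only [partialD, LinearMap.coe_mk, AddHom.coe_mk]
  congr!

theorem partialD_mul (i : ι) (f g : SmoothFun O) :
    partialD O i (f * g) = partialD O i f * g + f * partialD O i g := by
  classical
  ext x
  have he : ext (f.1 * g.1) =ᶠ[nhds x.1] ext f.1 * ext g.1 := by
    filter_upwards [O.isOpen.mem_nhds x.2] with y hy
    simp [ext_apply _ y hy]
  simp [partialD, he.fderiv_eq, fderiv_mul (differentiableAt_ext f x) (differentiableAt_ext g x),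
    ext_apply _ x.1 x.2]
  ring

/-- Symmetry of the second derivatives. -/
theorem partialD_comm (i j : ι) (f : SmoothFun O) :
    partialD O i (partialD O j f) = partialD O j (partialD O i f) := by
  classical
  have key : ∀ i j : ι, ∀ x : O, (partialD O i (partialD O j f)).1 x
      = fderiv ℝ (fderiv ℝ (ext f.1)) x.1 (Pi.single i 1) (Pi.single j 1) := by
    intro i j x
    have he : ext (partialD O j f).1 =ᶠ[nhds x.1]
        fun y => fderiv ℝ (ext f.1) y (Pi.single j 1) := by
      filter_upwards [O.isOpen.mem_nhds x.2] with y hy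
      exact ext_partialD j f y hy
    have hd : DifferentiableAt ℝ (fderiv ℝ (ext f.1)) x.1 :=
      ((ContDiffOn.fderiv_of_isOpen (m := (⊤ : ℕ∞)) f.2 O.isOpen (by simp)).contDiffAt
        (O.isOpen.mem_nhds x.2)).differentiableAt (by simp)
    have h1 := ext_partialD i (partialD O j f) x.1 x.2
    rw [ext_apply _ x.1 x.2] at h1
    rw [h1, he.fderiv_eq, fderiv_clm_apply hd (differentiableAt_const _)]
    simp
  ext x
  rw [key, key]
  have hs : IsSymmSndFDerivAt ℝ (ext f.1) x.1 :=
    (ContDiffOn.contDiffAt f.2 (O.isOpen.mem_nhds x.2)).isSymmSndFDerivAt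
      (by
        rw [minSmoothness_of_isRCLikeNormedField]
        exact WithTop.coe_le_coe.2 (le_top : (2 : ℕ∞) ≤ ⊤))
  exact hs _ _

theorem partialD_one (i : ι) : partialD O i 1 = 0 := by
  have h := partialD_mul (O := O) i 1 1
  rw [mul_one, mul_one, one_mul] at h
  exact left_eq_add.1 h

theorem partialD_eq_of_hasFDerivAt [DecidableEq ι] (i : ι) (f : SmoothFun O) (g : (ι → ℝ) → ℝ)
    (x : O) (L : (ι → ℝ) →L[ℝ] ℝ) (hg : ∀ y : O, f.1 y = g y) (h : HasFDerivAt g L x.1) :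
    (partialD O i f).1 x = L (Pi.single i 1) := by
  have he : ext f.1 =ᶠ[nhds x.1] g := by
    filter_upwards [O.isOpen.mem_nhds x.2] with y hy
    rw [ext_apply _ y hy, hg]
  have h1 := ext_partialD i f x.1 x.2
  rw [ext_apply _ x.1 x.2] at h1
  rw [h1, he.fderiv_eq, h.fderiv]

end Smooth

/-! ### Generators of the algebra of local functions -/

theorem LocalFun.mk_mul (f f' : SmoothFun (fieldRange U)) (p p' : MvPolynomial (DerJet D) ℝ)
    (γ γ' : ExteriorAlgebra ℝ (GhostJet →₀ ℝ)) :
    LocalFun.mk f p γ * LocalFun.mk f' p' γ' = LocalFun.mk (f * f') (p * p') (γ * γ') := by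
  refine (Algebra.TensorProduct.tmul_mul_tmul f f' (p ⊗ₜ[ℝ] γ) (p' ⊗ₜ[ℝ] γ')).trans ?_
  rw [Algebra.TensorProduct.tmul_mul_tmul]
  rfl

theorem LocalFun.one_def : (1 : LocalFun U) = LocalFun.mk 1 1 1 := rfl

theorem LocalFun.induction_mk {P : LocalFun U → Prop} (hmk : ∀ f p γ, P (LocalFun.mk f p γ))
    (hadd : ∀ x y, P x → P y → P (x + y)) (ω : LocalFun U) : P ω := by
  have h0 : P 0 := by
    have := hmk 0 0 0
    rwa [show LocalFun.mk (0 : SmoothFun (fieldRange U)) 0 0 = 0 from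
      TensorProduct.zero_tmul _ _] at this
  refine TensorProduct.induction_on (motive := P) ω h0 (fun f x => ?_) (fun x y => hadd x y)
  refine TensorProduct.induction_on (motive := fun x => P (f ⊗ₜ x)) x ?_ (fun p γ => hmk f p γ)
    (fun x y hx hy => ?_)
  · rw [TensorProduct.tmul_zero]; exact h0
  · rw [TensorProduct.tmul_add]; exact hadd _ _ hx hy

/-- Local functions are generated, as a ring, by the smooth functions of the undifferentiated
bosonic fields, the derivatives of these fields, and the ghosts with their derivatives. -/
theorem LocalFun.induction {P : LocalFun U → Prop} (hsmooth : ∀ f, P (ofSmooth f))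
    (hjet : ∀ b p, P (jet b p)) (hghost : ∀ α p, P (ghost α p))
    (hadd : ∀ x y, P x → P y → P (x + y)) (hmul : ∀ x y, P x → P y → P (x * y))
    (ω : LocalFun U) : P ω := by
  have hC : ∀ r : ℝ, P (algebraMap ℝ (LocalFun U) r) := fun r => hsmooth _
  refine LocalFun.induction_mk (fun f p γ => ?_) hadd ω
  have hp : P (LocalFun.mk 1 p 1) := by
    induction p using MvPolynomial.induction_on with
    | C a =>
      convert hC a using 1
      rw [Algebra.algebraMap_eq_smul_one, LocalFun.one_def, ← mul_one (MvPolynomial.C a),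
        ← MvPolynomial.smul_eq_C_mul]
      exact (congrArg _ (TensorProduct.smul_tmul' ..).symm).trans (TensorProduct.tmul_smul ..)
    | add p q hp hq =>
      convert hadd _ _ hp hq using 1
      exact (congrArg _ (TensorProduct.add_tmul ..)).trans (TensorProduct.tmul_add ..)
    | mul_X p n hp =>
      have := hmul _ _ hp (hjet n.1 n.2.1)
      rwa [jet, dif_neg n.2.2, LocalFun.mk_mul, one_mul, one_mul] at this
  have hγ : P (LocalFun.mk 1 1 γ) := by
    have hadd' : ∀ γ γ' : ExteriorAlgebra ℝ (GhostJet →₀ ℝ), P (LocalFun.mk 1 1 γ) →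
        P (LocalFun.mk 1 1 γ') → P (LocalFun.mk 1 1 (γ + γ')) := by
      intro γ γ' h h'
      convert hadd _ _ h h' using 1
      exact (congrArg _ (TensorProduct.tmul_add ..)).trans (TensorProduct.tmul_add ..)
    have hsmul : ∀ (r : ℝ) (γ : ExteriorAlgebra ℝ (GhostJet →₀ ℝ)), P (LocalFun.mk 1 1 γ) →
        P (LocalFun.mk 1 1 (r • γ)) := by
      intro r γ h
      convert hmul _ _ (hC r) h using 1
      rw [← Algebra.smul_def]
      exact (congrArg _ (TensorProduct.tmul_smul ..)).trans (TensorProduct.tmul_smul ..)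
    induction γ using ExteriorAlgebra.induction with
    | algebraMap r =>
      rw [Algebra.algebraMap_eq_smul_one]
      refine hsmul r 1 ?_
      have := hC 1
      rwa [map_one] at this
    | ι x =>
      induction x using Finsupp.induction_linear with
      | zero =>
        have := hsmul 0 1 (by have := hC 1; rwa [map_one] at this)
        rwa [zero_smul, ← map_zero (ExteriorAlgebra.ι ℝ)] at this
      | add x y hx hy => rw [map_add]; exact hadd' _ _ hx hy
      | single g r =>
        rw [← mul_one r, ← smul_eq_mul, ← Finsupp.smul_single, map_smul]
        exact hsmul r _ (hghost g.1 g.2)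
    | mul a b ha hb =>
      have := hmul _ _ ha hb
      rwa [LocalFun.mk_mul, one_mul, one_mul] at this
    | add a b ha hb => exact hadd' _ _ ha hb
  have := hmul _ _ (hmul _ _ (hsmooth f) hp) hγ
  rwa [ofSmooth, LocalFun.mk_mul, LocalFun.mk_mul, one_mul, mul_one, mul_one, mul_one, one_mul,
    one_mul] at this

@[simp] theorem ofSmooth_mul (f g : SmoothFun (fieldRange U)) :
    ofSmooth (f * g) = ofSmooth f * ofSmooth g := by
  rw [ofSmooth, ofSmooth, ofSmooth, LocalFun.mk_mul, one_mul, one_mul]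

@[simp] theorem ofSmooth_one : ofSmooth (1 : SmoothFun (fieldRange U)) = 1 := rfl

@[simp] theorem ofSmooth_add (f g : SmoothFun (fieldRange U)) :
    ofSmooth (f + g) = ofSmooth f + ofSmooth g := TensorProduct.add_tmul ..

@[simp] theorem ofSmooth_smul (r : ℝ) (g : SmoothFun (fieldRange U)) :
    ofSmooth (r • g) = r • ofSmooth g := (TensorProduct.smul_tmul' ..).symm

@[simp] theorem ofSmooth_zero : ofSmooth (0 : SmoothFun (fieldRange U)) = 0 := by
  have := ofSmooth_smul (0 : ℝ) (0 : SmoothFun (fieldRange U))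
  rwa [zero_smul, zero_smul] at this

theorem jet_zero (b : Boson D) : (jet b (0, 0) : LocalFun U) = ofSmooth (coord U b) := by
  simp [jet]

/-- The grade involution: it changes the sign of all ghosts. -/
def parity : LocalFun U →ₐ[ℝ] LocalFun U :=
  Algebra.TensorProduct.map (AlgHom.id ℝ (SmoothFun (fieldRange U)))
    (Algebra.TensorProduct.map (AlgHom.id ℝ (MvPolynomial (DerJet D) ℝ))
      (CliffordAlgebra.involute (Q := (0 : QuadraticForm ℝ (GhostJet →₀ ℝ)))))

theorem parity_mk (f : SmoothFun (fieldRange U)) (p γ) :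
    parity (LocalFun.mk f p γ) = LocalFun.mk f p (CliffordAlgebra.involute γ) := rfl

@[simp] theorem parity_ofSmooth (f : SmoothFun (fieldRange U)) :
    parity (ofSmooth f) = ofSmooth f := by
  rw [ofSmooth, parity_mk, map_one]

@[simp] theorem parity_jet (b : Boson D) (p) : parity (jet b p : LocalFun U) = jet b p := by
  rw [jet]
  split_ifs
  · simp
  · rw [parity_mk, map_one]

theorem LocalFun.mk_neg (f : SmoothFun (fieldRange U)) (p γ) :
    LocalFun.mk f p (-γ) = -LocalFun.mk f p γ := by
  have h : ∀ y : MvPolynomial (DerJet D) ℝ ⊗[ℝ] ExteriorAlgebra ℝ (GhostJet →₀ ℝ),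
    (f ⊗ₜ[ℝ] (-y) : SmoothFun (fieldRange U) ⊗[ℝ] _) = -(f ⊗ₜ[ℝ] y) := TensorProduct.tmul_neg f
  exact (congrArg _ (TensorProduct.tmul_neg ..)).trans (h _)

@[simp] theorem parity_ghost (α : Bool) (p) :
    parity (ghost α p : LocalFun U) = -ghost α p := by
  rw [ghost, parity_mk, ExteriorAlgebra.ι, CliffordAlgebra.involute_ι, LocalFun.mk_neg]

@[simp] theorem parity_parity (x : LocalFun U) : parity (parity x) = x := by
  induction x using LocalFun.induction <;> simp_all

theorem eq_zero_of_eq_neg {x : LocalFun U} (h : x = -x) : x = 0 := by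
  rw [eq_neg_iff_add_eq_zero, ← two_smul ℝ] at h
  exact (smul_eq_zero.1 h).resolve_left two_ne_zero

theorem ghost_mul_ghost (α β : Bool) (p q) :
    (ghost α p * ghost β q : LocalFun U) = -(ghost β q * ghost α p) := by
  rw [ghost, ghost, LocalFun.mk_mul, LocalFun.mk_mul, ← LocalFun.mk_neg]
  congr 1
  rw [eq_neg_iff_add_eq_zero]
  exact ExteriorAlgebra.ι_add_mul_swap _ _

theorem ghost_mul_self (α : Bool) (p) : (ghost α p * ghost α p : LocalFun U) = 0 :=
  eq_zero_of_eq_neg (ghost_mul_ghost α α p p)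

theorem LocalFun.mk_comm (f f' : SmoothFun (fieldRange U)) (p p') (γ) :
    Commute (LocalFun.mk f p 1) (LocalFun.mk f' p' γ) := by
  rw [commute_iff_eq, LocalFun.mk_mul, LocalFun.mk_mul, mul_comm f, mul_comm p, one_mul, mul_one]

theorem commute_mk (f : SmoothFun (fieldRange U)) (p) (x : LocalFun U) :
    Commute (LocalFun.mk f p 1) x :=
  LocalFun.induction_mk (fun _ _ _ => LocalFun.mk_comm ..) (fun _ _ h h' => h.add_right h') x

theorem commute_ofSmooth (f : SmoothFun (fieldRange U)) (x : LocalFun U) :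
    Commute (ofSmooth f) x := commute_mk ..

theorem commute_jet (b : Boson D) (p) (x : LocalFun U) : Commute (jet b p) x := by
  rw [jet]
  split_ifs
  exacts [commute_mk .., commute_mk ..]

theorem ghost_mul (α : Bool) (p) (x : LocalFun U) :
    ghost α p * x = parity x * ghost α p := by
  induction x using LocalFun.induction with
  | hsmooth f => rw [parity_ofSmooth, (commute_ofSmooth f _).eq]
  | hjet b q => rw [parity_jet, (commute_jet b q _).eq]
  | hghost β q => rw [parity_ghost, ghost_mul_ghost, neg_mul]
  | hadd x y hx hy => rw [mul_add, map_add, add_mul, hx, hy]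
  | hmul x y hx hy => rw [← mul_assoc, hx, mul_assoc, hy, map_mul, mul_assoc]

/-- The even part `½ (x + parity x)` of `x` is central, the odd part `½ (x - parity x)`
supercommutes. Both have to be carried through the induction over products. -/
theorem even_odd_part (x : LocalFun U) :
    (∀ a, Commute (x + parity x) a) ∧
      ∀ a, (x - parity x) * a = parity a * (x - parity x) := by
  induction x using LocalFun.induction with
  | hsmooth f =>
    rw [parity_ofSmooth]
    exact ⟨fun a => (commute_ofSmooth f a).add_left (commute_ofSmooth f a), by simp⟩
  | hjet b q =>
    rw [parity_jet]
    exact ⟨fun a => (commute_jet b q a).add_left (commute_jet b q a), by simp⟩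
  | hghost β q =>
    rw [parity_ghost]
    refine ⟨by simp, fun a => ?_⟩
    rw [sub_neg_eq_add, add_mul, mul_add, ghost_mul]
  | hadd x y hx hy =>
    constructor
    · intro a
      rw [map_add, add_add_add_comm]
      exact (hx.1 a).add_left (hy.1 a)
    · intro a
      rw [map_add, add_sub_add_comm, add_mul, hx.2, hy.2, mul_add]
  | hmul x y hx hy =>
    -- The even part of `x y` is `x₀ y₀ + x₁ y₁` and the odd part is `x₀ y₁ + x₁ y₀`, if `x₀`, `x₁`
    -- and `y₀`, `y₁` are the parts of `x` and `y`; here every part is multiplied by two.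
    obtain ⟨x0, x1⟩ := hx
    obtain ⟨y0, y1⟩ := hy
    have h2 : ∀ z w : LocalFun U, z + z = w + w → z = w := by
      intro z w h
      have : (2 : ℝ) • z = (2 : ℝ) • w := by rw [two_smul, two_smul, h]
      exact smul_right_injective _ (two_ne_zero) this
    have e0 : (x * y + parity (x * y)) + (x * y + parity (x * y))
        = (x + parity x) * (y + parity y) + (x - parity x) * (y - parity y) := by
      rw [map_mul]; noncomm_ring
    have e1 : (x * y - parity (x * y)) + (x * y - parity (x * y))
        = (x + parity x) * (y - parity y) + (x - parity x) * (y + parity y) := by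
      rw [map_mul]; noncomm_ring
    generalize x + parity x = u at *
    generalize x - parity x = v at *
    generalize y + parity y = u' at *
    generalize y - parity y = v' at *
    constructor
    · intro a
      refine h2 _ _ ?_
      have : v * v' * a = a * (v * v') := by
        rw [mul_assoc, y1, ← mul_assoc, x1, parity_parity, mul_assoc]
      rw [← add_mul, ← mul_add, e0, add_mul, mul_add, this,
        ((x0 a).mul_left (y0 a)).eq]
    · intro a
      refine h2 _ _ ?_
      rw [← add_mul, ← mul_add, e1, add_mul, mul_add, mul_assoc, y1, ← mul_assoc, (x0 _).eq,
        mul_assoc, mul_assoc v, (y0 a).eq, ← mul_assoc v, x1 a, mul_assoc]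

/-- Even elements are central. -/
theorem commute_of_parity {x : LocalFun U} (hx : parity x = x) (a : LocalFun U) : Commute x a := by
  have h := (even_odd_part x).1 a
  rw [hx, ← two_smul ℝ x] at h
  have := h.smul_left (2⁻¹ : ℝ)
  rwa [smul_smul, inv_mul_cancel₀ two_ne_zero, one_smul] at this

/-- Supercommutation rule for an odd element. -/
theorem odd_mul {x : LocalFun U} (hx : parity x = -x) (a : LocalFun U) :
    x * a = parity a * x := by
  have h := (even_odd_part x).2 a
  rw [hx, sub_neg_eq_add, ← two_smul ℝ x, smul_mul_assoc, mul_smul_comm] at h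
  exact smul_right_injective _ (two_ne_zero : (2 : ℝ) ≠ 0) h

theorem odd_mul_self {x : LocalFun U} (hx : parity x = -x) : x * x = 0 := by
  have h := odd_mul hx x
  rw [hx, neg_mul] at h
  exact eq_zero_of_eq_neg h

theorem odd_mul_odd {x y : LocalFun U} (hx : parity x = -x) (hy : parity y = -y) :
    x * y = -(y * x) := by
  rw [odd_mul hx, hy, neg_mul]

/-! ### Partial derivatives of local functions -/

theorem dField_mk (b : Boson D) (f : SmoothFun (fieldRange U)) (p γ) :
    dField b (LocalFun.mk f p γ) = LocalFun.mk (partialD _ b f) p γ := rfl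

theorem dJet_mk (j : DerJet D) (f : SmoothFun (fieldRange U)) (p γ) :
    dJet j (LocalFun.mk f p γ) = LocalFun.mk f (MvPolynomial.pderiv j p) γ := rfl

theorem dGhost_mk (g : GhostJet) (f : SmoothFun (fieldRange U)) (p γ) :
    dGhost g (LocalFun.mk f p γ) = LocalFun.mk f p
      (CliffordAlgebra.contractLeft (Q := (0 : QuadraticForm ℝ (GhostJet →₀ ℝ)))
      (Finsupp.lapply g) γ) := rfl

theorem LocalFun.mk_add_left (f f' : SmoothFun (fieldRange U)) (p γ) :
    LocalFun.mk (f + f') p γ = LocalFun.mk f p γ + LocalFun.mk f' p γ :=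
  TensorProduct.add_tmul ..

theorem LocalFun.mk_add_mid (f : SmoothFun (fieldRange U)) (p p' γ) :
    LocalFun.mk f (p + p') γ = LocalFun.mk f p γ + LocalFun.mk f p' γ :=
  (congrArg _ (TensorProduct.add_tmul ..)).trans (TensorProduct.tmul_add ..)

theorem LocalFun.mk_add_right (f : SmoothFun (fieldRange U)) (p γ γ') :
    LocalFun.mk f p (γ + γ') = LocalFun.mk f p γ + LocalFun.mk f p γ' :=
  (congrArg _ (TensorProduct.tmul_add ..)).trans (TensorProduct.tmul_add ..)

theorem LocalFun.mk_zero_left (p γ) : LocalFun.mk (0 : SmoothFun (fieldRange U)) p γ = 0 :=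
  TensorProduct.zero_tmul ..

theorem LocalFun.mk_zero_mid (f : SmoothFun (fieldRange U)) (γ) : LocalFun.mk f 0 γ = 0 :=
  (congrArg _ (TensorProduct.zero_tmul ..)).trans (TensorProduct.tmul_zero ..)

theorem LocalFun.mk_zero_right (f : SmoothFun (fieldRange U)) (p) : LocalFun.mk f p 0 = 0 :=
  (congrArg _ (TensorProduct.tmul_zero ..)).trans (TensorProduct.tmul_zero ..)

theorem dField_mul (b : Boson D) (x y : LocalFun U) :
    dField b (x * y) = dField b x * y + x * dField b y := by
  induction x using LocalFun.induction_mk with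
  | hadd x x' h h' => rw [add_mul, map_add, h, h', map_add]; noncomm_ring
  | hmk f p γ =>
    induction y using LocalFun.induction_mk with
    | hadd y y' h h' => rw [mul_add, map_add, h, h', map_add]; noncomm_ring
    | hmk f' p' γ' =>
      simp only [LocalFun.mk_mul, dField_mk, partialD_mul, LocalFun.mk_add_left]

theorem dJet_mul (j : DerJet D) (x y : LocalFun U) :
    dJet j (x * y) = dJet j x * y + x * dJet j y := by
  induction x using LocalFun.induction_mk with
  | hadd x x' h h' => rw [add_mul, map_add, h, h', map_add]; noncomm_ring
  | hmk f p γ =>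
    induction y using LocalFun.induction_mk with
    | hadd y y' h h' => rw [mul_add, map_add, h, h', map_add]; noncomm_ring
    | hmk f' p' γ' =>
      simp only [LocalFun.mk_mul, dJet_mk, Derivation.leibniz, LocalFun.mk_add_mid, smul_eq_mul]
      rw [add_comm, mul_comm p']

/-- The contraction with a linear form is an antiderivation. -/
theorem contractLeft_mul {M : Type*} [AddCommGroup M] [Module ℝ M] {Q : QuadraticForm ℝ M}
    (d : Module.Dual ℝ M) (x y : CliffordAlgebra Q) :
    CliffordAlgebra.contractLeft d (x * y)
      = CliffordAlgebra.contractLeft d x * y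
        + CliffordAlgebra.involute x * CliffordAlgebra.contractLeft d y := by
  induction x using CliffordAlgebra.induction generalizing y with
  | algebraMap r => simp [CliffordAlgebra.contractLeft_algebraMap_mul]
  | ι v =>
    rw [CliffordAlgebra.contractLeft_ι_mul, CliffordAlgebra.contractLeft_ι,
      CliffordAlgebra.involute_ι, Algebra.smul_def]
    noncomm_ring
  | add a b ha hb => simp only [add_mul, map_add, ha, hb]; abel
  | mul a b ha hb =>
    rw [mul_assoc, ha, hb, ha, map_mul]
    noncomm_ring

theorem dGhost_mul (g : GhostJet) (x y : LocalFun U) :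
    dGhost g (x * y) = dGhost g x * y + parity x * dGhost g y := by
  induction x using LocalFun.induction_mk with
  | hadd x x' h h' => rw [add_mul, map_add, h, h', map_add, map_add]; noncomm_ring
  | hmk f p γ =>
    induction y using LocalFun.induction_mk with
    | hadd y y' h h' => rw [mul_add, map_add, h, h', map_add]; noncomm_ring
    | hmk f' p' γ' =>
      rw [LocalFun.mk_mul, dGhost_mk, contractLeft_mul, LocalFun.mk_add_right, parity_mk,
        dGhost_mk, dGhost_mk, LocalFun.mk_mul, LocalFun.mk_mul]

@[simp] theorem dField_ofSmooth (b : Boson D) (f : SmoothFun (fieldRange U)) :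
    dField b (ofSmooth f) = ofSmooth (partialD _ b f) := rfl

@[simp] theorem dField_ghost (b : Boson D) (α p) : dField b (ghost α p : LocalFun U) = 0 := by
  rw [ghost, dField_mk, partialD_one, LocalFun.mk_zero_left]

theorem dField_jet_ne (b c : Boson D) (p) (h : p ≠ (0, 0)) :
    dField b (jet c p : LocalFun U) = 0 := by
  rw [jet, dif_neg h, dField_mk, partialD_one, LocalFun.mk_zero_left]

@[simp] theorem dJet_ofSmooth (j : DerJet D) (f : SmoothFun (fieldRange U)) :
    dJet j (ofSmooth f) = 0 := by
  rw [ofSmooth, dJet_mk, Derivation.map_one_eq_zero, LocalFun.mk_zero_mid]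

@[simp] theorem dJet_ghost (j : DerJet D) (α p) : dJet j (ghost α p : LocalFun U) = 0 := by
  rw [ghost, dJet_mk, Derivation.map_one_eq_zero, LocalFun.mk_zero_mid]

open Classical in
theorem dJet_jet (j : DerJet D) (b : Boson D) (p) :
    dJet j (jet b p : LocalFun U) = if (j.1, j.2.1) = (b, p) then 1 else 0 := by
  by_cases h : p = (0, 0)
  · subst h
    rw [jet_zero, dJet_ofSmooth, if_neg]
    intro h
    exact j.2.2 (Prod.ext_iff.1 h).2
  · rw [jet, dif_neg h, dJet_mk, MvPolynomial.pderiv_X]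
    by_cases hj : j = (b, ⟨p, h⟩)
    · subst hj
      simp [LocalFun.one_def]
    · rw [Pi.single_eq_of_ne (fun h => hj h.symm), LocalFun.mk_zero_mid, if_neg]
      rintro h'
      apply hj
      rw [Prod.ext_iff] at h'
      exact Prod.ext h'.1 (Subtype.ext h'.2)

@[simp] theorem dGhost_ofSmooth (g : GhostJet) (f : SmoothFun (fieldRange U)) :
    dGhost g (ofSmooth f) = 0 := by
  rw [ofSmooth, dGhost_mk, CliffordAlgebra.contractLeft_one, LocalFun.mk_zero_right]

@[simp] theorem dGhost_jet (g : GhostJet) (b : Boson D) (p) :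
    dGhost g (jet b p : LocalFun U) = 0 := by
  rw [jet]
  split_ifs
  · rw [dGhost_ofSmooth]
  · rw [dGhost_mk, CliffordAlgebra.contractLeft_one, LocalFun.mk_zero_right]

open Classical in
theorem dGhost_ghost (g : GhostJet) (α p) :
    dGhost g (ghost α p : LocalFun U) = if g = (α, p) then 1 else 0 := by
  rw [ghost, dGhost_mk, ExteriorAlgebra.ι, CliffordAlgebra.contractLeft_ι]
  by_cases h : g = (α, p)
  · subst h
    simp [LocalFun.one_def]
  · rw [if_neg h, Finsupp.lapply_apply, Finsupp.single_eq_of_ne h, map_zero,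
      LocalFun.mk_zero_right]

@[simp] theorem dGhost_one (g : GhostJet) : dGhost g (1 : LocalFun U) = 0 := dGhost_ofSmooth g 1

theorem dJet_finite (x : LocalFun U) : {j | dJet j x ≠ 0}.Finite := by
  induction x using LocalFun.induction with
  | hsmooth f => simp
  | hghost α p => simp
  | hjet b p =>
    by_cases h : p = (0, 0)
    · subst h; simp [jet_zero]
    · refine (Set.finite_singleton (b, ⟨p, h⟩)).subset fun j hj => ?_
      rw [Set.mem_ofPred_eq, dJet_jet] at hj
      have := (ite_ne_right_iff.1 hj).1
      rw [Prod.ext_iff] at this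
      exact Prod.ext this.1 (Subtype.ext this.2)
  | hadd x y hx hy =>
    refine (hx.union hy).subset fun j hj => ?_
    by_contra h
    simp_all
  | hmul x y hx hy =>
    refine (hx.union hy).subset fun j hj => ?_
    by_contra h
    simp_all [dJet_mul]

theorem dGhost_finite (x : LocalFun U) : {g | dGhost g x ≠ 0}.Finite := by
  induction x using LocalFun.induction with
  | hsmooth f => simp
  | hjet b p => simp
  | hghost α p =>
    refine (Set.finite_singleton (α, p)).subset fun g hg => ?_
    rw [Set.mem_ofPred_eq, dGhost_ghost] at hg
    exact (ite_ne_right_iff.1 hg).1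
  | hadd x y hx hy =>
    refine (hx.union hy).subset fun j hj => ?_
    by_contra h
    simp_all
  | hmul x y hx hy =>
    refine (hx.union hy).subset fun j hj => ?_
    by_contra h
    simp_all [dGhost_mul]

theorem partialD_coord (b c : Boson D) [DecidableEq (Boson D)] :
    partialD (fieldRange U) b (coord U c) = if b = c then 1 else 0 := by
  ext v
  rw [partialD_eq_of_hasFDerivAt b (coord U c) (fun v => v c) v (ContinuousLinearMap.proj c)
    (fun _ => rfl) (ContinuousLinearMap.proj (R := ℝ) (φ := fun _ : Boson D => ℝ) c).hasFDerivAt]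
  by_cases h : b = c
  · subst h; simp
  · simp [h]

/-! ### (Anti)derivations given by their values on the generators -/

section derivationOf

variable (V : Boson D → ℕ × ℕ → LocalFun U) (W : Bool → ℕ × ℕ → LocalFun U)

theorem derivationOf_supp_jet (x : LocalFun U) :
    (Function.support fun j : DerJet D => V j.1 j.2.1 * dJet j x).Finite :=
  (dJet_finite x).subset fun j hj h => hj (by simp [h])

theorem derivationOf_supp_ghost (x : LocalFun U) :
    (Function.support fun g : GhostJet => W g.1 g.2 * dGhost g x).Finite :=
  (dGhost_finite x).subset fun j hj h => hj (by simp [h])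

theorem derivationOf_add (x y : LocalFun U) :
    derivationOf V W (x + y) = derivationOf V W x + derivationOf V W y := by
  simp only [derivationOf, map_add, mul_add, Finset.sum_add_distrib]
  rw [finsum_add_distrib (derivationOf_supp_jet V x) (derivationOf_supp_jet V y),
    finsum_add_distrib (derivationOf_supp_ghost W x) (derivationOf_supp_ghost W y)]
  abel

theorem derivationOf_smul (r : ℝ) (x : LocalFun U) :
    derivationOf V W (r • x) = r • derivationOf V W x := by
  simp only [derivationOf, map_smul, mul_smul_comm, smul_add, Finset.smul_sum, smul_finsum]

theorem derivationOf_ofSmooth (f : SmoothFun (fieldRange U)) :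
    derivationOf V W (ofSmooth f) = ∑ b, V b (0, 0) * ofSmooth (partialD _ b f) := by
  simp [derivationOf]

theorem derivationOf_jet (b : Boson D) (p : ℕ × ℕ) : derivationOf V W (jet b p) = V b p := by
  classical
  by_cases h : p = (0, 0)
  · subst h
    rw [jet_zero, derivationOf_ofSmooth, Finset.sum_eq_single b]
    · simp [partialD_coord]
    · intro c _ hc
      simp [partialD_coord, hc]
    · simp
  · rw [derivationOf, finsum_eq_single _ (b, ⟨p, h⟩)]
    · simp [dField_jet_ne _ _ _ h, dJet_jet]
    · intro j hj
      rw [dJet_jet, if_neg, mul_zero]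
      intro h'
      rw [Prod.ext_iff] at h'
      exact hj (Prod.ext h'.1 (Subtype.ext h'.2))

theorem derivationOf_ghost (α : Bool) (p : ℕ × ℕ) : derivationOf V W (ghost α p) = W α p := by
  classical
  rw [derivationOf, finsum_eq_single _ (α, p)]
  · simp [dGhost_ghost]
  · intro g hg
    rw [dGhost_ghost, if_neg hg, mul_zero]

variable {V W}

/-- Leibniz rule of `derivationOf V W`, for both parities: `q` is the identity if the `V b p` are
even and the `W α p` odd, and the grade involution if it is the other way round. -/
theorem derivationOf_mul (q : LocalFun U → LocalFun U) (hV : ∀ b p x, V b p * x = q x * V b p)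
    (hW : ∀ α p x, W α p * parity x = q x * W α p) (x y : LocalFun U) :
    derivationOf V W (x * y) = derivationOf V W x * y + q x * derivationOf V W y := by
  have h1 : ∀ b p (z w : LocalFun U), V b p * (z * y + x * w)
      = V b p * z * y + q x * (V b p * w) := by
    intro b p z w
    rw [mul_add, ← mul_assoc (V b p) x, hV b p x, mul_assoc (V b p), mul_assoc (q x)]
  have h2 : ∀ α p (z w : LocalFun U), W α p * (z * y + parity x * w)
      = W α p * z * y + q x * (W α p * w) := by
    intro b p z w
    rw [mul_add, ← mul_assoc (W b p) (parity x), hW, mul_assoc (W b p), mul_assoc (q x)]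
  simp only [derivationOf, dField_mul, dJet_mul, dGhost_mul]
  simp only [h1, h2, add_mul, mul_add, Finset.sum_add_distrib,
    Finset.sum_mul, Finset.mul_sum]
  have fj := derivationOf_supp_jet V x
  have fj' := derivationOf_supp_jet V y
  have fg := derivationOf_supp_ghost W x
  have fg' := derivationOf_supp_ghost W y
  rw [finsum_add_distrib (fj.subset fun j hj h => hj (by simp_all))
      (fj'.subset fun j hj h => hj (by simp_all)),
    finsum_add_distrib (fg.subset fun j hj h => hj (by simp_all))
      (fg'.subset fun j hj h => hj (by simp_all)),
    finsum_mul' _ _ fj, finsum_mul' _ _ fg, mul_finsum' _ _ fj', mul_finsum' _ _ fg']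
  abel

end derivationOf

/-! ### The total derivatives -/

@[simp] theorem step_zero (α : Bool) (p : ℕ × ℕ) : step α 0 p = p := by
  cases α <;> simp [step]

theorem step_comm (α β : Bool) (k l : ℕ) (p : ℕ × ℕ) :
    step α k (step β l p) = step β l (step α k p) := by
  cases α <;> cases β <;> simp [step, add_right_comm]

theorem step_step (α : Bool) (k l : ℕ) (p : ℕ × ℕ) :
    step α k (step α l p) = step α (l + k) p := by
  cases α <;> simp [step, add_assoc]

theorem step_one_ne_zero (α : Bool) (p : ℕ × ℕ) : step α 1 p ≠ (0, 0) := by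
  cases α <;> simp [step]

theorem step_injective (α : Bool) : Function.Injective (step α 1) := by
  intro p q h
  cases α <;> simpa [step, Prod.ext_iff] using h

@[simp] theorem totalD_add (α : Bool) (x y : LocalFun U) :
    totalD α (x + y) = totalD α x + totalD α y := derivationOf_add ..

@[simp] theorem totalD_smul (α : Bool) (r : ℝ) (x : LocalFun U) :
    totalD α (r • x) = r • totalD α x := derivationOf_smul ..

/-- `totalD` as a linear map. -/
def totalDL (α : Bool) : LocalFun U →ₗ[ℝ] LocalFun U where
  toFun := totalD α
  map_add' := totalD_add α
  map_smul' := totalD_smul α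

theorem totalDL_apply (α : Bool) (x : LocalFun U) : totalDL α x = totalD α x := rfl

@[simp] theorem totalD_zero (α : Bool) : totalD α (0 : LocalFun U) = 0 := by
  simp only [← totalDL_apply, map_zero]

@[simp] theorem totalD_neg (α : Bool) (x : LocalFun U) : totalD α (-x) = -totalD α x := by
  simp only [← totalDL_apply, map_neg]

@[simp] theorem totalD_sub (α : Bool) (x y : LocalFun U) :
    totalD α (x - y) = totalD α x - totalD α y := by
  simp only [← totalDL_apply, map_sub]

theorem totalD_sum (α : Bool) {κ : Type*} (s : Finset κ) (x : κ → LocalFun U) :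
    totalD α (∑ i ∈ s, x i) = ∑ i ∈ s, totalD α (x i) := by
  simp only [← totalDL_apply, map_sum]

@[simp] theorem totalD_jet (α : Bool) (b : Boson D) (p) :
    totalD α (jet b p : LocalFun U) = jet b (step α 1 p) := derivationOf_jet ..

@[simp] theorem totalD_ghost (α β : Bool) (p) :
    totalD α (ghost β p : LocalFun U) = ghost β (step α 1 p) := derivationOf_ghost ..

theorem totalD_ofSmooth (α : Bool) (f : SmoothFun (fieldRange U)) :
    totalD α (ofSmooth f)
      = ∑ b, jet b (step α 1 (0, 0)) * ofSmooth (partialD (fieldRange U) b f) :=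
  derivationOf_ofSmooth ..

theorem totalD_mul (α : Bool) (x y : LocalFun U) :
    totalD α (x * y) = totalD α x * y + x * totalD α y :=
  derivationOf_mul id (fun _ _ _ => commute_jet ..)
    (fun _ _ _ => by rw [ghost_mul, parity_parity, id]) x y

@[simp] theorem totalD_one (α : Bool) : totalD α (1 : LocalFun U) = 0 := by
  have h := totalD_mul α (1 : LocalFun U) 1
  rw [mul_one, mul_one, one_mul] at h
  exact left_eq_add.1 h

@[simp] theorem parity_totalD (α : Bool) (x : LocalFun U) :
    parity (totalD α x) = totalD α (parity x) := by
  induction x using LocalFun.induction with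
  | hsmooth f => simp [totalD_ofSmooth]
  | hjet b p => simp
  | hghost β p => simp
  | hadd x y hx hy => simp [hx, hy]
  | hmul x y hx hy => simp [totalD_mul, hx, hy]

theorem totalD_comm (α β : Bool) (x : LocalFun U) :
    totalD α (totalD β x) = totalD β (totalD α x) := by
  induction x using LocalFun.induction with
  | hsmooth f =>
    have key : ∀ α β : Bool, totalD α (totalD β (ofSmooth f))
        = ∑ b, jet b (step α 1 (step β 1 (0, 0))) * ofSmooth (partialD (fieldRange U) b f)
          + ∑ b, ∑ c, jet b (step β 1 (0, 0)) * (jet c (step α 1 (0, 0)) *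
            ofSmooth (partialD (fieldRange U) c (partialD (fieldRange U) b f))) := by
      intro α β
      simp only [totalD_ofSmooth, totalD_sum, totalD_mul, totalD_jet, Finset.sum_add_distrib,
        Finset.mul_sum]
    rw [key, key, Finset.sum_comm (γ := Boson D), step_comm]
    congr 1
    refine Finset.sum_congr rfl fun b _ => Finset.sum_congr rfl fun c _ => ?_
    rw [partialD_comm, ← mul_assoc, (commute_jet c _ _).eq, mul_assoc]
  | hjet b p => simp [step_comm]
  | hghost β p => simp [step_comm]
  | hadd x y hx hy => simp [hx, hy]
  | hmul x y hx hy => simp only [totalD_mul, totalD_add, hx, hy]; abel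

/-- The iterated total derivative `∂_+^m ∂_-^n`, where `p = (m, n)`. -/
def totalDs (p : ℕ × ℕ) (x : LocalFun U) : LocalFun U :=
  (totalD true)^[p.1] ((totalD false)^[p.2] x)

theorem iterate_totalD_comm (α β : Bool) (n : ℕ) (x : LocalFun U) :
    totalD α ((totalD β)^[n] x) = (totalD β)^[n] (totalD α x) :=
  (Function.Commute.iterate_right (fun x => totalD_comm α β x) n x)

@[simp] theorem totalDs_zero (x : LocalFun U) : totalDs (0, 0) x = x := rfl

theorem totalDs_step (α : Bool) (p : ℕ × ℕ) (x : LocalFun U) :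
    totalDs (step α 1 p) x = totalD α (totalDs p x) := by
  cases α
  · simp [step, totalDs, Function.iterate_succ_apply', iterate_totalD_comm]
  · simp [step, totalDs, Function.iterate_succ_apply']

/-- Induction over the orders of derivatives. -/
theorem orders_induction {P : ℕ × ℕ → Prop} (h0 : P (0, 0))
    (hs : ∀ α p, P p → P (step α 1 p)) (p : ℕ × ℕ) : P p := by
  obtain ⟨m, n⟩ := p
  induction m with
  | succ m ih => exact hs true (m, n) ih
  | zero =>
    induction n with
    | zero => exact h0
    | succ n ih => exact hs false (0, n) ih

@[simp] theorem totalDs_zero_right (p : ℕ × ℕ) : totalDs p (0 : LocalFun U) = 0 := by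
  induction p using orders_induction with
  | h0 => simp
  | hs α p ih => simp [totalDs_step, ih]

theorem totalDs_neg (p : ℕ × ℕ) (x : LocalFun U) : totalDs p (-x) = -totalDs p x := by
  induction p using orders_induction with
  | h0 => simp
  | hs α p ih => simp [totalDs_step, ih]

@[simp] theorem parity_totalDs (p : ℕ × ℕ) (x : LocalFun U) :
    parity (totalDs p x) = totalDs p (parity x) := by
  induction p using orders_induction with
  | h0 => simp
  | hs α p ih => simp [totalDs_step, ih]

/-! ### The BRST operator -/

@[simp] theorem parity_brstBoson (b : Boson D) :
    parity (brstBoson b : LocalFun U) = -brstBoson b := by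
  obtain μ | α := b
  · simp only [brstBoson, nablaX, map_mul, map_add, map_sub, parity_ofSmooth, parity_jet,
      parity_ghost]
    noncomm_ring
  · simp only [brstBoson, map_mul, map_add, map_sub, parity_jet, parity_ghost]
    noncomm_ring

@[simp] theorem parity_brstGhost (α : Bool) :
    parity (brstGhost α : LocalFun U) = brstGhost α := by
  simp [brstGhost]

@[simp] theorem S_add (x y : LocalFun U) : S (x + y) = S x + S y := derivationOf_add ..

@[simp] theorem S_smul (r : ℝ) (x : LocalFun U) : S (r • x) = r • S x := derivationOf_smul ..

/-- `S` as a linear map. -/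
def SL : LocalFun U →ₗ[ℝ] LocalFun U where
  toFun := S
  map_add' := S_add
  map_smul' := S_smul

theorem SL_apply (x : LocalFun U) : SL x = S x := rfl

@[simp] theorem S_zero : S (0 : LocalFun U) = 0 := by simp only [← SL_apply, map_zero]

@[simp] theorem S_neg (x : LocalFun U) : S (-x) = -S x := by simp only [← SL_apply, map_neg]

@[simp] theorem S_sub (x y : LocalFun U) : S (x - y) = S x - S y := by
  simp only [← SL_apply, map_sub]

theorem S_sum {κ : Type*} (s : Finset κ) (x : κ → LocalFun U) :
    S (∑ i ∈ s, x i) = ∑ i ∈ s, S (x i) := by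
  simp only [← SL_apply, map_sum]

@[simp] theorem S_jet (b : Boson D) (p) :
    S (jet b p : LocalFun U) = totalDs p (brstBoson b) := derivationOf_jet ..

@[simp] theorem S_ghost (α : Bool) (p) :
    S (ghost α p : LocalFun U) = totalDs p (brstGhost α) := derivationOf_ghost ..

theorem S_ofSmooth (f : SmoothFun (fieldRange U)) :
    S (ofSmooth f) = ∑ b, brstBoson b * ofSmooth (partialD (fieldRange U) b f) :=
  derivationOf_ofSmooth ..

/-- `S` is an antiderivation. -/
theorem S_mul (x y : LocalFun U) : S (x * y) = S x * y + parity x * S y := by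
  refine derivationOf_mul parity (fun b p x => odd_mul ?_ x) (fun α p x => ?_) x y
  · exact (parity_totalDs p _).trans (by rw [parity_brstBoson, totalDs_neg]; rfl)
  · refine commute_of_parity ?_ _
    exact (parity_totalDs p _).trans (by rw [parity_brstGhost]; rfl)

@[simp] theorem S_one : S (1 : LocalFun U) = 0 := by
  have h := S_mul (1 : LocalFun U) 1
  rw [mul_one, mul_one, map_one, one_mul] at h
  exact left_eq_add.1 h

@[simp] theorem parity_S (x : LocalFun U) : parity (S x) = -S (parity x) := by
  induction x using LocalFun.induction with
  | hsmooth f =>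
    simp only [S_ofSmooth, map_sum, map_mul, parity_brstBoson, neg_mul, Finset.sum_neg_distrib,
      parity_ofSmooth]
  | hjet b p => simp [totalDs_neg]
  | hghost β p => simp
  | hadd x y hx hy => simp [hx, hy, add_comm]
  | hmul x y hx hy => simp [S_mul, hx, hy, add_comm]

@[simp] theorem parity_dGhost (g : GhostJet) (x : LocalFun U) :
    parity (dGhost g x) = -dGhost g (parity x) := by
  classical
  induction x using LocalFun.induction with
  | hsmooth f => simp
  | hjet b p => simp
  | hghost β p =>
    rw [parity_ghost, map_neg, neg_neg, dGhost_ghost]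
    split_ifs <;> simp
  | hadd x y hx hy => simp [hx, hy, add_comm]
  | hmul x y hx hy => simp [dGhost_mul, hx, hy, add_comm]

/-- `S` commutes with the total derivatives. -/
theorem S_totalD (α : Bool) (x : LocalFun U) : S (totalD α x) = totalD α (S x) := by
  induction x using LocalFun.induction with
  | hsmooth f =>
    simp only [totalD_ofSmooth, S_ofSmooth, S_sum, totalD_sum, S_mul, totalD_mul, S_jet,
      totalDs_step, totalDs_zero, parity_jet, Finset.sum_add_distrib, Finset.mul_sum]
    congr 1
    rw [Finset.sum_comm]
    refine Finset.sum_congr rfl fun b _ => Finset.sum_congr rfl fun c _ => ?_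
    rw [partialD_comm, ← mul_assoc, (commute_jet c _ _).eq, mul_assoc]
  | hjet b p => simp [totalDs_step]
  | hghost β p => simp [totalDs_step]
  | hadd x y hx hy => simp [hx, hy]
  | hmul x y hx hy => simp only [totalD_mul, totalD_add, S_add, S_mul, hx, hy, parity_totalD]; abel

theorem S_totalDs (p : ℕ × ℕ) (x : LocalFun U) : S (totalDs p x) = totalDs p (S x) := by
  induction p using orders_induction with
  | h0 => simp
  | hs α p ih => simp [totalDs_step, ih, S_totalD]

theorem S_brstGhost (α : Bool) : S (brstGhost α : LocalFun U) = 0 := by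
  have h := ghost_mul_self (U := U) α (step α 1 (0, 0))
  have h' := ghost_mul_self (U := U) α (0, 0)
  simp only [brstGhost, S_mul, S_ghost, totalDs_step, totalDs_zero, totalD_mul, totalD_ghost,
    parity_ghost]
  linear_combination (norm := noncomm_ring) - h' * ghost α (step α 1 (step α 1 (0, 0)))

theorem S_brstBoson_inr (α : Bool) : S (brstBoson (Sum.inr α) : LocalFun U) = 0 := by
  obtain ⟨β, hβ⟩ : ∃ β, β = !α := ⟨_, rfl⟩
  have e1 : (brstBoson (Sum.inr α) : LocalFun U) = ghost β (step α 1 (0, 0))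
      - jet (Sum.inr α) (0, 0) * ghost β (step β 1 (0, 0))
      + jet (Sum.inr α) (step β 1 (0, 0)) * ghost β (0, 0) := by rw [brstBoson, hβ]
  have h1 := ghost_mul_self (U := U) β (step β 1 (0, 0))
  have h0 := ghost_mul_self (U := U) β (0, 0)
  have h2 := ghost_mul_ghost (U := U) β β (0, 0) (step β 1 (step β 1 (0, 0)))
  have h3 := ghost_mul_ghost (U := U) β β (0, 0) (step α 1 (step β 1 (0, 0)))
  rw [e1]
  simp only [S_mul, S_add, S_sub, S_ghost, S_jet, totalDs_step, totalDs_zero, totalD_mul,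
    totalD_add, totalD_sub, totalD_jet, totalD_ghost, parity_jet, brstGhost, e1,
    step_comm β α]
  linear_combination (norm := noncomm_ring) h3 - jet (Sum.inr α) (0, 0) * h2
    + jet (Sum.inr α) (step β 1 (step β 1 (0, 0))) * h0

/-! ### First covariant derivatives of the matter fields and nilpotency -/

/-- The first covariant derivative `(1 - y)⁻¹ ∇_α X^μ` of `X^μ`. -/
def covX (α : Bool) (μ : Fin D) : LocalFun U := ofSmooth (invOneSubY U) * nablaX α μ

/-- The mixed second covariant derivative
`(1 - y)⁻¹ (∂_α X_β - h_{αα} ∂_β X_β - (∂_β h_{αα}) X_β)`, `β = -α`, where `X_β = covX β μ`. -/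
def covXX (α : Bool) (μ : Fin D) : LocalFun U :=
  ofSmooth (invOneSubY U) * (totalD α (covX (!α) μ) -
    jet (Sum.inr α) (0, 0) * totalD (!α) (covX (!α) μ)
    - jet (Sum.inr α) (step (!α) 1 (0, 0)) * covX (!α) μ)

/-- The pure second covariant derivative
`(1 - y)⁻¹ (∂_α X_α - h_{αα} ∂_β X_α + h_{αα} (∂_α h_{ββ}) X_α)`, `β = -α`. -/
def covXSq (α : Bool) (μ : Fin D) : LocalFun U :=
  ofSmooth (invOneSubY U) * (totalD α (covX α μ) -
    jet (Sum.inr α) (0, 0) * totalD (!α) (covX α μ)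
    + jet (Sum.inr α) (0, 0) * (jet (Sum.inr !α) (step α 1 (0, 0)) * covX α μ))

theorem invOneSubY_mul (α : Bool) :
    (ofSmooth (invOneSubY U) : LocalFun U)
      * (1 - jet (Sum.inr α) (0, 0) * jet (Sum.inr !α) (0, 0)) = 1 := by
  have h : ∀ α : Bool, invOneSubY U * (1 - coord U (Sum.inr α) * coord U (Sum.inr !α)) = 1 := by
    intro α
    ext v
    have hv : v.1 (Sum.inr true) * v.1 (Sum.inr false) ≠ 1 := v.2.2
    have hv' : 1 - v.1 (Sum.inr true) * v.1 (Sum.inr false) ≠ 0 := sub_ne_zero.2 (Ne.symm hv)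
    cases α
    · simp only [coord, invOneSubY, MulMemClass.coe_mul, Pi.mul_apply, AddSubgroupClass.coe_sub,
        OneMemClass.coe_one, Pi.sub_apply, Pi.one_apply, Bool.not_false]
      rw [mul_comm (v.1 (Sum.inr false))]
      exact inv_mul_cancel₀ hv'
    · simp only [coord, invOneSubY, MulMemClass.coe_mul, Pi.mul_apply, AddSubgroupClass.coe_sub,
        OneMemClass.coe_one, Pi.sub_apply, Pi.one_apply, Bool.not_true]
      exact inv_mul_cancel₀ hv'
  have h1 := congrArg ofSmooth (h α)
  rw [ofSmooth_mul, sub_eq_add_neg, ofSmooth_add, ← neg_one_smul ℝ, ofSmooth_smul, ofSmooth_mul,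
    ofSmooth_one, neg_one_smul] at h1
  rw [jet_zero, jet_zero, sub_eq_add_neg]
  exact h1

theorem commute_invOneSubY (x : LocalFun U) : Commute (ofSmooth (invOneSubY U)) x :=
  commute_ofSmooth _ x

@[simp] theorem parity_covX (α : Bool) (μ : Fin D) :
    parity (covX α μ : LocalFun U) = covX α μ := by
  simp [covX, nablaX]

@[simp] theorem parity_covXX (α : Bool) (μ : Fin D) :
    parity (covXX α μ : LocalFun U) = covXX α μ := by
  simp [covXX]

/-- The covariant derivatives `X_± = covX ± μ` solve `∂_α X^μ = X_α + h_{αα} X_{-α}`. -/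
theorem jet_eq_covX (α : Bool) (μ : Fin D) :
    (jet (Sum.inl μ) (step α 1 (0, 0)) : LocalFun U)
      = covX α μ + jet (Sum.inr α) (0, 0) * covX (!α) μ := by
  have h1 := invOneSubY_mul (U := U) α
  have hc := (commute_invOneSubY (jet (Sum.inr α) (0, 0) : LocalFun U)).eq
  rw [covX, covX, nablaX, nablaX, Bool.not_not]
  linear_combination (norm := noncomm_ring) - h1 * jet (Sum.inl μ) (step α 1 (0, 0))
    + hc * jet (Sum.inl μ) (step (!α) 1 (0, 0))
    - hc * jet (Sum.inr !α) (0, 0) * jet (Sum.inl μ) (step α 1 (0, 0))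

/-- The mixed second covariant derivatives commute, because `∂_+` and `∂_-` do. -/
theorem covXX_comm (α : Bool) (μ : Fin D) :
    (covXX (!α) μ : LocalFun U) = covXX α μ := by
  have h1 := congrArg (totalD (!α)) (jet_eq_covX (U := U) α μ)
  have h2 := congrArg (totalD α) (jet_eq_covX (U := U) (!α) μ)
  simp only [totalD_jet, totalD_add, totalD_mul, Bool.not_not] at h1 h2
  rw [covXX, covXX, Bool.not_not]
  rw [step_comm] at h2
  rw [h1] at h2
  congr 1
  linear_combination (norm := noncomm_ring) h2

theorem S_X (α : Bool) (μ : Fin D) : (brstBoson (Sum.inl μ) : LocalFun U)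
    = ghost α (0, 0) * covX α μ + ghost (!α) (0, 0) * covX (!α) μ := by
  have key : (brstBoson (Sum.inl μ) : LocalFun U)
    = ghost true (0, 0) * covX true μ + ghost false (0, 0) * covX false μ := by
    rw [brstBoson, covX, covX, mul_add, ← mul_assoc, ← mul_assoc, (commute_invOneSubY _).eq,
      (commute_invOneSubY _).eq, mul_assoc, mul_assoc]
  cases α
  · rw [key, add_comm]; rfl
  · exact key

/-- `S` of the first covariant derivatives involves no ghost variables except `c^±` and
`∂_α c^α`. -/
theorem S_covX (α : Bool) (μ : Fin D) : S (covX α μ : LocalFun U)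
    = ghost α (step α 1 (0, 0)) * covX α μ + ghost α (0, 0) * covXSq α μ
      + ghost (!α) (0, 0) * covXX α μ := by
  obtain ⟨β, hβ⟩ : ∃ β, β = !α := ⟨_, rfl⟩
  have hβ' : (!β) = α := by rw [hβ, Bool.not_not]
  set u : LocalFun U := ofSmooth (invOneSubY U) with hu
  set h : LocalFun U := jet (Sum.inr α) (0, 0) with hh
  set k : LocalFun U := jet (Sum.inr β) (0, 0) with hk
  set c : LocalFun U := ghost α (0, 0) with hc
  set d : LocalFun U := ghost β (0, 0) with hd
  set X : LocalFun U := covX α μ with hX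
  set Y : LocalFun U := covX β μ with hY
  have hSX := S_X (U := U) α μ
  rw [← hβ, ← hc, ← hd, ← hX, ← hY] at hSX
  have ha : (jet (Sum.inl μ) (step α 1 (0, 0)) : LocalFun U) = X + h * Y := by
    rw [hX, hY, hh, hβ, jet_eq_covX]
  have hb : (jet (Sum.inl μ) (step β 1 (0, 0)) : LocalFun U) = Y + k * X := by
    rw [hX, hY, hk, jet_eq_covX, hβ']
  have hSh : S h = ghost β (step α 1 (0, 0)) - h * ghost β (step β 1 (0, 0))
      + jet (Sum.inr α) (step β 1 (0, 0)) * d := by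
    rw [hh, S_jet, totalDs_zero, brstBoson, ← hβ]
  have hSk : S k = ghost α (step β 1 (0, 0)) - k * ghost α (step α 1 (0, 0))
      + jet (Sum.inr β) (step α 1 (0, 0)) * c := by
    rw [hk, S_jet, totalDs_zero, brstBoson, hβ']
  have hSa := congrArg S ha
  have hSb := congrArg S hb
  rw [S_jet, totalDs_step, totalDs_zero, hSX, S_add, S_mul, hh, parity_jet, ← hh, totalD_add,
    totalD_mul, totalD_mul, hSh, hc, hd, totalD_ghost, totalD_ghost, ← hc, ← hd] at hSa
  rw [S_jet, totalDs_step, totalDs_zero, hSX, S_add, S_mul, hk, parity_jet, ← hk, totalD_add,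
    totalD_mul, totalD_mul, hSk, hc, hd, totalD_ghost, totalD_ghost, ← hc, ← hd] at hSb
  have h1 := invOneSubY_mul (U := U) α
  rw [← hβ, ← hh, ← hk, ← hu] at h1
  have hXSq : (covXSq α μ : LocalFun U) = u * (totalD α X - h * totalD β X
    + h * (jet (Sum.inr β) (step α 1 (0, 0)) * X)) := by rw [covXSq, ← hβ]
  have hXX : (covXX α μ : LocalFun U) = u * (totalD α Y - h * totalD β Y
    - jet (Sum.inr α) (step β 1 (0, 0)) * Y) := by rw [covXX, ← hβ]
  have uc : u * c = c * u := (commute_invOneSubY _).eq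
  have ud : u * d = d * u := (commute_invOneSubY _).eq
  have hcc : h * c = c * h := (commute_jet ..).eq
  have hdc : h * d = d * h := (commute_jet ..).eq
  have kc : jet (Sum.inr β) (step α 1 (0, 0)) * c = c * jet (Sum.inr β) (step α 1 (0, 0)) :=
    (commute_jet ..).eq
  have kd : jet (Sum.inr α) (step β 1 (0, 0)) * d = d * jet (Sum.inr α) (step β 1 (0, 0)) :=
    (commute_jet ..).eq
  rw [← hβ, ← hd, hXSq, hXX]
  -- The two relations for `∂_± X` determine `(1 - y) S X_α`; it remains to divide by `1 - y`.
  have hmain : (1 - h * k) * S X = (1 - h * k) * (ghost α (step α 1 (0, 0)) * X)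
      + c * (totalD α X - h * totalD β X + h * (jet (Sum.inr β) (step α 1 (0, 0)) * X))
      + d * (totalD α Y - h * totalD β Y - jet (Sum.inr α) (step β 1 (0, 0)) * Y) := by
    linear_combination (norm := noncomm_ring) h * hSb - hSa - hcc * totalD β X
      - hdc * totalD β Y - kd * Y + h * kc * X + hcc * (jet (Sum.inr β) (step α 1 (0, 0)) * X)
  calc S X = u * (1 - h * k) * S X := by rw [h1, one_mul]
    _ = u * (1 - h * k) * (ghost α (step α 1 (0, 0)) * X)
      + (u * c) * (totalD α X - h * totalD β X + h * (jet (Sum.inr β) (step α 1 (0, 0)) * X))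
      + (u * d) * (totalD α Y - h * totalD β Y - jet (Sum.inr α) (step β 1 (0, 0)) * Y) := by
      rw [mul_assoc, hmain]; noncomm_ring
    _ = _ := by rw [h1, one_mul, uc, ud, mul_assoc, mul_assoc]

theorem S_brstBoson (b : Boson D) : S (brstBoson b : LocalFun U) = 0 := by
  obtain μ | α := b
  · have e : (brstBoson (Sum.inl μ) : LocalFun U)
      = ghost true (0, 0) * covX true μ + ghost false (0, 0) * covX false μ := S_X true μ
    have h1 := ghost_mul_self (U := U) true (0, 0)
    have h2 := ghost_mul_self (U := U) false (0, 0)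
    have h3 := ghost_mul_ghost (U := U) true false (0, 0) (0, 0)
    have h4 := covXX_comm (U := U) true μ
    simp only [Bool.not_true] at h4
    rw [e, S_add, S_mul, S_mul, S_covX, S_covX, S_ghost, S_ghost, totalDs_zero, totalDs_zero,
      brstGhost, brstGhost, parity_ghost, parity_ghost, h4, Bool.not_true, Bool.not_false]
    linear_combination (norm := noncomm_ring) - h1 * covXSq true μ - h2 * covXSq false μ
      - h3 * covXX true μ
  · exact S_brstBoson_inr α

/-- The BRST operator squares to zero. -/
theorem S_S (x : LocalFun U) : S (S x) = 0 := by
  induction x using LocalFun.induction with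
  | hsmooth f =>
    simp only [S_ofSmooth, S_sum, S_mul, S_brstBoson, zero_mul, zero_add, parity_brstBoson,
      Finset.mul_sum]
    -- The odd `S φ_b` are contracted with the symmetric matrix of second derivatives.
    refine eq_zero_of_eq_neg ?_
    rw [← Finset.sum_neg_distrib, Finset.sum_comm]
    refine Finset.sum_congr rfl fun b _ => ?_
    rw [← Finset.sum_neg_distrib]
    refine Finset.sum_congr rfl fun c _ => ?_
    rw [partialD_comm, ← mul_assoc, ← mul_assoc, neg_mul, neg_mul,
      odd_mul_odd (parity_brstBoson c) (parity_brstBoson b), neg_mul, neg_mul, neg_mul]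
  | hjet b p => rw [S_jet, S_totalDs, S_brstBoson, totalDs_zero_right]
  | hghost α p => rw [S_ghost, S_totalDs, S_brstGhost, totalDs_zero_right]
  | hadd x y hx hy => rw [S_add, S_add, hx, hy, add_zero]
  | hmul x y hx hy =>
    rw [S_mul, S_add, S_mul, S_mul, hx, hy, parity_S, parity_parity]
    noncomm_ring

/-! ### Local functions without ghosts -/

/-- The subalgebra of the local functions that do not depend on the ghosts. -/
def bosonic (U : Opens (Fin D → ℝ)) : Subalgebra ℝ (LocalFun U) :=
  Algebra.adjoin ℝ (Set.range ofSmooth ∪ Set.range fun j : Boson D × ℕ × ℕ => jet j.1 j.2)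

theorem ofSmooth_mem_bosonic (f : SmoothFun (fieldRange U)) : ofSmooth f ∈ bosonic U :=
  Algebra.subset_adjoin (Or.inl ⟨f, rfl⟩)

theorem jet_mem_bosonic (b : Boson D) (p) : jet b p ∈ bosonic U :=
  Algebra.subset_adjoin (Or.inr ⟨(b, p), rfl⟩)

theorem bosonic_induction {P : LocalFun U → Prop} (hsmooth : ∀ f, P (ofSmooth f))
    (hjet : ∀ b p, P (jet b p)) (hadd : ∀ x y, P x → P y → P (x + y))
    (hmul : ∀ x ∈ bosonic U, ∀ y ∈ bosonic U, P x → P y → P (x * y)) {x : LocalFun U}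
    (hx : x ∈ bosonic U) : P x := by
  induction hx using Algebra.adjoin_induction with
  | mem x hx =>
    obtain ⟨f, rfl⟩ | ⟨j, rfl⟩ := hx
    exacts [hsmooth f, hjet _ _]
  | algebraMap r => exact hsmooth _
  | add x y _ _ hx hy => exact hadd x y hx hy
  | mul x y h h' hx hy => exact hmul x h y h' hx hy

theorem parity_bosonic {x : LocalFun U} (hx : x ∈ bosonic U) : parity x = x := by
  refine bosonic_induction (P := fun x => parity x = x) (by simp) (by simp) ?_ ?_ hx
  · intro x y hx hy; simp [hx, hy]
  · intro x _ y _ hx hy; simp [hx, hy]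

theorem dGhost_bosonic (g : GhostJet) {x : LocalFun U} (hx : x ∈ bosonic U) :
    dGhost g x = 0 := by
  refine bosonic_induction (P := fun x => dGhost g x = 0) (by simp) (by simp) ?_ ?_ hx
  · intro x y hx hy; simp [hx, hy]
  · intro x _ y _ hx hy; simp [dGhost_mul, hx, hy]

theorem totalD_mem_bosonic (α : Bool) {x : LocalFun U} (hx : x ∈ bosonic U) :
    totalD α x ∈ bosonic U := by
  refine bosonic_induction (P := fun x => totalD α x ∈ bosonic U) ?_ ?_ ?_ ?_ hx
  · intro f
    rw [totalD_ofSmooth]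
    exact sum_mem fun b _ => mul_mem (jet_mem_bosonic _ _) (ofSmooth_mem_bosonic _)
  · intro b p
    rw [totalD_jet]
    exact jet_mem_bosonic _ _
  · intro x y hx hy
    rw [totalD_add]
    exact add_mem hx hy
  · intro x hx' y hy' hx hy
    rw [totalD_mul]
    exact add_mem (mul_mem hx hy') (mul_mem hx' hy)

/-- `[∂/∂(∂_α φ), ∂_α] = ∂/∂φ` for a ghost variable `φ`. -/
theorem dGhost_totalD_step (β α : Bool) (p : ℕ × ℕ) (x : LocalFun U) :
    dGhost (β, step α 1 p) (totalD α x)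
      = totalD α (dGhost (β, step α 1 p) x) + dGhost (β, p) x := by
  classical
  induction x using LocalFun.induction with
  | hsmooth f => simp [totalD_ofSmooth, dGhost_mul]
  | hjet b q => simp
  | hghost γ q =>
    simp only [totalD_ghost, dGhost_ghost, Prod.mk.injEq, (step_injective α).eq_iff]
    have h : ∀ P : Prop, ∀ _ : Decidable P, totalD α (if P then (1 : LocalFun U) else 0) = 0 := by
      intro P _
      split_ifs <;> simp
    rw [h, zero_add]
  | hadd x y hx hy => simp only [totalD_add, map_add, hx, hy]; abel
  | hmul x y hx hy =>
    simp only [totalD_mul, map_add, dGhost_mul, hx, hy, totalD_add, parity_totalD]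
    noncomm_ring

theorem dGhost_totalD_of_ne (β α : Bool) (p : ℕ × ℕ) (hp : ∀ q, p ≠ step α 1 q)
    (x : LocalFun U) : dGhost (β, p) (totalD α x) = totalD α (dGhost (β, p) x) := by
  classical
  induction x using LocalFun.induction with
  | hsmooth f => simp [totalD_ofSmooth, dGhost_mul]
  | hjet b q => simp
  | hghost γ q =>
    simp only [totalD_ghost, dGhost_ghost, Prod.mk.injEq]
    rw [if_neg fun h => hp q h.2]
    by_cases h1 : β = γ ∧ p = q <;> simp [h1]
  | hadd x y hx hy => simp only [totalD_add, map_add, hx, hy]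
  | hmul x y hx hy =>
    simp only [totalD_mul, map_add, dGhost_mul, hx, hy, totalD_add, parity_totalD]
    abel

theorem dGhost_totalDs_mem_bosonic {x : LocalFun U} (hx : ∀ g, dGhost g x ∈ bosonic U)
    (p : ℕ × ℕ) : ∀ g, dGhost g (totalDs p x) ∈ bosonic U := by
  induction p using orders_induction with
  | h0 => exact hx
  | hs α p ih =>
    rintro ⟨β, q⟩
    rw [totalDs_step]
    by_cases h : ∃ q', q = step α 1 q'
    · obtain ⟨q', rfl⟩ := h
      rw [dGhost_totalD_step]
      exact add_mem (totalD_mem_bosonic _ (ih _)) (ih _)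
    · push Not at h
      rw [dGhost_totalD_of_ne _ _ _ h]
      exact totalD_mem_bosonic _ (ih _)

theorem dGhost_ghost_mem_bosonic (g : GhostJet) (α p) :
    dGhost g (ghost α p : LocalFun U) ∈ bosonic U := by
  classical
  rw [dGhost_ghost]
  split_ifs
  exacts [one_mem _, zero_mem _]

theorem nablaX_mem_bosonic (α : Bool) (μ : Fin D) : nablaX α μ ∈ bosonic U :=
  sub_mem (jet_mem_bosonic _ _) (mul_mem (jet_mem_bosonic _ _) (jet_mem_bosonic _ _))

theorem dGhost_brstBoson_mem_bosonic (g : GhostJet) (b : Boson D) :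
    dGhost g (brstBoson b : LocalFun U) ∈ bosonic U := by
  have hn := dGhost_ghost_mem_bosonic (U := U) g
  have hx := fun α μ => nablaX_mem_bosonic (U := U) α μ
  obtain μ | α := b
  · simp only [brstBoson, dGhost_mul, map_add, dGhost_ofSmooth, zero_mul, zero_add,
      parity_ofSmooth, parity_ghost, dGhost_bosonic g (hx _ _), mul_zero, add_zero]
    exact mul_mem (ofSmooth_mem_bosonic _)
      (add_mem (mul_mem (hn _ _) (hx _ _)) (mul_mem (hn _ _) (hx _ _)))
  · simp only [brstBoson, dGhost_mul, map_add, map_sub, dGhost_jet, zero_mul, zero_add,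
      parity_jet]
    exact add_mem (sub_mem (hn _ _) (mul_mem (jet_mem_bosonic _ _) (hn _ _)))
      (mul_mem (jet_mem_bosonic _ _) (hn _ _))

/-- `S` of a function without ghosts is linear in the ghosts. -/
theorem dGhost_S_mem_bosonic (g : GhostJet) {x : LocalFun U} (hx : x ∈ bosonic U) :
    dGhost g (S x) ∈ bosonic U := by
  refine bosonic_induction (P := fun x => dGhost g (S x) ∈ bosonic U) ?_ ?_ ?_ ?_ hx
  · intro f
    rw [S_ofSmooth, map_sum]
    refine sum_mem fun b _ => ?_
    rw [dGhost_mul, dGhost_ofSmooth, mul_zero, add_zero]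
    exact mul_mem (dGhost_brstBoson_mem_bosonic _ _) (ofSmooth_mem_bosonic _)
  · intro b p
    rw [S_jet]
    exact dGhost_totalDs_mem_bosonic (fun g => dGhost_brstBoson_mem_bosonic g b) p g
  · intro x y hx hy
    rw [S_add, map_add]
    exact add_mem hx hy
  · intro x hx' y hy' hx hy
    rw [S_mul, map_add, dGhost_mul, dGhost_mul, parity_bosonic hx', dGhost_bosonic g hx',
      dGhost_bosonic g hy', parity_bosonic hx', mul_zero, add_zero, zero_mul, zero_add]
    exact add_mem (mul_mem hx hy') (mul_mem hx' hy)

theorem covX_mem_bosonic (α : Bool) (μ : Fin D) : covX α μ ∈ bosonic U :=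
  mul_mem (ofSmooth_mem_bosonic _) (nablaX_mem_bosonic _ _)

theorem covXX_mem_bosonic (α : Bool) (μ : Fin D) : covXX α μ ∈ bosonic U :=
  mul_mem (ofSmooth_mem_bosonic _) (sub_mem (sub_mem (totalD_mem_bosonic _ (covX_mem_bosonic _ _))
    (mul_mem (jet_mem_bosonic _ _) (totalD_mem_bosonic _ (covX_mem_bosonic _ _))))
    (mul_mem (jet_mem_bosonic _ _) (covX_mem_bosonic _ _)))

theorem covXSq_mem_bosonic (α : Bool) (μ : Fin D) : covXSq α μ ∈ bosonic U :=
  mul_mem (ofSmooth_mem_bosonic _) (add_mem (sub_mem (totalD_mem_bosonic _ (covX_mem_bosonic _ _))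
    (mul_mem (jet_mem_bosonic _ _) (totalD_mem_bosonic _ (covX_mem_bosonic _ _))))
    (mul_mem (jet_mem_bosonic _ _) (mul_mem (jet_mem_bosonic _ _) (covX_mem_bosonic _ _))))

/-! ### The derivations `{∂/∂g, S}` and the weights of the generators -/

/-- The derivation `(∂/∂g) S + S (∂/∂g)` attached to a ghost variable `g`. -/
def lieGhost (g : GhostJet) : LocalFun U →ₗ[ℝ] LocalFun U := dGhost g ∘ₗ SL + SL ∘ₗ dGhost g

theorem lieGhost_apply (g : GhostJet) (x : LocalFun U) :
    lieGhost g x = dGhost g (S x) + S (dGhost g x) := rfl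

theorem virasoro_eq (α : Bool) (k : ℕ) (x : LocalFun U) :
    virasoro α k x = (Nat.factorial k : ℝ) • lieGhost (α, step α k (0, 0)) x := by
  rw [virasoro, dCovGhost, dCovGhost, lieGhost_apply, S_smul, smul_add]

theorem lieGhost_mul (g : GhostJet) (x y : LocalFun U) :
    lieGhost g (x * y) = lieGhost g x * y + x * lieGhost g y := by
  simp only [lieGhost_apply, S_mul, dGhost_mul, map_add, S_add, parity_S, parity_dGhost,
    parity_parity]
  noncomm_ring

theorem lieGhost_S (g : GhostJet) (x : LocalFun U) : lieGhost g (S x) = S (lieGhost g x) := by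
  simp [lieGhost_apply, S_S]

theorem lieGhost_one (g : GhostJet) : lieGhost g (1 : LocalFun U) = 0 := by
  simp [lieGhost_apply]

@[simp] theorem parity_lieGhost (g : GhostJet) (x : LocalFun U) :
    parity (lieGhost g x) = lieGhost g (parity x) := by
  simp [lieGhost_apply]

theorem lieGhost_bosonic (g : GhostJet) {x : LocalFun U} (hx : x ∈ bosonic U) :
    lieGhost g x = dGhost g (S x) := by
  rw [lieGhost_apply, dGhost_bosonic g hx, S_zero, add_zero]

theorem lieGhost_mem_bosonic (g : GhostJet) {x : LocalFun U} (hx : x ∈ bosonic U) :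
    lieGhost g x ∈ bosonic U := by
  rw [lieGhost_bosonic g hx]
  exact dGhost_S_mem_bosonic g hx

theorem lieGhost_totalD_step (β α : Bool) (p : ℕ × ℕ) (x : LocalFun U) :
    lieGhost (β, step α 1 p) (totalD α x)
      = totalD α (lieGhost (β, step α 1 p) x) + lieGhost (β, p) x := by
  simp only [lieGhost_apply, S_totalD, dGhost_totalD_step, S_add, totalD_add]
  abel

theorem lieGhost_totalD_of_ne (β α : Bool) (p : ℕ × ℕ) (hp : ∀ q, p ≠ step α 1 q)
    (x : LocalFun U) : lieGhost (β, p) (totalD α x) = totalD α (lieGhost (β, p) x) := by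
  simp only [lieGhost_apply, S_totalD, dGhost_totalD_of_ne _ _ _ hp, totalD_add]

theorem zero_ne_step (α : Bool) (q : ℕ × ℕ) : (0, 0) ≠ step α 1 q :=
  (step_one_ne_zero α q).symm

theorem step_not_ne_step (α : Bool) (q : ℕ × ℕ) : step α 1 (0, 0) ≠ step (!α) 1 q := by
  cases α <;> simp [step]

/-- A ghost-number two expression `∂_+^m ∂_-^n (c^β ∂_β c^β)` contains no product of two
undifferentiated ghosts. -/
theorem dGhost_dGhost_brstGhost (α β γ : Bool) (p : ℕ × ℕ) :
    dGhost (γ, (0, 0)) (dGhost (α, (0, 0)) (totalDs p (brstGhost β) : LocalFun U)) = 0 := by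
  classical
  induction p using orders_induction with
  | h0 =>
    have h := fun α : Bool => (step_one_ne_zero α (0, 0)).symm
    by_cases h1 : α = β <;> by_cases h2 : γ = β <;>
      simp [brstGhost, dGhost_mul, dGhost_ghost, h1, h2, h]
  | hs δ p ih =>
    rw [totalDs_step, dGhost_totalD_of_ne _ _ _ (zero_ne_step δ),
      dGhost_totalD_of_ne _ _ _ (zero_ne_step δ), ih, totalD_zero]

open Classical in
/-- The terms of `∂_+^m ∂_-^n (c^β ∂_β c^β)` that contain both an undifferentiated ghost and some
`∂_α c^α`: there are none unless `m = n = 0`. -/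
theorem dGhost_dGhost_brstGhost' (α β γ : Bool) (p : ℕ × ℕ) :
    dGhost (γ, (0, 0)) (dGhost (α, step α 1 (0, 0)) (totalDs p (brstGhost β) : LocalFun U))
      = -(if γ = α then dGhost (γ, (0, 0)) (ghost β p : LocalFun U) else 0) := by
  induction p using orders_induction with
  | h0 =>
    have h := fun α : Bool => (step_one_ne_zero α (0, 0))
    by_cases h1 : α = β <;> by_cases h2 : γ = β <;>
      simp [brstGhost, dGhost_mul, dGhost_ghost, h1, h2, h]
    rintro rfl
    simp at h1
  | hs δ p ih =>
    have hR : dGhost (γ, (0, 0)) (ghost β (step δ 1 p) : LocalFun U) = 0 := by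
      rw [dGhost_ghost, if_neg]
      rw [Prod.mk.injEq]
      exact fun h => zero_ne_step _ _ h.2
    have hT : totalD δ (-(if γ = α then dGhost (γ, (0, 0)) (ghost β p : LocalFun U) else 0))
        = 0 := by
      rw [dGhost_ghost]
      split_ifs <;> simp
    rw [totalDs_step, hR, ite_self, neg_zero]
    by_cases hδ : δ = α
    · subst hδ
      rw [dGhost_totalD_step, map_add, dGhost_totalD_of_ne _ _ _ (zero_ne_step _), ih, hT,
        dGhost_dGhost_brstGhost, add_zero]
    · have hδ' : δ = !α := by cases δ <;> cases α <;> simp_all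
      subst hδ'
      rw [dGhost_totalD_of_ne _ _ _ (step_not_ne_step α),
        dGhost_totalD_of_ne _ _ _ (zero_ne_step _), ih, hT]

open Classical in
/-- `∂/∂c^γ` raises the weight with respect to `L^γ_0` by one. -/
theorem lieGhost_dGhost (α γ : Bool) (x : LocalFun U) :
    lieGhost (α, step α 1 (0, 0)) (dGhost (γ, (0, 0)) x)
      = dGhost (γ, (0, 0)) (lieGhost (α, step α 1 (0, 0)) x)
        + if γ = α then dGhost (γ, (0, 0)) x else 0 := by
  have hb : ∀ x ∈ bosonic U, lieGhost (α, step α 1 (0, 0)) (dGhost (γ, (0, 0)) x)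
      = dGhost (γ, (0, 0)) (lieGhost (α, step α 1 (0, 0)) x)
        + if γ = α then dGhost (γ, (0, 0)) x else 0 := by
    intro x hx
    rw [dGhost_bosonic _ hx, map_zero, ite_self, add_zero,
      dGhost_bosonic _ (lieGhost_mem_bosonic _ hx)]
  have hc : ∀ (g g' : GhostJet) (β p), lieGhost g (dGhost g' (ghost β p : LocalFun U)) = 0 := by
    intro g g' β p
    rw [dGhost_ghost]
    split_ifs
    · exact lieGhost_one _
    · exact map_zero _
  induction x using LocalFun.induction with
  | hsmooth f => exact hb _ (ofSmooth_mem_bosonic f)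
  | hjet b p => exact hb _ (jet_mem_bosonic b p)
  | hghost β p =>
    have hS : ∀ g : GhostJet, S (dGhost g (ghost β p : LocalFun U)) = 0 := by
      intro g
      rw [dGhost_ghost]
      split_ifs <;> simp
    rw [hc, lieGhost_apply, hS, add_zero, S_ghost, dGhost_dGhost_brstGhost', neg_add_cancel]
  | hadd x y hx hy =>
    simp only [map_add, hx, hy]
    split_ifs <;> abel
  | hmul x y hx hy =>
    simp only [lieGhost_mul, dGhost_mul, map_add, hx, hy, parity_lieGhost]
    split_ifs <;> noncomm_ring

theorem dCovGhost_zero (α : Bool) (x : LocalFun U) :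
    dCovGhost α 0 x = dGhost (α, (0, 0)) x := by
  simp [dCovGhost]

theorem chiralX_zero_zero (μ : Fin D) : (chiralX μ 0 0 : LocalFun U) = jet (Sum.inl μ) (0, 0) :=
  rfl

theorem chiralX_succ_left (μ : Fin D) (m n : ℕ) :
    (chiralX μ (m + 1) n : LocalFun U) = dGhost (true, (0, 0)) (S (chiralX μ m n)) := by
  rw [chiralX, Function.iterate_succ_apply', dCovGhost_zero]
  rfl

theorem chiralX_zero_succ (μ : Fin D) (n : ℕ) :
    (chiralX μ 0 (n + 1) : LocalFun U) = dGhost (false, (0, 0)) (S (chiralX μ 0 n)) := by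
  rw [chiralX, Function.iterate_zero_apply, Function.iterate_succ_apply', dCovGhost_zero]
  rfl

theorem chiralX_induction {P : ℕ → ℕ → Prop} (h0 : P 0 0) (h1 : ∀ n, P 0 n → P 0 (n + 1))
    (h2 : ∀ m n, P m n → P (m + 1) n) (m n : ℕ) : P m n := by
  induction m with
  | succ m ih => exact h2 m n ih
  | zero =>
    induction n with
    | zero => exact h0
    | succ n ih => exact h1 n ih

theorem chiralX_mem_bosonic (μ : Fin D) (m n : ℕ) : chiralX μ m n ∈ bosonic U := by
  induction m, n using chiralX_induction with
  | h0 =>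
    rw [chiralX_zero_zero]
    exact jet_mem_bosonic _ _
  | h1 n ih =>
    rw [chiralX_zero_succ]
    exact dGhost_S_mem_bosonic _ ih
  | h2 m n ih =>
    rw [chiralX_succ_left]
    exact dGhost_S_mem_bosonic _ ih

theorem dGhost_S_X (α : Bool) (μ : Fin D) :
    dGhost (α, (0, 0)) (brstBoson (Sum.inl μ) : LocalFun U) = covX α μ := by
  classical
  rw [S_X α, map_add, dGhost_mul, dGhost_mul, dGhost_bosonic _ (covX_mem_bosonic _ _),
    dGhost_bosonic _ (covX_mem_bosonic _ _), dGhost_ghost, dGhost_ghost]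
  cases α <;> simp

theorem chiralX_one_zero (μ : Fin D) : (chiralX μ 1 0 : LocalFun U) = covX true μ := by
  rw [chiralX_succ_left, chiralX_zero_zero, S_jet, totalDs_zero, dGhost_S_X]

theorem chiralX_zero_one (μ : Fin D) : (chiralX μ 0 1 : LocalFun U) = covX false μ := by
  rw [chiralX_zero_succ, chiralX_zero_zero, S_jet, totalDs_zero, dGhost_S_X]

theorem chiralX_one_one (μ : Fin D) : (chiralX μ 1 1 : LocalFun U) = covXX true μ := by
  classical
  have h := (step_one_ne_zero false (0, 0)).symm
  rw [chiralX_succ_left, chiralX_zero_one, S_covX, map_add, map_add, dGhost_mul, dGhost_mul,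
    dGhost_mul, dGhost_bosonic _ (covX_mem_bosonic _ _), dGhost_bosonic _ (covXX_mem_bosonic _ _),
    dGhost_bosonic _ (covXSq_mem_bosonic _ _), dGhost_ghost, dGhost_ghost, dGhost_ghost]
  simp [← covXX_comm true μ]

/-- `L^α_0`, the Virasoro operator that measures the weights. -/
def weightOp (α : Bool) : LocalFun U →ₗ[ℝ] LocalFun U := lieGhost (α, step α 1 (0, 0))

theorem virasoro_one (α : Bool) (x : LocalFun U) : virasoro α 1 x = weightOp α x := by
  rw [virasoro_eq, Nat.factorial_one, Nat.cast_one, one_smul, weightOp]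

theorem weightOp_chiralX (α : Bool) (μ : Fin D) (m n : ℕ) :
    weightOp α (chiralX μ m n : LocalFun U) = (if α then (m : ℝ) else n) • chiralX μ m n := by
  classical
  have hg : ∀ (γ : Bool) (x : LocalFun U) (r : ℝ), weightOp α x = r • x →
      weightOp α (dGhost (γ, (0, 0)) (S x))
        = (r + if γ = α then 1 else 0) • dGhost (γ, (0, 0)) (S x) := by
    intro γ x r hx
    rw [weightOp] at hx ⊢
    rw [lieGhost_dGhost, lieGhost_S, hx, S_smul, map_smul, add_smul]
    split_ifs <;> simp
  induction m, n using chiralX_induction with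
  | h0 =>
    have h := step_one_ne_zero α (0, 0)
    rw [weightOp, lieGhost_bosonic _ (chiralX_mem_bosonic _ _ _), chiralX_zero_zero, S_jet,
      totalDs_zero, S_X α, map_add, dGhost_mul, dGhost_mul,
      dGhost_bosonic _ (covX_mem_bosonic _ _), dGhost_bosonic _ (covX_mem_bosonic _ _),
      dGhost_ghost, dGhost_ghost]
    simp [h]
  | h1 n ih =>
    rw [chiralX_zero_succ, hg _ _ _ ih]
    cases α <;> simp
  | h2 m n ih =>
    rw [chiralX_succ_left, hg _ _ _ ih]
    cases α <;> simp

theorem step_succ (α : Bool) (k : ℕ) : step α (k + 1) (0, 0) = step α 1 (step α k (0, 0)) :=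
  (step_step α 1 k (0, 0)).symm

open Classical in
theorem lieGhost_zero_ghost (α β : Bool) (k : ℕ) :
    lieGhost (α, (0, 0)) (ghost β (step β k (0, 0)) : LocalFun U)
      = if α = β then ghost β (step β (k + 1) (0, 0)) else 0 := by
  induction k with
  | zero =>
    have h := (step_one_ne_zero β (0, 0)).symm
    rw [step_zero, lieGhost_apply, S_ghost, totalDs_zero, brstGhost, dGhost_mul, dGhost_ghost,
      dGhost_ghost]
    by_cases h1 : α = β <;> simp [h1, h]
  | succ k ih =>
    rw [step_succ β k, ← totalD_ghost, lieGhost_totalD_of_ne _ _ _ (zero_ne_step β), ih]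
    split_ifs
    · rw [totalD_ghost, ← step_succ]
    · exact totalD_zero _

open Classical in
theorem weightOp_ghost (α β : Bool) (k : ℕ) :
    weightOp α (ghost β (step β k (0, 0)) : LocalFun U)
      = (if α = β then (k : ℝ) - 1 else 0) • ghost β (step β k (0, 0)) := by
  rw [weightOp]
  induction k with
  | zero =>
    have h := step_one_ne_zero α (0, 0)
    rw [step_zero, lieGhost_apply, S_ghost, totalDs_zero, brstGhost, dGhost_mul, dGhost_ghost,
      dGhost_ghost]
    by_cases h1 : α = β
    · subst h1; simp [h]
    · simp [h1, h]
  | succ k ih =>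
    by_cases h1 : α = β
    · subst h1
      rw [step_succ α k, ← totalD_ghost, lieGhost_totalD_step, ih, lieGhost_zero_ghost,
        totalD_smul, totalD_ghost, ← step_succ, if_pos rfl, if_pos rfl, if_pos rfl]
      rw [Nat.cast_succ, add_sub_right_comm, add_smul, one_smul]
    · have h2 : α = !β := by cases β <;> cases α <;> simp_all
      have h3 := step_not_ne_step α
      rw [h2, Bool.not_not, ← h2] at h3
      rw [step_succ β k, ← totalD_ghost, lieGhost_totalD_of_ne _ _ _ h3, ih,
        if_neg h1, if_neg h1, zero_smul, zero_smul, totalD_zero]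

open Classical in
theorem weightOp_covGhost (α β : Bool) (k : ℕ) :
    weightOp α (covGhost β k : LocalFun U)
      = (if α = β then (k : ℝ) - 1 else 0) • covGhost β k := by
  rw [covGhost, map_smul, weightOp_ghost, smul_comm]

/-! ### Superfields as local functions -/

theorem ofX_mul (f g : SmoothFun U) : (ofX (f * g) : LocalFun U) = ofX f * ofX g := by
  rw [ofX, ofX, ofX, ← ofSmooth_mul]
  rfl

theorem ofX_add (f g : SmoothFun U) : (ofX (f + g) : LocalFun U) = ofX f + ofX g := by
  rw [ofX, ofX, ofX, ← ofSmooth_add]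
  rfl

theorem ofX_smul (r : ℝ) (f : SmoothFun U) : (ofX (r • f) : LocalFun U) = r • ofX f := by
  rw [ofX, ofX, ← ofSmooth_smul]
  rfl

theorem ofX_one : (ofX 1 : LocalFun U) = 1 := rfl

theorem ofX_algebraMap (r : ℝ) :
    (ofX (algebraMap ℝ (SmoothFun U) r) : LocalFun U) = algebraMap ℝ (LocalFun U) r := rfl

theorem ofX_zero : (ofX 0 : LocalFun U) = 0 := ofSmooth_zero

theorem ofX_neg (f : SmoothFun U) : (ofX (-f) : LocalFun U) = -ofX f := by
  rw [← neg_one_smul ℝ, ofX_smul, neg_one_smul]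

theorem ofX_coord (μ : Fin D) :
    (ofX ⟨fun v => v.1 μ, mem_smoothFun_of _ (fun v => v μ) (by fun_prop) fun _ => rfl⟩
      : LocalFun U) = jet (Sum.inl μ) (0, 0) := by
  rw [jet_zero]
  rfl

theorem commute_ofX (f : SmoothFun U) (x : LocalFun U) : Commute (ofX f) x := commute_ofSmooth _ x

theorem ofX_mem_bosonic (f : SmoothFun U) : ofX f ∈ bosonic U := ofSmooth_mem_bosonic _

/-- `S f(X) = T^μ ∂_μ f(X)`. -/
theorem S_ofX (f : SmoothFun U) :
    S (ofX f : LocalFun U) = ∑ μ, brstBoson (Sum.inl μ) * ofX (partialD U μ f) := by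
  classical
  have hderiv : ∀ v : fieldRange U, HasFDerivAt
      (fun v : Boson D → ℝ => ext f.1 fun μ => v (Sum.inl μ))
      ((fderiv ℝ (ext f.1) fun μ => v.1 (Sum.inl μ)).comp
        (ContinuousLinearMap.pi fun μ => ContinuousLinearMap.proj (Sum.inl μ))) v.1 := by
    intro v
    have h := (differentiableAt_ext f ⟨fun μ => v.1 (Sum.inl μ), v.2.1⟩).hasFDerivAt
    exact h.comp (f := fun (v : Boson D → ℝ) (μ : Fin D) => v (Sum.inl μ)) v.1
      (ContinuousLinearMap.pi (R := ℝ) (φ := fun _ : Fin D => ℝ) fun μ =>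
        ContinuousLinearMap.proj (R := ℝ) (φ := fun _ : Boson D => ℝ) (Sum.inl μ)).hasFDerivAt
  rw [ofX, S_ofSmooth, Fintype.sum_sum_type, Finset.sum_eq_zero (s := (Finset.univ : Finset Bool)),
    add_zero]
  · refine Finset.sum_congr rfl fun μ _ => ?_
    rw [ofX]
    congr 2
    ext v
    rw [partialD_eq_of_hasFDerivAt _ _ _ v _ (fun v => (ext_apply f.1 _ v.2.1).symm) (hderiv v)]
    have h := ext_partialD μ f (fun μ => v.1 (Sum.inl μ)) v.2.1
    rw [ext_apply _ _ v.2.1] at h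
    refine Eq.trans ?_ h.symm
    rw [ContinuousLinearMap.comp_apply]
    congr 1
    ext ν
    by_cases hν : ν = μ
    · subst hν; simp
    · simp [hν]
  · intro α _
    convert mul_zero (brstBoson (Sum.inr α) : LocalFun U)
    rw [← ofSmooth_zero]
    congr 1
    ext v
    have hz : (ContinuousLinearMap.pi fun μ => ContinuousLinearMap.proj (R := ℝ)
        (φ := fun _ : Boson D => ℝ) (Sum.inl μ)) (Pi.single (Sum.inr α) (1 : ℝ))
        = (0 : Fin D → ℝ) := by
      ext μ
      simp
    rw [partialD_eq_of_hasFDerivAt _ _ _ v _ (fun v => (ext_apply f.1 _ v.2.1).symm) (hderiv v),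
      ContinuousLinearMap.comp_apply, hz, map_zero]
    rfl

theorem Theta_eq (α : Bool) : (Theta α : LocalFun U) = ghost α (step α 1 (0, 0)) := by
  simp [Theta, covGhost]

theorem parity_Theta (α : Bool) : parity (Theta α : LocalFun U) = -Theta α := by
  rw [Theta_eq, parity_ghost]

theorem Theta_mul_self (α : Bool) : (Theta α * Theta α : LocalFun U) = 0 :=
  odd_mul_self (parity_Theta α)

theorem Theta_comm : (Theta false * Theta true : LocalFun U) = -(Theta true * Theta false) :=
  odd_mul_odd (parity_Theta _) (parity_Theta _)

theorem eval_add (H K : Superfield U) : (H + K).eval = H.eval + K.eval := by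
  simp only [Superfield.eval, Pi.add_apply, ofX_add]
  noncomm_ring

theorem eval_smul (r : ℝ) (H : Superfield U) : (r • H).eval = r • H.eval := by
  simp only [Superfield.eval, Pi.smul_apply, ofX_smul, smul_mul_assoc, smul_add]

/-- Evaluation of superfields as a linear map. -/
def evalL : Superfield U →ₗ[ℝ] LocalFun U where
  toFun := Superfield.eval
  map_add' := eval_add
  map_smul' := eval_smul

theorem evalL_apply (H : Superfield U) : evalL H = H.eval := rfl

@[simp] theorem eval_zero : (0 : Superfield U).eval = 0 := by rw [← evalL_apply, map_zero]

@[simp] theorem eval_neg (H : Superfield U) : (-H).eval = -H.eval := by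
  simp only [← evalL_apply, map_neg]

@[simp] theorem eval_sub (H K : Superfield U) : (H - K).eval = H.eval - K.eval := by
  simp only [← evalL_apply, map_sub]

/-- The product of a function of `X` with a superfield. -/
def funMul (f : SmoothFun U) (H : Superfield U) : Superfield U := fun a b => f * H a b

theorem eval_funMul (f : SmoothFun U) (H : Superfield U) :
    (funMul f H).eval = ofX f * H.eval := by
  simp only [Superfield.eval, funMul, ofX_mul]
  noncomm_ring

/-- The product of `Θ^α` with a superfield. -/
def thetaMul : Bool → Superfield U → Superfield U
  | true, H => fun a b => if a then H false b else 0
  | false, H => fun a b => if b then (if a then -H true false else H false false) else 0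

theorem eval_thetaMul (α : Bool) (H : Superfield U) :
    (thetaMul α H).eval = Theta α * H.eval := by
  have hc := fun (f : SmoothFun U) (α : Bool) => (commute_ofX f (Theta α)).eq
  have h1 := Theta_mul_self (U := U) α
  have h3 := Theta_comm (U := U)
  cases α
  · simp only [Superfield.eval, thetaMul, if_true, Bool.false_eq_true, if_false, ofX_zero, ofX_neg]
    linear_combination (norm := noncomm_ring) hc (H false false) false
      + hc (H false true) false * Theta false + hc (H true false) false * Theta true
      + hc (H true true) false * (Theta true * Theta false)
      - ofX (H true false) * h3 - ofX (H true true) * h3 * Theta false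
      + (ofX (H true true) * Theta true - ofX (H false true)) * h1
  · simp only [Superfield.eval, thetaMul, if_true, Bool.false_eq_true, if_false, ofX_zero]
    linear_combination (norm := noncomm_ring) hc (H false false) true
      + hc (H false true) true * Theta false + hc (H true false) true * Theta true
      + hc (H true true) true * (Theta true * Theta false)
      - ofX (H true false) * h1 - ofX (H true true) * h1 * Theta false

theorem dGhost_eval_of_ne (g : GhostJet) (hg : ∀ α, g ≠ (α, step α 1 (0, 0)))
    (H : Superfield U) : dGhost g H.eval = 0 := by
  classical
  have h : ∀ α, dGhost g (Theta α : LocalFun U) = 0 := by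
    intro α
    rw [Theta_eq, dGhost_ghost, if_neg (hg α)]
  simp [Superfield.eval, dGhost_mul, h, dGhost_bosonic g (ofX_mem_bosonic _)]

/-! ### The covariant one-forms `u^α_i` and their differentials -/

/-- The weight one partner `y^α_i` of the ghost `c^α`: the covariant derivative of `X^μ` for
`i = some μ`, and `2 c^α_1 = ∂_α ∂_α c^α` for `i = none`. -/
def partner (α : Bool) : Option (Fin D) → LocalFun U
  | some μ => covX α μ
  | none => ghost α (step α 2 (0, 0))

/-- The weight zero product `u^α_i = c^α y^α_i`. Thus `T^μ = u^+_μ + u^-_μ`, `R^μ = u^+_μ - u^-_μ`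
and `T^α` is `u^α_i` for `i = none`. -/
def oneForm (α : Bool) (i : Option (Fin D)) : LocalFun U := ghost α (0, 0) * partner α i

/-- The product `c^+ c^- X^μ_{1,1}`. -/
def mixedForm (μ : Fin D) : LocalFun U :=
  ghost true (0, 0) * (ghost false (0, 0) * covXX true μ)

/-- The sign by which the grade involution acts on `oneForm α i`. -/
def formSign : Option (Fin D) → ℝ
  | some _ => -1
  | none => 1

theorem formSign_mul_self (i : Option (Fin D)) : formSign i * formSign i = 1 := by
  cases i <;> simp [formSign]

theorem parity_partner (α : Bool) (i : Option (Fin D)) :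
    parity (partner α i : LocalFun U) = -formSign i • partner α i := by
  cases i <;> simp [partner, formSign]

theorem parity_oneForm (α : Bool) (i : Option (Fin D)) :
    parity (oneForm α i : LocalFun U) = formSign i • oneForm α i := by
  rw [oneForm, map_mul, parity_ghost, parity_partner, mul_smul_comm, neg_mul, smul_neg, neg_smul,
    neg_neg]

theorem oneForm_mul_oneForm_self (α : Bool) (i j : Option (Fin D)) :
    (oneForm α i * oneForm α j : LocalFun U) = 0 := by
  have h : (ghost α (0, 0) * partner α i : LocalFun U)
      = -formSign i • (partner α i * ghost α (0, 0)) := by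
    rw [ghost_mul, parity_partner, smul_mul_assoc]
  have h0 := ghost_mul_self (U := U) α (0, 0)
  rw [oneForm, h, oneForm, smul_mul_assoc, mul_assoc, ← mul_assoc (ghost α (0, 0)), h0, zero_mul,
    mul_zero, smul_zero]

/-- The sign in the exchange of two one-forms: `-1` if both are odd. -/
def exchangeSign : Option (Fin D) → Option (Fin D) → ℝ
  | some _, some _ => -1
  | _, _ => 1

theorem oneForm_comm (α β : Bool) (i j : Option (Fin D)) :
    (oneForm α i * oneForm β j : LocalFun U) = exchangeSign i j • (oneForm β j * oneForm α i) := by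
  have hi := parity_oneForm (U := U) α i
  have hj := parity_oneForm (U := U) β j
  cases i with
  | none =>
    rw [formSign, one_smul] at hi
    rw [exchangeSign, one_smul, (commute_of_parity hi _).eq]
    simp
  | some μ =>
    rw [formSign, neg_one_smul] at hi
    rw [odd_mul hi, hj, smul_mul_assoc]
    cases j <;> rfl

theorem T_inl (μ : Fin D) :
    (T (Sum.inl μ) : LocalFun U) = oneForm true (some μ) + oneForm false (some μ) := by
  simp [T, oneForm, partner, covGhost, chiralX_one_zero, chiralX_zero_one]

theorem R_eq (μ : Fin D) :
    (R μ : LocalFun U) = oneForm true (some μ) - oneForm false (some μ) := by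
  simp [R, oneForm, partner, covGhost, chiralX_one_zero, chiralX_zero_one]

theorem T_inr (α : Bool) : (T (Sum.inr α) : LocalFun U) = oneForm α none := by
  simp [T, oneForm, partner, covGhost]

theorem brstBoson_inl (μ : Fin D) : (brstBoson (Sum.inl μ) : LocalFun U)
    = oneForm true (some μ) + oneForm false (some μ) := S_X true μ

theorem S_Theta (α : Bool) : S (Theta α : LocalFun U) = oneForm α none := by
  have h := ghost_mul_self (U := U) α (step α 1 (0, 0))
  rw [Theta_eq, S_ghost, totalDs_step, totalDs_zero, brstGhost, totalD_mul, totalD_ghost,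
    totalD_ghost, h, zero_add, step_step, oneForm, partner]

theorem S_oneForm_none (α : Bool) : S (oneForm α none : LocalFun U) = 0 := by
  rw [← S_Theta, S_S]

theorem S_oneForm_true (μ : Fin D) :
    S (oneForm true (some μ) : LocalFun U) = -mixedForm μ := by
  have h := ghost_mul_self (U := U) true (0, 0)
  rw [oneForm, partner, S_mul, S_ghost, totalDs_zero, brstGhost, parity_ghost, S_covX, mixedForm,
    Bool.not_true]
  linear_combination (norm := noncomm_ring) -h * covXSq true μ

theorem S_oneForm_false (μ : Fin D) :
    S (oneForm false (some μ) : LocalFun U) = mixedForm μ := by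
  have h := S_S (jet (Sum.inl μ) (0, 0) : LocalFun U)
  rw [S_jet, totalDs_zero, brstBoson_inl, S_add, S_oneForm_true, neg_add_eq_zero] at h
  exact h.symm

theorem S_mixedForm (μ : Fin D) : S (mixedForm μ : LocalFun U) = 0 := by
  rw [← S_oneForm_false, S_S]

theorem parity_mixedForm (μ : Fin D) : parity (mixedForm μ : LocalFun U) = mixedForm μ := by
  simp [mixedForm]

theorem mixedForm_mul_oneForm (μ : Fin D) (α : Bool) (i : Option (Fin D)) :
    (mixedForm μ * oneForm α i : LocalFun U) = 0 := by
  have h1 := ghost_mul_self (U := U) true (0, 0)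
  have h2 := ghost_mul_self (U := U) false (0, 0)
  have h3 := ghost_mul_ghost (U := U) true false (0, 0) (0, 0)
  have hX := fun x => (commute_of_parity (parity_bosonic (covXX_mem_bosonic (U := U) true μ)) x).eq
  rw [mixedForm, oneForm, mul_assoc, mul_assoc, ← mul_assoc (covXX true μ), hX]
  cases α
  · linear_combination (norm := noncomm_ring)
      ghost true (0, 0) * h2 * covXX true μ * partner false i
  · linear_combination (norm := noncomm_ring)
      h3 * ghost true (0, 0) * covXX true μ * partner true i
        - ghost false (0, 0) * h1 * covXX true μ * partner true i

/-- Products of three one-forms vanish, since there are only two undifferentiated ghosts. -/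
theorem oneForm_mul_mul (β : Bool) (i j k : Option (Fin D)) :
    (oneForm true i * oneForm false j * oneForm β k : LocalFun U) = 0 := by
  cases β
  · rw [mul_assoc, oneForm_mul_oneForm_self, mul_zero]
  · rw [mul_assoc, oneForm_comm false true, mul_smul_comm, ← mul_assoc, oneForm_mul_oneForm_self,
      zero_mul, smul_zero]

/-- The superspace derivative dual to `oneForm α i`: `∂_μ` for `i = some μ`, and `∂/∂Θ^α` for
`i = none`. -/
def formDeriv (α : Bool) : Option (Fin D) → Superfield U → Superfield U
  | some μ, H => sderiv (Sum.inl μ) H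
  | none, H => sderiv (Sum.inr α) H

/-- `S` acts on superfields as the exterior derivative. -/
theorem S_eval (H : Superfield U) :
    S H.eval = ∑ α, ∑ i, oneForm α i * (formDeriv α i H).eval := by
  have key : ∀ f : SmoothFun U, S (ofX f : LocalFun U)
      = ∑ μ, (oneForm true (some μ) + oneForm false (some μ)) * ofX (partialD U μ f) := by
    intro f
    rw [S_ofX]
    simp only [brstBoson_inl]
  have e1 : ∀ (f : SmoothFun U) (α : Bool), ofX f * oneForm α none = oneForm α none * ofX f :=
    fun f α => (commute_ofX f _).eq
  have e2 : (Theta true * oneForm false none : LocalFun U) = oneForm false none * Theta true :=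
    ((commute_of_parity ((parity_oneForm false none).trans (one_smul _ _)) _).eq).symm
  have hsum : S H.eval = (∑ μ, (oneForm true (some μ) + oneForm false (some μ))
        * (formDeriv true (some μ) H).eval)
      + oneForm true none * (formDeriv true none H).eval
      + oneForm false none * (formDeriv false none H).eval := by
    simp only [Superfield.eval, S_add, S_mul, S_Theta, key, formDeriv, sderiv, if_true,
      Bool.false_eq_true, if_false, ofX_zero, ofX_neg, mul_add, Finset.sum_add_distrib,
      ← mul_assoc, Finset.sum_mul, parity_bosonic (ofX_mem_bosonic _), parity_Theta, map_mul]
    simp only [mul_assoc, e1, Finset.sum_mul, add_mul]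
    linear_combination (norm := noncomm_ring)
      - ofX (H true true) * e2 - e1 (H true true) false * Theta true
  rw [hsum, Fintype.sum_bool, Fintype.sum_option, Fintype.sum_option]
  simp only [formDeriv, add_mul, Finset.sum_add_distrib]
  abel

/-! ### The normal form and the differential on its coefficients -/

/-- The general element of the module over the superfields which is freely generated by `1`, the
one-forms `u^α_i`, the forms `c^+ c^- X^μ_{1,1}` and the products `u^+_i u^-_j`. -/
def normalForm (H : Superfield U) (A : Bool → Option (Fin D) → Superfield U)
    (E : Fin D → Superfield U) (F : Option (Fin D) → Option (Fin D) → Superfield U) :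
    LocalFun U :=
  H.eval + ∑ α, ∑ i, oneForm α i * (A α i).eval + ∑ μ, mixedForm μ * (E μ).eval
    + ∑ i, ∑ j, oneForm true i * oneForm false j * (F i j).eval

theorem normalForm_add (H H' : Superfield U) (A A' E E' F F') :
    normalForm (H + H') (A + A') (E + E') (F + F')
      = normalForm H A E F + normalForm H' A' E' F' := by
  simp only [normalForm, eval_add, Pi.add_apply, mul_add, Finset.sum_add_distrib]
  abel

theorem normalForm_smul (r : ℝ) (H : Superfield U) (A E F) :
    normalForm (r • H) (r • A) (r • E) (r • F) = r • normalForm H A E F := by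
  simp only [normalForm, eval_smul, Pi.smul_apply, mul_smul_comm, Finset.smul_sum, smul_add]

theorem normalForm_zero : normalForm (0 : Superfield U) 0 0 0 = 0 := by
  have h := normalForm_smul (0 : ℝ) (0 : Superfield U) 0 0 0
  simpa only [zero_smul] using h

theorem normalForm_sub (H H' : Superfield U) (A A' E E' F F') :
    normalForm (H - H') (A - A') (E - E') (F - F')
      = normalForm H A E F - normalForm H' A' E' F' := by
  simp only [normalForm, eval_sub, Pi.sub_apply, mul_sub, Finset.sum_sub_distrib]
  abel

/-- The `u^+_i u^-_j` component of `S (∑ u^α_i A^α_i)`. -/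
def curlCoeff (A : Bool → Option (Fin D) → Superfield U) (i j : Option (Fin D)) : Superfield U :=
  formSign i • formDeriv false j (A true i)
    + (formSign j * exchangeSign i j) • formDeriv true i (A false j)

/-- `S` in terms of the coefficients of a normal form. -/
theorem S_normalForm (H : Superfield U) (A E F) :
    S (normalForm H A E F) = normalForm 0 (fun α i => formDeriv α i H)
      (fun μ => A false (some μ) - A true (some μ)) (curlCoeff A) := by
  have hE : ∀ μ, S (mixedForm μ * (E μ).eval) = 0 := by
    intro μ
    rw [S_mul, S_mixedForm, zero_mul, zero_add, parity_mixedForm, S_eval]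
    simp only [Finset.mul_sum, ← mul_assoc, mixedForm_mul_oneForm, zero_mul, Finset.sum_const_zero]
  have hF : ∀ i j, S (oneForm true i * oneForm false j * (F i j).eval) = 0 := by
    intro i j
    have hu : ∀ (α : Bool) (i : Option (Fin D)) (β j),
        (S (oneForm α i) * oneForm β j : LocalFun U) = 0 := by
      intro α i β j
      rcases i with _ | μ
      · rw [S_oneForm_none, zero_mul]
      · cases α
        · rw [S_oneForm_false, mixedForm_mul_oneForm]
        · rw [S_oneForm_true, neg_mul, mixedForm_mul_oneForm, neg_zero]
    have hu' : (oneForm true i * S (oneForm false j) : LocalFun U) = 0 := by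
      have hp : parity (S (oneForm false j) : LocalFun U) = S (oneForm false j) := by
        rcases j with _ | μ
        · rw [S_oneForm_none, map_zero]
        · rw [S_oneForm_false, parity_mixedForm]
      rw [← (commute_of_parity hp _).eq, hu]
    rw [S_mul, S_mul, hu, zero_add, parity_oneForm, smul_mul_assoc, hu', smul_zero, zero_mul,
      zero_add, S_eval]
    simp only [map_mul, parity_oneForm, Finset.mul_sum, smul_mul_assoc, mul_smul_comm, ← mul_assoc,
      oneForm_mul_mul, zero_mul, smul_zero, Finset.sum_const_zero]
  have hA : ∀ α i, S (oneForm α i * (A α i).eval) = S (oneForm α i) * (A α i).eval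
      + ∑ j, formSign i • (oneForm α i * oneForm (!α) j * (formDeriv (!α) j (A α i)).eval) := by
    intro α i
    rw [S_mul, parity_oneForm, S_eval, smul_mul_assoc, Finset.mul_sum, Finset.smul_sum,
      Fintype.sum_eq_single (!α)]
    · simp only [Finset.mul_sum, Finset.smul_sum, mul_assoc]
    · intro β hβ
      have : β = α := by cases α <;> cases β <;> simp_all
      subst this
      simp only [Finset.mul_sum, ← mul_assoc, oneForm_mul_oneForm_self, zero_mul,
        Finset.sum_const_zero, smul_zero]
  have hA2 : ∀ i j, oneForm false i * oneForm true j * (formDeriv true j (A false i)).eval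
      = exchangeSign j i • (oneForm true j * oneForm false i
        * (formDeriv true j (A false i)).eval) := by
    intro i j
    rw [oneForm_comm false true]
    have : (exchangeSign i j : ℝ) = exchangeSign j i := by cases i <;> cases j <;> rfl
    rw [this, smul_mul_assoc]
  rw [normalForm, S_add, S_add, S_add, S_eval, S_sum, S_sum, S_sum]
  simp only [S_sum, hE, hF, hA, Finset.sum_const_zero, add_zero]
  rw [normalForm, eval_zero, zero_add, add_assoc]
  congr 1
  simp only [Fintype.sum_bool, Finset.sum_add_distrib, Bool.not_true, Bool.not_false, hA2,
    curlCoeff, eval_add, eval_smul, mul_add, mul_smul_comm, smul_smul, eval_sub, mul_sub,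
    Finset.sum_sub_distrib]
  rw [Fintype.sum_option (fun i => S (oneForm true i) * _),
    Fintype.sum_option (fun i => S (oneForm false i) * _)]
  simp only [S_oneForm_none, S_oneForm_true, S_oneForm_false, zero_mul, zero_add, neg_mul,
    Finset.sum_neg_distrib]
  rw [Finset.sum_comm (f := fun i j => (formSign i * exchangeSign j i) • _)]
  abel

/-! ### Linear independence of the generators of the normal form -/

/-- The value of a local function where the undifferentiated bosonic fields are given by `v`, their
derivatives by `r`, and the ghosts are zero. -/
def evalAt (v : fieldRange U) (r : DerJet D → ℝ) : LocalFun U →ₐ[ℝ] ℝ :=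
  Algebra.TensorProduct.lift
    ((Pi.evalAlgHom ℝ (fun _ : fieldRange U => ℝ) v).comp (SmoothFun (fieldRange U)).val)
    (Algebra.TensorProduct.lift (MvPolynomial.aeval r) ExteriorAlgebra.algebraMapInv
      fun _ _ => Commute.all _ _) fun _ _ => Commute.all _ _

theorem evalAt_mk (v : fieldRange U) (r : DerJet D → ℝ) (f p γ) :
    evalAt v r (LocalFun.mk f p γ)
      = f.1 v * (MvPolynomial.aeval r p * ExteriorAlgebra.algebraMapInv γ) := by
  refine (Algebra.TensorProduct.lift_tmul ..).trans ?_
  rw [Algebra.TensorProduct.lift_tmul]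
  rfl

theorem evalAt_ofSmooth (v : fieldRange U) (r : DerJet D → ℝ) (f) :
    evalAt v r (ofSmooth f) = f.1 v := by
  rw [ofSmooth, evalAt_mk, map_one, map_one, mul_one, mul_one]

theorem evalAt_jet_zero (v : fieldRange U) (r : DerJet D → ℝ) (b : Boson D) :
    evalAt v r (jet b (0, 0)) = v.1 b := by
  rw [jet_zero, evalAt_ofSmooth]
  rfl

theorem evalAt_jet (v : fieldRange U) (r : DerJet D → ℝ) (b : Boson D) (p) (h : p ≠ (0, 0)) :
    evalAt v r (jet b p) = r (b, ⟨p, h⟩) := by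
  rw [jet, dif_neg h, evalAt_mk, map_one, MvPolynomial.aeval_X]
  simp

/-- The point of field space over `x ∈ U` with `h_{++} = h_{--} = 0`. -/
def flatPoint (x : U) : fieldRange U :=
  ⟨Sum.elim x.1 fun _ => 0, by
    refine ⟨x.2, ?_⟩
    simp⟩

/-- The derivatives of the fields with prescribed `∂_+ X`, `∂_- X`, `∂_+ ∂_- X`, all others being
zero. -/
def flatJet (ξ : Bool → Fin D → ℝ) (ζ : Fin D → ℝ) (j : DerJet D) : ℝ :=
  Sum.elim (fun μ => if j.2.1 = (1, 0) then ξ true μ else if j.2.1 = (0, 1) then ξ false μ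
    else if j.2.1 = (1, 1) then ζ μ else 0) (fun _ => 0) j.1

theorem evalAt_ofX (x : U) (r : DerJet D → ℝ) (f : SmoothFun U) :
    evalAt (flatPoint x) r (ofX f) = f.1 x := by
  rw [ofX, evalAt_ofSmooth]
  rfl

theorem evalAt_flat_h (x : U) (ξ : Bool → Fin D → ℝ) (ζ) (α : Bool) (p) :
    evalAt (flatPoint x) (flatJet ξ ζ) (jet (Sum.inr α) p) = 0 := by
  by_cases h : p = (0, 0)
  · subst h
    rw [evalAt_jet_zero]
    rfl
  · rw [evalAt_jet _ _ _ _ h]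
    rfl

theorem evalAt_flat_inv (x : U) (r : DerJet D → ℝ) :
    evalAt (flatPoint x) r (ofSmooth (invOneSubY U)) = 1 := by
  rw [evalAt_ofSmooth]
  simp [invOneSubY, flatPoint]

theorem evalAt_covX (x : U) (ξ : Bool → Fin D → ℝ) (ζ) (α : Bool) (μ : Fin D) :
    evalAt (flatPoint x) (flatJet ξ ζ) (covX α μ) = ξ α μ := by
  rw [covX, map_mul, evalAt_flat_inv, nablaX, map_sub, map_mul, evalAt_flat_h,
    evalAt_jet _ _ _ _ (step_one_ne_zero _ _)]
  cases α <;> simp [flatJet, step]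

theorem evalAt_covXX (x : U) (ξ : Bool → Fin D → ℝ) (ζ) (μ : Fin D) :
    evalAt (flatPoint x) (flatJet ξ ζ) (covXX true μ) = ζ μ := by
  have h := congrArg (totalD true) (jet_eq_covX (U := U) false μ)
  simp only [totalD_jet, totalD_add, totalD_mul] at h
  have h' := congrArg (evalAt (flatPoint x) (flatJet ξ ζ)) h
  rw [map_add, map_add, map_mul, map_mul, evalAt_flat_h, evalAt_flat_h, zero_mul, zero_mul,
    add_zero, add_zero, evalAt_jet _ _ _ _ (step_one_ne_zero _ _)] at h'
  rw [covXX, map_mul, map_sub, map_sub, map_mul, map_mul, evalAt_flat_h, evalAt_flat_h, zero_mul,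
    zero_mul, sub_zero, sub_zero, evalAt_flat_inv, one_mul, Bool.not_true, ← h']
  simp [flatJet, step]

/-- A finite family of local functions that is linearly independent over `C^∞(U)`. -/
def IndepOverX {κ : Type} [Fintype κ] (B : κ → LocalFun U) : Prop :=
  ∀ f : κ → SmoothFun U, ∑ k, B k * ofX (f k) = 0 → f = 0

theorem indepOverX_one : IndepOverX (fun _ : Unit => (1 : LocalFun U)) := by
  intro f hf
  ext k x
  have h := congrArg (evalAt (flatPoint x) 0) hf
  simpa [evalAt_ofX] using h

theorem indepOverX_covX (α : Bool) : IndepOverX (covX α : Fin D → LocalFun U) := by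
  intro f hf
  ext μ x
  have h := congrArg (evalAt (flatPoint x) (flatJet (fun _ => Pi.single μ 1) 0)) hf
  simpa [evalAt_ofX, evalAt_covX, Pi.single_apply] using h

theorem indepOverX_second : IndepOverX (Sum.elim (covXX true)
    (fun k : Fin D × Fin D => covX true k.1 * covX false k.2) : _ → LocalFun U) := by
  intro f hf
  ext k x
  obtain μ | ⟨μ, ν⟩ := k
  · have h := congrArg (evalAt (flatPoint x) (flatJet 0 (Pi.single μ 1))) hf
    simpa [evalAt_ofX, evalAt_covX, evalAt_covXX, Pi.single_apply] using h
  · have h := congrArg (evalAt (flatPoint x) (flatJet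
      (fun α => if α then Pi.single μ 1 else Pi.single ν 1) 0)) hf
    simpa [evalAt_ofX, evalAt_covX, evalAt_covXX, Pi.single_apply, Fintype.sum_prod_type] using h

/-- Splitting off a ghost variable. -/
theorem eq_zero_of_add_ghost_mul (α : Bool) (p) (x y : LocalFun U)
    (hx : dGhost (α, p) x = 0) (hy : dGhost (α, p) y = 0) (h : x + ghost α p * y = 0) :
    x = 0 ∧ y = 0 := by
  classical
  have h' := congrArg (dGhost (α, p)) h
  rw [map_add, hx, dGhost_mul, hy, dGhost_ghost, if_pos rfl, one_mul, mul_zero, add_zero, zero_add,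
    map_zero] at h'
  rw [h', mul_zero, add_zero] at h
  exact ⟨h, h'⟩

theorem IndepOverX.eval {κ : Type} [Fintype κ] {B : κ → LocalFun U} (hB : IndepOverX B)
    (hb : ∀ k, B k ∈ bosonic U) (H : κ → Superfield U) (h : ∑ k, B k * (H k).eval = 0) :
    H = 0 := by
  have hm : ∀ a b, ∑ k, B k * ofX (H k a b) ∈ bosonic U := fun a b =>
    sum_mem fun k _ => mul_mem (hb k) (ofX_mem_bosonic _)
  have hd := fun a b g => dGhost_bosonic g (hm a b)
  have e : ∑ k, B k * (H k).eval
      = (∑ k, B k * ofX (H k false false)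
          + ghost false (step false 1 (0, 0)) * ∑ k, B k * ofX (H k false true))
        + ghost true (step true 1 (0, 0)) * (∑ k, B k * ofX (H k true false)
          + ghost false (step false 1 (0, 0)) * ∑ k, B k * ofX (H k true true)) := by
    simp only [mul_add, Finset.mul_sum, ← Finset.sum_add_distrib]
    refine Finset.sum_congr rfl fun k _ => ?_
    have hc := fun a b (y : LocalFun U) => (commute_of_parity (parity_bosonic
      (mul_mem (hb k) (ofX_mem_bosonic (H k a b)))) y).eq
    simp only [Superfield.eval, mul_add, ← Theta_eq, ← hc, ← mul_assoc]
    abel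
  rw [e] at h
  have hne : ∀ p q : ℕ × ℕ, ((true, p) : GhostJet) ≠ (false, q) := by simp
  have hg : dGhost (true, step true 1 (0, 0))
      (ghost false (step false 1 (0, 0)) : LocalFun U) = 0 := by
    classical
    rw [dGhost_ghost, if_neg (hne _ _)]
  obtain ⟨h1, h2⟩ := eq_zero_of_add_ghost_mul _ _ _ _ (by simp [dGhost_mul, hd, hg])
    (by simp [dGhost_mul, hd, hg]) h
  obtain ⟨h3, h4⟩ := eq_zero_of_add_ghost_mul _ _ _ _ (hd _ _ _) (hd _ _ _) h1
  obtain ⟨h5, h6⟩ := eq_zero_of_add_ghost_mul _ _ _ _ (hd _ _ _) (hd _ _ _) h2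
  funext k a b
  cases a <;> cases b
  · exact congrFun (hB _ h3) k
  · exact congrFun (hB _ h4) k
  · exact congrFun (hB _ h5) k
  · exact congrFun (hB _ h6) k

theorem eval_injective (H : Superfield U) (h : H.eval = 0) : H = 0 := by
  have := indepOverX_one.eval (fun _ => one_mem _) (fun _ : Unit => H) (by simpa using h)
  exact congrFun this ()

theorem partner_indep (α : Bool) (A : Option (Fin D) → Superfield U)
    (h : ∑ i, partner α i * (A i).eval = 0) : A = 0 := by
  rw [Fintype.sum_option, add_comm] at h
  have hg : ∀ β : Bool, ((α, step α 2 (0, 0)) : GhostJet) ≠ (β, step β 1 (0, 0)) := by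
    cases α <;> intro β <;> cases β <;> simp [step]
  have he := dGhost_eval_of_ne (U := U) _ hg
  obtain ⟨h1, h2⟩ := eq_zero_of_add_ghost_mul α (step α 2 (0, 0)) _ _
    (by simp [dGhost_mul, he, partner, dGhost_bosonic _ (covX_mem_bosonic _ _)]) (he _) h
  have h3 := (indepOverX_covX α).eval (covX_mem_bosonic α) (fun μ => A (some μ)) h1
  funext i
  cases i with
  | none => exact eval_injective _ h2
  | some μ => exact congrFun h3 μ

theorem second_indep (E : Fin D → Superfield U) (F : Option (Fin D) → Option (Fin D) → Superfield U)
    (h : ∑ μ, covXX true μ * (E μ).eval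
      + ∑ i, ∑ j, partner true i * partner false j * (F i j).eval = 0) : E = 0 ∧ F = 0 := by
  have hg : ∀ α β : Bool, ((α, step α 2 (0, 0)) : GhostJet) ≠ (β, step β 1 (0, 0)) := by
    intro α β
    cases α <;> cases β <;> simp [step]
  have he := fun α => dGhost_eval_of_ne (U := U) _ (hg α)
  have hX := fun g α μ => dGhost_bosonic g (covX_mem_bosonic (U := U) α μ)
  have hXX := fun g α μ => dGhost_bosonic g (covXX_mem_bosonic (U := U) α μ)
  have hn : dGhost (true, step true 2 (0, 0)) (ghost false (step false 2 (0, 0)) : LocalFun U)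
      = 0 := by
    classical
    rw [dGhost_ghost, if_neg (by simp)]
  have e : ∑ μ, covXX true μ * (E μ).eval
      + ∑ i, ∑ j, partner true i * partner false j * (F i j).eval
      = (∑ μ, covXX true μ * (E μ).eval
        + ∑ μ, ∑ j, covX true μ * partner false j * (F (some μ) j).eval)
        + ghost true (step true 2 (0, 0)) * ∑ j, partner false j * (F none j).eval := by
    rw [Fintype.sum_option]
    simp only [partner, Finset.mul_sum, mul_assoc]
    abel
  rw [e] at h
  obtain ⟨h1, h2⟩ := eq_zero_of_add_ghost_mul _ _ _ _
    (by simp [dGhost_mul, he, partner, hX, hXX, hn])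
    (by simp [dGhost_mul, he, partner, hX, hn]) h
  have e' : ∑ μ, covXX true μ * (E μ).eval
        + ∑ μ, ∑ j, covX true μ * partner false j * (F (some μ) j).eval
      = ∑ k, Sum.elim (covXX true) (fun k : Fin D × Fin D => covX true k.1 * covX false k.2) k
          * (Sum.elim E (fun k => F (some k.1) (some k.2)) k).eval
        + ghost false (step false 2 (0, 0)) * ∑ μ, covX true μ * (F (some μ) none).eval := by
    have hc := fun μ => (commute_of_parity (parity_bosonic (covX_mem_bosonic true μ))
      (ghost false (step false 2 (0, 0)) : LocalFun U)).eq
    simp only [Fintype.sum_sum_type, Sum.elim_inl, Sum.elim_inr, Fintype.sum_prod_type,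
      Fintype.sum_option, partner, Finset.sum_add_distrib, Finset.mul_sum, ← mul_assoc, hc]
    abel
  rw [e'] at h1
  obtain ⟨h3, h4⟩ := eq_zero_of_add_ghost_mul _ _ _ _
    (by simp [dGhost_mul, he, hX, hXX])
    (by simp [dGhost_mul, he, hX]) h1
  have h5 := indepOverX_second.eval (by
    rintro (μ | k)
    · exact covXX_mem_bosonic _ _
    · exact mul_mem (covX_mem_bosonic _ _) (covX_mem_bosonic _ _)) _ h3
  have h6 := (indepOverX_covX true).eval (covX_mem_bosonic true) _ h4
  refine ⟨funext fun μ => congrFun h5 (Sum.inl μ), ?_⟩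
  funext i j
  rcases i with _ | μ
  · exact congrFun (partner_indep false _ h2) j
  · rcases j with _ | ν
    · exact congrFun h6 μ
    · exact congrFun h5 (Sum.inr (μ, ν))

/-- The coefficients of a normal form are unique. -/
theorem normalForm_eq_zero (H : Superfield U) (A E F) (h : normalForm H A E F = 0) :
    H = 0 ∧ A = 0 ∧ E = 0 ∧ F = 0 := by
  have hg : ∀ α β : Bool, ((α, (0, 0)) : GhostJet) ≠ (β, step β 1 (0, 0)) := by
    intro α β
    cases β <;> simp [step]
  have he := fun α => dGhost_eval_of_ne (U := U) _ (hg α)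
  have hX := fun g α μ => dGhost_bosonic g (covX_mem_bosonic (U := U) α μ)
  have hXX := fun g α μ => dGhost_bosonic g (covXX_mem_bosonic (U := U) α μ)
  have hp : ∀ α β i, dGhost (α, (0, 0)) (partner β i : LocalFun U) = 0 := by
    classical
    intro α β i
    rcases i with _ | μ
    · rw [partner, dGhost_ghost, if_neg]
      cases β <;> simp [step]
    · exact hX _ _ _
  have hn : dGhost (true, (0, 0)) (ghost false (0, 0) : LocalFun U) = 0 := by
    classical
    rw [dGhost_ghost, if_neg (by simp)]
  have e : normalForm H A E F
      = (H.eval + ghost false (0, 0) * ∑ i, partner false i * (A false i).eval)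
        + ghost true (0, 0) * (∑ i, partner true i * (A true i).eval
          + ghost false (0, 0) * (∑ μ, covXX true μ * (E μ).eval
            + ∑ i, ∑ j, partner true i * partner false j * (-formSign i • F i j).eval)) := by
    have hpg : ∀ i, (partner true i * ghost false (0, 0) : LocalFun U)
        = -formSign i • (ghost false (0, 0) * partner true i) := by
      intro i
      rw [ghost_mul, parity_partner, smul_mul_assoc, smul_smul, neg_mul_neg, formSign_mul_self,
        one_smul]
    have hu : ∀ i j, (oneForm true i * oneForm false j * (F i j).eval)
        = ghost true (0, 0) * (ghost false (0, 0)
          * (partner true i * partner false j * (-formSign i • F i j).eval)) := by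
      intro i j
      rw [oneForm, oneForm, mul_assoc (ghost true (0, 0)), ← mul_assoc (partner true i), hpg,
        eval_smul]
      simp only [smul_mul_assoc, mul_smul_comm, mul_assoc]
    simp only [normalForm, Fintype.sum_bool, hu]
    simp only [oneForm, mixedForm, mul_add, Finset.mul_sum, mul_assoc]
    abel
  rw [e] at h
  obtain ⟨h1, h2⟩ := eq_zero_of_add_ghost_mul _ _ _ _
    (by simp [dGhost_mul, he, hp, hn]) (by simp [dGhost_mul, he, hp, hn, hXX]) h
  obtain ⟨h3, h4⟩ := eq_zero_of_add_ghost_mul _ _ _ _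
    (by simp [he]) (by simp [dGhost_mul, he, hp]) h1
  obtain ⟨h5, h6⟩ := eq_zero_of_add_ghost_mul _ _ _ _
    (by simp [dGhost_mul, he, hp]) (by simp [dGhost_mul, he, hp, hXX]) h2
  obtain ⟨h7, h8⟩ := second_indep _ _ h6
  refine ⟨eval_injective _ h3, ?_, h7, ?_⟩
  · funext α
    cases α
    · exact partner_indep _ _ h4
    · exact partner_indep _ _ h5
  · funext i j
    have h9 : -formSign i • F i j = 0 := congrFun (congrFun h8 i) j
    have h10 := congrArg (fun x => -formSign i • x) h9
    simpa [smul_smul, formSign_mul_self] using h10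

/-! ### The space `C^Φ` is the space of normal forms -/

/-- `x` has weights `i`, `j` with respect to `L^+_0`, `L^-_0`. -/
def IsWeight (i j : ℝ) (x : LocalFun U) : Prop :=
  weightOp true x = i • x ∧ weightOp false x = j • x

theorem weightOp_mul (α : Bool) (x y : LocalFun U) :
    weightOp α (x * y) = weightOp α x * y + x * weightOp α y := lieGhost_mul _ x y

theorem IsWeight.mul {i j k l : ℝ} {x y : LocalFun U} (hx : IsWeight i j x)
    (hy : IsWeight k l y) : IsWeight (i + k) (j + l) (x * y) := by
  constructor
  · rw [weightOp_mul, hx.1, hy.1, smul_mul_assoc, mul_smul_comm, add_smul]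
  · rw [weightOp_mul, hx.2, hy.2, smul_mul_assoc, mul_smul_comm, add_smul]

theorem IsWeight.smul {i j : ℝ} {x : LocalFun U} (hx : IsWeight i j x) (r : ℝ) :
    IsWeight i j (r • x) := by
  constructor
  · rw [map_smul, hx.1, smul_comm]
  · rw [map_smul, hx.2, smul_comm]

theorem isWeight_one : IsWeight 0 0 (1 : LocalFun U) := by
  constructor <;> rw [zero_smul] <;> exact lieGhost_one _

theorem isWeight_ofX (f : SmoothFun U) : IsWeight 0 0 (ofX f) := by
  have h : ∀ α, weightOp α (ofX f) = 0 := by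
    classical
    intro α
    have h := step_one_ne_zero α (0, 0)
    rw [weightOp, lieGhost_bosonic _ (ofX_mem_bosonic f), S_ofX, map_sum]
    refine Finset.sum_eq_zero fun μ _ => ?_
    rw [dGhost_mul, dGhost_bosonic _ (ofX_mem_bosonic _), S_X α, map_add, dGhost_mul, dGhost_mul,
      dGhost_bosonic _ (covX_mem_bosonic _ _), dGhost_bosonic _ (covX_mem_bosonic _ _),
      dGhost_ghost, dGhost_ghost]
    simp [h]
  constructor <;> rw [zero_smul, h]

theorem isWeight_chiralX (μ : Fin D) (m n : ℕ) : IsWeight m n (chiralX μ m n : LocalFun U) := by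
  constructor <;> rw [weightOp_chiralX] <;> simp

theorem isWeight_covGhost_true (k : ℕ) : IsWeight (k - 1) 0 (covGhost true k : LocalFun U) := by
  constructor <;> rw [weightOp_covGhost] <;> simp

theorem isWeight_covGhost_false (k : ℕ) : IsWeight 0 (k - 1) (covGhost false k : LocalFun U) := by
  constructor <;> rw [weightOp_covGhost] <;> simp

theorem covGhost_zero (α : Bool) : (covGhost α 0 : LocalFun U) = ghost α (0, 0) := by
  simp [covGhost]

theorem covGhost_two (α : Bool) :
    (covGhost α 2 : LocalFun U) = (2⁻¹ : ℝ) • partner α none := by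
  simp [covGhost, partner]

theorem partner_none (α : Bool) : (partner α none : LocalFun U) = (2 : ℝ) • covGhost α 2 := by
  rw [covGhost_two, smul_smul]
  simp

theorem isWeight_eval (H : Superfield U) : IsWeight 0 0 H.eval := by
  have hθ : ∀ α, IsWeight 0 0 (Theta α : LocalFun U) := by
    intro α
    cases α
    · simpa [Theta] using isWeight_covGhost_false (U := U) 1
    · simpa [Theta] using isWeight_covGhost_true (U := U) 1
  have hadd : ∀ x y : LocalFun U, IsWeight 0 0 x → IsWeight 0 0 y → IsWeight 0 0 (x + y) := by
    intro x y hx hy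
    constructor
    · rw [map_add, hx.1, hy.1, smul_add]
    · rw [map_add, hx.2, hy.2, smul_add]
  have hmul : ∀ x y : LocalFun U, IsWeight 0 0 x → IsWeight 0 0 y → IsWeight 0 0 (x * y) := by
    intro x y hx hy
    simpa using hx.mul hy
  exact hadd _ _ (hadd _ _ (hadd _ _ (isWeight_ofX _) (hmul _ _ (isWeight_ofX _) (hθ _)))
    (hmul _ _ (isWeight_ofX _) (hθ _))) (hmul _ _ (isWeight_ofX _) (hmul _ _ (hθ _) (hθ _)))

theorem isWeight_oneForm (α : Bool) (i : Option (Fin D)) :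
    IsWeight 0 0 (oneForm α i : LocalFun U) := by
  rw [oneForm, ← covGhost_zero]
  cases α <;> cases i
  · rw [partner_none, mul_smul_comm]
    refine IsWeight.smul ?_ _
    convert (isWeight_covGhost_false 0).mul (isWeight_covGhost_false 2) using 1 <;> norm_num
  · rw [partner, ← chiralX_zero_one]
    convert (isWeight_covGhost_false 0).mul (isWeight_chiralX _ 0 1) using 1 <;> norm_num
  · rw [partner_none, mul_smul_comm]
    refine IsWeight.smul ?_ _
    convert (isWeight_covGhost_true 0).mul (isWeight_covGhost_true 2) using 1 <;> norm_num
  · rw [partner, ← chiralX_one_zero]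
    convert (isWeight_covGhost_true 0).mul (isWeight_chiralX _ 1 0) using 1 <;> norm_num

theorem isWeight_mixedForm (μ : Fin D) : IsWeight 0 0 (mixedForm μ : LocalFun U) := by
  rw [mixedForm, ← covGhost_zero, ← covGhost_zero, ← chiralX_one_one]
  convert (isWeight_covGhost_true 0).mul ((isWeight_covGhost_false 0).mul (isWeight_chiralX _ 1 1))
    using 1 <;> norm_num

theorem covGhost_mem (α : Bool) (k : ℕ) : covGhost α k ∈ covariantFun U :=
  Algebra.subset_adjoin (Or.inr ⟨(α, k), rfl⟩)

theorem chiralX_mem (μ : Fin D) (m n : ℕ) : chiralX μ m n ∈ covariantFun U :=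
  Algebra.subset_adjoin (Or.inl (Or.inr ⟨(μ, m, n), rfl⟩))

theorem ofX_mem (f : SmoothFun U) : ofX f ∈ covariantFun U :=
  Algebra.subset_adjoin (Or.inl (Or.inl ⟨f, rfl⟩))

theorem eval_mem (H : Superfield U) : H.eval ∈ covariantFun U :=
  add_mem (add_mem (add_mem (ofX_mem _) (mul_mem (ofX_mem _) (covGhost_mem _ _)))
    (mul_mem (ofX_mem _) (covGhost_mem _ _)))
    (mul_mem (ofX_mem _) (mul_mem (covGhost_mem _ _) (covGhost_mem _ _)))

theorem oneForm_mem (α : Bool) (i : Option (Fin D)) : oneForm α i ∈ covariantFun U := by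
  rw [oneForm, ← covGhost_zero]
  refine mul_mem (covGhost_mem _ _) ?_
  cases i
  · rw [partner_none]
    exact Subalgebra.smul_mem _ (covGhost_mem _ _) _
  · cases α
    · rw [partner, ← chiralX_zero_one]
      exact chiralX_mem _ _ _
    · rw [partner, ← chiralX_one_zero]
      exact chiralX_mem _ _ _

theorem mixedForm_mem (μ : Fin D) : mixedForm μ ∈ covariantFun U := by
  rw [mixedForm, ← covGhost_zero, ← covGhost_zero, ← chiralX_one_one]
  exact mul_mem (covGhost_mem _ _) (mul_mem (covGhost_mem _ _) (chiralX_mem _ _ _))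

theorem normalForm_mem (H : Superfield U) (A E F) : normalForm H A E F ∈ covariantFun U :=
  add_mem (add_mem (add_mem (eval_mem _)
    (sum_mem fun _ _ => sum_mem fun _ _ => mul_mem (oneForm_mem _ _) (eval_mem _)))
    (sum_mem fun _ _ => mul_mem (mixedForm_mem _) (eval_mem _)))
    (sum_mem fun _ _ => sum_mem fun _ _ =>
      mul_mem (mul_mem (oneForm_mem _ _) (oneForm_mem _ _)) (eval_mem _))

theorem weightOp_normalForm (α : Bool) (H : Superfield U) (A E F) :
    weightOp α (normalForm H A E F) = 0 := by
  have h : ∀ x : LocalFun U, IsWeight 0 0 x → weightOp α x = 0 := by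
    intro x hx
    cases α
    · rw [hx.2, zero_smul]
    · rw [hx.1, zero_smul]
  simp only [normalForm, map_add, map_sum, weightOp_mul, h _ (isWeight_eval _),
    h _ (isWeight_oneForm _ _), h _ (isWeight_mixedForm _), zero_mul, mul_zero, add_zero,
    Finset.sum_const_zero]

/-- `NonnegWord m n x`: `x` is a product, of total weights `m`, `n`, of the generators other than
the undifferentiated ghosts; all of these generators have non-negative weights. -/
inductive NonnegWord : ℕ → ℕ → LocalFun U → Prop
  | one : NonnegWord 0 0 1
  | smooth (f : SmoothFun U) {m n x} : NonnegWord m n x → NonnegWord m n (ofX f * x)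
  | chiral (μ : Fin D) (k l : ℕ) {m n x} :
      NonnegWord m n x → NonnegWord (k + m) (l + n) (chiralX μ k l * x)
  | ghostTrue (k : ℕ) {m n x} : NonnegWord m n x → NonnegWord (k + m) n (covGhost true (k + 1) * x)
  | ghostFalse (k : ℕ) {m n x} :
      NonnegWord m n x → NonnegWord m (k + n) (covGhost false (k + 1) * x)

theorem NonnegWord.isWeight {m n : ℕ} {x : LocalFun U} (h : NonnegWord m n x) :
    IsWeight m n x := by
  induction h with
  | one => simpa using isWeight_one
  | smooth f _ ih => simpa using (isWeight_ofX f).mul ih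
  | chiral μ k l _ ih => simpa using (isWeight_chiralX μ k l).mul ih
  | ghostTrue k _ ih => simpa using (isWeight_covGhost_true (k + 1)).mul ih
  | ghostFalse k _ ih => simpa using (isWeight_covGhost_false (k + 1)).mul ih

/-- Module generators, over the superfields, of the products of weights `(m, n)` with
`m, n ≤ 1`. -/
def lowGen : ℕ → ℕ → Set (LocalFun U)
  | 0, 0 => {1}
  | 1, 0 => Set.range (partner true)
  | 0, 1 => Set.range (partner false)
  | 1, 1 => {s | (∃ μ, s = covXX true μ) ∨ ∃ i j, s = partner true i * partner false j}
  | _, _ => ∅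

theorem parity_lowGen {m n : ℕ} {s : LocalFun U} (hs : s ∈ lowGen m n) :
    parity s = s ∨ parity s = -s := by
  have hp : ∀ α i, parity (partner α i : LocalFun U) = partner α i
      ∨ parity (partner α i : LocalFun U) = -partner α i := by
    intro α i
    cases i <;> simp [parity_partner, formSign]
  match m, n, hs with
  | 0, 0, hs => left; rw [Set.mem_singleton_iff.1 hs, map_one]
  | 1, 0, ⟨i, hi⟩ => rw [← hi]; exact hp _ _
  | 0, 1, ⟨i, hi⟩ => rw [← hi]; exact hp _ _
  | 1, 1, Or.inl ⟨μ, hμ⟩ => left; rw [hμ, parity_covXX]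
  | 1, 1, Or.inr ⟨i, j, hs⟩ =>
    rw [hs, map_mul]
    rcases hp true i with h | h <;> rcases hp false j with h' | h' <;> simp [h, h']

/-- The superfield module generated by `lowGen m n`. -/
def lowSpan (m n : ℕ) : Submodule ℝ (LocalFun U) :=
  Submodule.span ℝ {w | ∃ s ∈ lowGen m n, ∃ H : Superfield U, w = s * H.eval}

theorem mul_mem_of_gen {m n : ℕ} {P : Submodule ℝ (LocalFun U)} (g : LocalFun U)
    (hg : ∀ s ∈ lowGen m n, ∀ H : Superfield U, g * (s * H.eval) ∈ P) {x : LocalFun U}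
    (hx : x ∈ lowSpan m n) : g * x ∈ P := by
  have h : lowSpan m n ≤ P.comap (LinearMap.mulLeft ℝ g) := by
    refine Submodule.span_le.2 ?_
    rintro w ⟨s, hs, H, rfl⟩
    exact hg s hs H
  exact h hx

theorem gen_mul_eval_mem {m n : ℕ} {s : LocalFun U} (hs : s ∈ lowGen m n) (H : Superfield U) :
    s * H.eval ∈ lowSpan m n := Submodule.subset_span ⟨s, hs, H, rfl⟩

theorem ofX_mul_mem {m n : ℕ} (f : SmoothFun U) {x : LocalFun U} (hx : x ∈ lowSpan m n) :
    ofX f * x ∈ lowSpan m n := by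
  refine mul_mem_of_gen _ (fun s hs H => ?_) hx
  rw [← mul_assoc, (commute_ofX f s).eq, mul_assoc, ← eval_funMul]
  exact gen_mul_eval_mem hs _

theorem Theta_mul_mem {m n : ℕ} (α : Bool) {x : LocalFun U} (hx : x ∈ lowSpan m n) :
    Theta α * x ∈ lowSpan m n := by
  refine mul_mem_of_gen _ (fun s hs H => ?_) hx
  rw [← mul_assoc, odd_mul (parity_Theta α)]
  rcases parity_lowGen hs with h | h
  · rw [h, mul_assoc, ← eval_thetaMul]
    exact gen_mul_eval_mem hs _
  · rw [h, neg_mul, neg_mul, mul_assoc, ← eval_thetaMul]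
    exact neg_mem (gen_mul_eval_mem hs _)

theorem partner_true_mul_mem {n : ℕ} (hn : n ≤ 1) (i : Option (Fin D)) {x : LocalFun U}
    (hx : x ∈ lowSpan 0 n) : partner true i * x ∈ lowSpan 1 n := by
  refine mul_mem_of_gen _ (fun s hs H => ?_) hx
  rw [← mul_assoc]
  refine gen_mul_eval_mem ?_ H
  interval_cases n
  · rw [Set.mem_singleton_iff.1 hs, mul_one]
    exact ⟨i, rfl⟩
  · obtain ⟨j, rfl⟩ := hs
    exact Or.inr ⟨i, j, rfl⟩

theorem partner_false_mul_mem {m : ℕ} (hm : m ≤ 1) (j : Option (Fin D)) {x : LocalFun U}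
    (hx : x ∈ lowSpan m 0) : partner false j * x ∈ lowSpan m 1 := by
  refine mul_mem_of_gen _ (fun s hs H => ?_) hx
  rw [← mul_assoc]
  interval_cases m
  · rw [Set.mem_singleton_iff.1 hs, mul_one]
    exact gen_mul_eval_mem (m := 0) (n := 1) ⟨j, rfl⟩ H
  · obtain ⟨i, rfl⟩ := hs
    have h := gen_mul_eval_mem (m := 1) (n := 1) (s := partner true i * partner false j)
      (Or.inr ⟨i, j, rfl⟩) H
    have hc : ∃ r : ℝ, (partner false j * partner true i : LocalFun U)
        = r • (partner true i * partner false j) := by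
      have hi := parity_partner (U := U) true i
      have hj := parity_partner (U := U) false j
      cases i with
      | some μ =>
        refine ⟨1, ?_⟩
        rw [formSign, neg_neg, one_smul] at hi
        rw [one_smul, (commute_of_parity hi _).eq]
      | none =>
        rw [formSign, neg_one_smul] at hi
        refine ⟨-formSign j, ?_⟩
        rw [odd_mul hi, hj, smul_mul_assoc, smul_smul, neg_mul_neg, formSign_mul_self, one_smul]
    obtain ⟨r, hr⟩ := hc
    rw [hr, smul_mul_assoc]
    exact Submodule.smul_mem _ _ h

theorem covXX_mul_mem (μ : Fin D) {x : LocalFun U} (hx : x ∈ lowSpan 0 0) :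
    covXX true μ * x ∈ lowSpan 1 1 := by
  refine mul_mem_of_gen _ (fun s hs H => ?_) hx
  rw [Set.mem_singleton_iff.1 hs, one_mul]
  exact gen_mul_eval_mem (m := 1) (n := 1) (Or.inl ⟨μ, rfl⟩) H

theorem NonnegWord.mem_lowSpan {m n : ℕ} {x : LocalFun U} (h : NonnegWord m n x) (hm : m ≤ 1)
    (hn : n ≤ 1) : x ∈ lowSpan m n := by
  induction h with
  | one =>
    have h := gen_mul_eval_mem (U := U) (m := 0) (n := 0) (Set.mem_singleton 1)
      (fun a b => if a = false ∧ b = false then 1 else 0)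
    rw [one_mul] at h
    convert h using 1
    simp [Superfield.eval, ofX_zero, ofX_one]
  | smooth f _ ih => exact ofX_mul_mem f (ih hm hn)
  | @chiral μ k l m n x _ ih =>
    have ih := ih (by omega) (by omega)
    obtain rfl | rfl : k = 0 ∨ k = 1 := by omega
    · rw [zero_add]
      obtain rfl | rfl : l = 0 ∨ l = 1 := by omega
      · rw [zero_add, chiralX_zero_zero, ← ofX_coord]
        exact ofX_mul_mem _ ih
      · obtain rfl : n = 0 := by omega
        rw [chiralX_zero_one]
        exact partner_false_mul_mem (by omega) (some μ) ih
    · obtain rfl : m = 0 := by omega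
      obtain rfl | rfl : l = 0 ∨ l = 1 := by omega
      · rw [zero_add, chiralX_one_zero]
        exact partner_true_mul_mem (by omega) (some μ) ih
      · obtain rfl : n = 0 := by omega
        rw [chiralX_one_one]
        exact covXX_mul_mem μ ih
  | @ghostTrue k m n x _ ih =>
    have ih := ih (by omega) (by omega)
    obtain rfl | rfl : k = 0 ∨ k = 1 := by omega
    · rw [zero_add]
      exact Theta_mul_mem true ih
    · obtain rfl : m = 0 := by omega
      rw [covGhost_two, smul_mul_assoc]
      exact Submodule.smul_mem _ _ (partner_true_mul_mem (by omega) none ih)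
  | @ghostFalse k m n x _ ih =>
    have ih := ih (by omega) (by omega)
    obtain rfl | rfl : k = 0 ∨ k = 1 := by omega
    · rw [zero_add, zero_add]
      exact Theta_mul_mem false ih
    · obtain rfl : n = 0 := by omega
      rw [covGhost_two, smul_mul_assoc]
      exact Submodule.smul_mem _ _ (partner_false_mul_mem (by omega) none ih)

/-- The words of weights `k`: a product of generators of non-negative weights, multiplied by one of
`1`, `c^+`, `c^-`, `c^+ c^-`. -/
def words (k : ℤ × ℤ) : Set (LocalFun U) :=
  {w | ∃ (m n : ℕ) (x : LocalFun U), NonnegWord m n x ∧ ((k = ((m : ℤ), (n : ℤ)) ∧ w = x)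
    ∨ (k = ((m : ℤ) - 1, (n : ℤ)) ∧ w = ghost true (0, 0) * x)
    ∨ (k = ((m : ℤ), (n : ℤ) - 1) ∧ w = ghost false (0, 0) * x)
    ∨ (k = ((m : ℤ) - 1, (n : ℤ) - 1) ∧ w = ghost true (0, 0) * (ghost false (0, 0) * x)))}

theorem isWeight_words {k : ℤ × ℤ} {w : LocalFun U} (hw : w ∈ words k) :
    IsWeight k.1 k.2 w := by
  have h1 := isWeight_covGhost_true (U := U) 0
  have h2 := isWeight_covGhost_false (U := U) 0
  rw [covGhost_zero] at h1 h2
  obtain ⟨m, n, x, hx, ⟨rfl, rfl⟩ | ⟨rfl, rfl⟩ | ⟨rfl, rfl⟩ | ⟨rfl, rfl⟩⟩ := hw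
  · simpa using hx.isWeight
  · convert h1.mul hx.isWeight using 1 <;> push_cast <;> ring
  · convert h2.mul hx.isWeight using 1 <;> push_cast <;> ring
  · convert h1.mul (h2.mul hx.isWeight) using 1 <;> push_cast <;> ring

/-- The span of all words. -/
def wordSpan (U : Opens (Fin D → ℝ)) : Submodule ℝ (LocalFun U) := ⨆ k, Submodule.span ℝ (words k)

theorem word_mem {k : ℤ × ℤ} {w : LocalFun U} (hw : w ∈ words k) : w ∈ wordSpan U :=
  Submodule.mem_iSup_of_mem k (Submodule.subset_span hw)

theorem mul_mem_wordSpan (g : LocalFun U)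
    (hg : ∀ k, ∀ w ∈ words k, g * w ∈ wordSpan U) {x : LocalFun U} (hx : x ∈ wordSpan U) :
    g * x ∈ wordSpan U := by
  have h : wordSpan U ≤ (wordSpan U).comap (LinearMap.mulLeft ℝ g) :=
    iSup_le fun k => Submodule.span_le.2 fun w hw => hg k w hw
  exact h hx

theorem mul_mem_wordSpan_of_nonneg {g : LocalFun U} {k l : ℕ} {s : ℝ} (hs : s * s = 1)
    (hp : parity g = s • g)
    (hg : ∀ m n x, NonnegWord m n x → NonnegWord (k + m) (l + n) (g * x)) {x : LocalFun U}
    (hx : x ∈ wordSpan U) : g * x ∈ wordSpan U := by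
  have hc : ∀ α (y : LocalFun U), g * (ghost α (0, 0) * y) = s • (ghost α (0, 0) * (g * y)) := by
    intro α y
    rw [← mul_assoc (ghost α (0, 0)), ghost_mul α _ g, hp, smul_mul_assoc, smul_mul_assoc,
      smul_smul, hs, one_smul, mul_assoc]
  refine mul_mem_wordSpan g ?_ hx
  rintro _ w ⟨m, n, y, hy, ⟨-, rfl⟩ | ⟨-, rfl⟩ | ⟨-, rfl⟩ | ⟨-, rfl⟩⟩
  · exact word_mem ⟨_, _, _, hg _ _ _ hy, Or.inl ⟨rfl, rfl⟩⟩
  · rw [hc]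
    exact Submodule.smul_mem _ _ (word_mem ⟨_, _, _, hg _ _ _ hy, Or.inr (Or.inl ⟨rfl, rfl⟩)⟩)
  · rw [hc]
    exact Submodule.smul_mem _ _
      (word_mem ⟨_, _, _, hg _ _ _ hy, Or.inr (Or.inr (Or.inl ⟨rfl, rfl⟩))⟩)
  · rw [hc, hc, mul_smul_comm, smul_smul, hs, one_smul]
    exact word_mem ⟨_, _, _, hg _ _ _ hy, Or.inr (Or.inr (Or.inr ⟨rfl, rfl⟩))⟩

theorem ghost_mul_mem_wordSpan (α : Bool) {x : LocalFun U} (hx : x ∈ wordSpan U) :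
    ghost α (0, 0) * x ∈ wordSpan U := by
  have h0 : ∀ (α : Bool) (y : LocalFun U), ghost α (0, 0) * (ghost α (0, 0) * y) = 0 := by
    intro α y
    rw [← mul_assoc, ghost_mul_self, zero_mul]
  have h1 : ∀ y : LocalFun U, ghost false (0, 0) * (ghost true (0, 0) * y)
      = -(ghost true (0, 0) * (ghost false (0, 0) * y)) := by
    intro y
    rw [← mul_assoc, ghost_mul_ghost, neg_mul, mul_assoc]
  refine mul_mem_wordSpan _ ?_ hx
  rintro _ w ⟨m, n, y, hy, ⟨-, rfl⟩ | ⟨-, rfl⟩ | ⟨-, rfl⟩ | ⟨-, rfl⟩⟩ <;> cases α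
  · exact word_mem ⟨_, _, _, hy, Or.inr (Or.inr (Or.inl ⟨rfl, rfl⟩))⟩
  · exact word_mem ⟨_, _, _, hy, Or.inr (Or.inl ⟨rfl, rfl⟩)⟩
  · rw [h1]
    exact neg_mem (word_mem ⟨_, _, _, hy, Or.inr (Or.inr (Or.inr ⟨rfl, rfl⟩))⟩)
  · rw [h0]
    exact zero_mem _
  · rw [h0]
    exact zero_mem _
  · exact word_mem ⟨_, _, _, hy, Or.inr (Or.inr (Or.inr ⟨rfl, rfl⟩))⟩
  · rw [h1, h0, mul_zero, neg_zero]
    exact zero_mem _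
  · rw [h0]
    exact zero_mem _

theorem covariantFun_le_wordSpan {x : LocalFun U} (hx : x ∈ covariantFun U) : x ∈ wordSpan U := by
  have key : ∀ y ∈ wordSpan U, x * y ∈ wordSpan U := by
    induction hx using Algebra.adjoin_induction with
    | mem x hx =>
      intro y hy
      obtain (⟨f, rfl⟩ | ⟨⟨μ, k, l⟩, rfl⟩) | ⟨⟨α, k⟩, rfl⟩ := hx
      · exact mul_mem_wordSpan_of_nonneg (k := 0) (l := 0) (one_mul 1)
          ((parity_bosonic (ofX_mem_bosonic f)).trans (one_smul _ _).symm)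
          (fun m n x h => by simpa using h.smooth f) hy
      · exact mul_mem_wordSpan_of_nonneg (one_mul 1)
          ((parity_bosonic (chiralX_mem_bosonic μ k l)).trans (one_smul _ _).symm)
          (fun m n x h => h.chiral μ k l) hy
      · cases k with
        | zero =>
          simp only [covGhost_zero]
          exact ghost_mul_mem_wordSpan α hy
        | succ k =>
          have hp : parity (covGhost α (k + 1) : LocalFun U) = (-1 : ℝ) • covGhost α (k + 1) := by
            rw [covGhost, map_smul, parity_ghost, smul_neg, neg_one_smul]
          cases α
          · exact mul_mem_wordSpan_of_nonneg (k := 0) (l := k) (by norm_num) hp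
              (fun m n x h => by simpa using h.ghostFalse k) hy
          · exact mul_mem_wordSpan_of_nonneg (k := k) (l := 0) (by norm_num) hp
              (fun m n x h => by simpa using h.ghostTrue k) hy
    | algebraMap r =>
      intro y hy
      rw [← Algebra.smul_def]
      exact Submodule.smul_mem _ _ hy
    | add x x' _ _ h h' =>
      intro y hy
      rw [add_mul]
      exact add_mem (h y hy) (h' y hy)
    | mul x x' _ _ h h' =>
      intro y hy
      rw [mul_assoc]
      exact h _ (h' y hy)
  have h1 : (1 : LocalFun U) ∈ wordSpan U :=
    word_mem ⟨_, _, _, NonnegWord.one, Or.inl ⟨rfl, rfl⟩⟩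
  simpa using key 1 h1

/-- A vector in the kernel of an endomorphism only has components in the eigenspaces of the
eigenvalue zero. -/
theorem mem_iSup_of_apply_eq_zero {M κ : Type*} [AddCommGroup M] [Module ℝ M]
    (f : Module.End ℝ M) (c : κ → ℝ) (V : κ → Submodule ℝ M) (hV : ∀ k, V k ≤ f.eigenspace (c k))
    {x : M} (hx : x ∈ ⨆ k, V k) (h0 : f x = 0) : x ∈ ⨆ k, ⨆ _ : c k = 0, V k := by
  rw [iSup_split V (fun k => c k = 0)] at hx
  obtain ⟨y, hy, z, hz, rfl⟩ := Submodule.mem_sup.1 hx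
  have hy0 : y ∈ f.eigenspace 0 := by
    have h : (⨆ k, ⨆ _ : c k = 0, V k) ≤ f.eigenspace 0 :=
      iSup_le fun k => iSup_le fun hk => hk ▸ hV k
    exact h hy
  have hz0 : z ∈ f.eigenspace 0 := by
    rw [Module.End.mem_eigenspace_iff, zero_smul] at hy0 ⊢
    rwa [map_add, hy0, zero_add] at h0
  have hz' : z ∈ ⨆ r, ⨆ _ : r ≠ 0, f.eigenspace r := by
    have h : (⨆ k, ⨆ _ : ¬ c k = 0, V k) ≤ ⨆ r, ⨆ _ : r ≠ 0, f.eigenspace r :=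
      iSup_le fun k => iSup_le fun hk => (hV k).trans (le_iSup₂_of_le (c k) hk le_rfl)
    exact h hz
  rw [Submodule.disjoint_def.1 (Module.End.eigenspaces_iSupIndep f 0) z hz0 hz', add_zero]
  exact hy

/-- Elements annihilated by `L^+_0` and `L^-_0` are combinations of words of vanishing weights. -/
theorem mem_span_words_zero {x : LocalFun U} (hx : x ∈ wordSpan U) (h1 : weightOp true x = 0)
    (h2 : weightOp false x = 0) : x ∈ Submodule.span ℝ (words (U := U) (0, 0)) := by
  have hle : ∀ k : ℤ × ℤ, Submodule.span ℝ (words (U := U) k)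
      ≤ Module.End.eigenspace (weightOp true) (k.1 : ℝ) := fun k =>
    Submodule.span_le.2 fun w hw => Module.End.mem_eigenspace_iff.2 (isWeight_words hw).1
  have hle' : ∀ k : ℤ × ℤ, Submodule.span ℝ (words (U := U) k)
      ≤ Module.End.eigenspace (weightOp false) (k.2 : ℝ) := fun k =>
    Submodule.span_le.2 fun w hw => Module.End.mem_eigenspace_iff.2 (isWeight_words hw).2
  have hx1 := mem_iSup_of_apply_eq_zero (weightOp true) (fun k : ℤ × ℤ => (k.1 : ℝ)) _ hle hx h1
  have hx2 := mem_iSup_of_apply_eq_zero (weightOp false) (fun k : ℤ × ℤ => (k.2 : ℝ)) _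
    (fun k => iSup_le fun _ => hle' k) hx1 h2
  have h : (⨆ k : ℤ × ℤ, ⨆ _ : (k.2 : ℝ) = 0, ⨆ _ : (k.1 : ℝ) = 0,
      Submodule.span ℝ (words (U := U) k)) ≤ Submodule.span ℝ (words (U := U) (0, 0)) := by
    refine iSup_le fun k => iSup_le fun h => iSup_le fun h' => ?_
    obtain ⟨i, j⟩ := k
    have hi : i = 0 := by exact_mod_cast h'
    have hj : j = 0 := by exact_mod_cast h
    rw [hi, hj]
  exact h hx2

/-- The normal forms as a subspace. -/
def normalForms (U : Opens (Fin D → ℝ)) : Submodule ℝ (LocalFun U) where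
  carrier := {x | ∃ H A E F, x = normalForm H A E F}
  add_mem' := by
    rintro _ _ ⟨H, A, E, F, rfl⟩ ⟨H', A', E', F', rfl⟩
    exact ⟨_, _, _, _, (normalForm_add ..).symm⟩
  zero_mem' := ⟨_, _, _, _, normalForm_zero.symm⟩
  smul_mem' := by
    rintro r _ ⟨H, A, E, F, rfl⟩
    exact ⟨_, _, _, _, (normalForm_smul ..).symm⟩

theorem eval_mem_normalForms (H : Superfield U) : H.eval ∈ normalForms U :=
  ⟨H, 0, 0, 0, by simp [normalForm]⟩

theorem oneForm_mul_eval_mem (α : Bool) (i : Option (Fin D)) (H : Superfield U) :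
    oneForm α i * H.eval ∈ normalForms U := by
  classical
  refine ⟨0, Pi.single α (Pi.single i H), 0, 0, ?_⟩
  rw [normalForm, Finset.sum_eq_single α (by intro β _ h; simp [h]) (by simp),
    Finset.sum_eq_single i (by intro j _ h; simp [h]) (by simp)]
  simp

theorem mixedForm_mul_eval_mem (μ : Fin D) (H : Superfield U) :
    mixedForm μ * H.eval ∈ normalForms U := by
  classical
  refine ⟨0, 0, Pi.single μ H, 0, ?_⟩
  rw [normalForm, Finset.sum_eq_single (f := fun μ' => mixedForm μ' * _) μ
    (by intro ν _ h; simp [h]) (by simp)]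
  simp

theorem oneForm_mul_oneForm_mul_eval_mem (i j : Option (Fin D)) (H : Superfield U) :
    oneForm true i * oneForm false j * H.eval ∈ normalForms U := by
  classical
  refine ⟨0, 0, 0, Pi.single i (Pi.single j H), ?_⟩
  rw [normalForm, Finset.sum_eq_single (f := fun i' => ∑ j', oneForm true i' * oneForm false j' * _)
    i (by intro k _ h; simp [h]) (by simp),
    Finset.sum_eq_single (f := fun j' => oneForm true i * oneForm false j' * _) j
    (by intro k _ h; simp [h]) (by simp)]
  simp

theorem words_zero_subset {w : LocalFun U} (hw : w ∈ words (0, 0)) : w ∈ normalForms U := by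
  obtain ⟨m, n, x, hx, ⟨hk, rfl⟩ | ⟨hk, rfl⟩ | ⟨hk, rfl⟩ | ⟨hk, rfl⟩⟩ := hw <;>
    rw [Prod.mk.injEq] at hk
  · obtain rfl : m = 0 := by omega
    obtain rfl : n = 0 := by omega
    rw [← one_mul w]
    refine mul_mem_of_gen 1 (fun s hs H => ?_) (hx.mem_lowSpan (by omega) (by omega))
    rw [Set.mem_singleton_iff.1 hs, one_mul, one_mul]
    exact eval_mem_normalForms H
  · obtain rfl : m = 1 := by omega
    obtain rfl : n = 0 := by omega
    refine mul_mem_of_gen _ (fun s hs H => ?_) (hx.mem_lowSpan (by omega) (by omega))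
    obtain ⟨i, rfl⟩ := hs
    rw [← mul_assoc]
    exact oneForm_mul_eval_mem true i H
  · obtain rfl : m = 0 := by omega
    obtain rfl : n = 1 := by omega
    refine mul_mem_of_gen _ (fun s hs H => ?_) (hx.mem_lowSpan (by omega) (by omega))
    obtain ⟨i, rfl⟩ := hs
    rw [← mul_assoc]
    exact oneForm_mul_eval_mem false i H
  · obtain rfl : m = 1 := by omega
    obtain rfl : n = 1 := by omega
    rw [← mul_assoc]
    refine mul_mem_of_gen _ (fun s hs H => ?_) (hx.mem_lowSpan (by omega) (by omega))
    obtain ⟨μ, rfl⟩ | ⟨i, j, rfl⟩ := hs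
    · rw [mul_assoc, ← mul_assoc (ghost false (0, 0)), ← mul_assoc]
      exact mixedForm_mul_eval_mem μ H
    · have hg : (ghost false (0, 0) * partner true i : LocalFun U)
          = -formSign i • (partner true i * ghost false (0, 0)) := by
        rw [ghost_mul, parity_partner, smul_mul_assoc]
      have e : ghost true (0, 0) * ghost false (0, 0)
          * (partner true i * partner false j * H.eval)
          = -formSign i • (oneForm true i * oneForm false j * H.eval) := by
        rw [oneForm, oneForm, ← mul_assoc, ← mul_assoc, mul_assoc (ghost true (0, 0)), hg,
          mul_smul_comm, smul_mul_assoc, smul_mul_assoc]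
        simp only [mul_assoc]
      rw [e]
      exact Submodule.smul_mem _ _ (oneForm_mul_oneForm_mul_eval_mem i j H)

/-- `C^Φ` consists of the normal forms. -/
theorem mem_CPhi_iff (x : LocalFun U) : x ∈ CPhi U ↔ ∃ H A E F, x = normalForm H A E F := by
  rw [CPhi, Set.mem_ofPred_eq, virasoro_one, virasoro_one]
  constructor
  · rintro ⟨hx, h1, h2⟩
    have h : Submodule.span ℝ (words (0, 0)) ≤ normalForms U :=
      Submodule.span_le.2 fun w hw => words_zero_subset hw
    exact h (mem_span_words_zero (covariantFun_le_wordSpan hx) h1 h2)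
  · rintro ⟨H, A, E, F, rfl⟩
    exact ⟨normalForm_mem H A E F, weightOp_normalForm .., weightOp_normalForm ..⟩

/-! ### The Poincaré lemma on star-shaped sets -/

/-- Around each of its points, an open star-shaped set is a convex neighbourhood of the segment to
the centre: the convex hull of the centre and a small ball. -/
theorem exists_convex_nhds {E : Type*} [NormedAddCommGroup E] [NormedSpace ℝ E] {s : Set E}
    (hs : IsOpen s) {x₀ : E} (hx₀ : x₀ ∈ s) (hstar : StarConvex ℝ x₀ s) {b : E} (hb : b ∈ s) :
    ∃ t, Convex ℝ t ∧ t ⊆ s ∧ x₀ ∈ t ∧ t ∈ nhds b := by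
  obtain ⟨ε, hε, hball⟩ := Metric.isOpen_iff.1 hs b hb
  refine ⟨convexJoin ℝ {x₀} (Metric.ball b ε),
    (convex_singleton x₀).convexJoin (convex_ball b ε), ?_, ?_, ?_⟩
  · intro y hy
    rw [mem_convexJoin] at hy
    obtain ⟨x, rfl, z, hz, hy⟩ := hy
    exact hstar.segment_subset (hball hz) hy
  · exact subset_convexJoin_left ⟨b, Metric.mem_ball_self hε⟩ rfl
  · exact Filter.mem_of_superset (Metric.ball_mem_nhds b hε)
      (subset_convexJoin_right (Set.singleton_nonempty x₀))

/-- The Poincaré lemma for one-forms. -/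
theorem exists_partialD_eq {x₀ : Fin D → ℝ} (hx₀ : x₀ ∈ U)
    (hstar : StarConvex ℝ x₀ (U : Set (Fin D → ℝ))) (f : Fin D → SmoothFun U)
    (hf : ∀ μ ν, partialD U μ (f ν) = partialD U ν (f μ)) :
    ∃ g : SmoothFun U, ∀ μ, partialD U μ g = f μ := by
  classical
  set w : (Fin D → ℝ) → (Fin D → ℝ) →L[ℝ] ℝ := fun x =>
    ∑ μ, ext (f μ).1 x • ContinuousLinearMap.proj (R := ℝ) (φ := fun _ : Fin D => ℝ) μ with hw
  set w' : (Fin D → ℝ) → (Fin D → ℝ) →L[ℝ] (Fin D → ℝ) →L[ℝ] ℝ := fun x =>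
    ∑ μ, (fderiv ℝ (ext (f μ).1) x).smulRight
      (ContinuousLinearMap.proj (R := ℝ) (φ := fun _ : Fin D => ℝ) μ) with hw'
  have hd : ∀ x ∈ U, HasFDerivAt w (w' x) x := by
    intro x hx
    refine HasFDerivAt.fun_sum fun μ _ => ?_
    exact (differentiableAt_ext (f μ) ⟨x, hx⟩).hasFDerivAt.smul_const
      (ContinuousLinearMap.proj (R := ℝ) (φ := fun _ : Fin D => ℝ) μ)
  have hsymm : ∀ a ∈ U, ∀ x y, w' a x y = w' a y x := by
    intro a ha x y
    have hpart : ∀ μ ν, fderiv ℝ (ext (f μ).1) a (Pi.single ν 1)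
        = fderiv ℝ (ext (f ν).1) a (Pi.single μ 1) := by
      intro μ ν
      rw [← ext_partialD _ _ _ ha, ← ext_partialD _ _ _ ha, hf]
    have hsum : ∀ (L : (Fin D → ℝ) →L[ℝ] ℝ) x, L x = ∑ ν, x ν * L (Pi.single ν 1) := by
      intro L x
      have h := L.toLinearMap.pi_apply_eq_sum_univ x
      have hs : ∀ ν : Fin D, (fun j => if ν = j then (1 : ℝ) else 0) = Pi.single ν 1 := by
        intro ν
        ext j
        simp [Pi.single_apply, eq_comm]
      simpa [hs] using h
    have hexp : ∀ x y, w' a x y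
        = ∑ μ, ∑ ν, x ν * y μ * fderiv ℝ (ext (f μ).1) a (Pi.single ν 1) := by
      intro x y
      simp only [hw', sum_apply, ContinuousLinearMap.smulRight_apply, smul_apply,
        ContinuousLinearMap.proj_apply, smul_eq_mul]
      refine Finset.sum_congr rfl fun μ _ => ?_
      rw [hsum, Finset.sum_mul]
      exact Finset.sum_congr rfl fun ν _ => by ring
    rw [hexp, hexp, Finset.sum_comm]
    refine Finset.sum_congr rfl fun μ _ => Finset.sum_congr rfl fun ν _ => ?_
    rw [hpart]
    ring
  set G : (Fin D → ℝ) → ℝ := fun b => curveIntegral w (Path.segment x₀ b) with hG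
  have hGd : ∀ b ∈ U, HasFDerivAt G (w b) b := by
    intro b hb
    obtain ⟨t, htc, htU, hxt, htb⟩ := exists_convex_nhds U.isOpen hx₀ hstar hb
    exact (htc.hasFDerivWithinAt_curveIntegral_segment_of_hasFDerivWithinAt_symmetric
      (fun x hx => (hd x (htU hx)).hasFDerivWithinAt) (fun a ha x _ y _ => hsymm a (htU ha) x y)
      hxt (mem_of_mem_nhds htb)).hasFDerivAt htb
  have hGs : ContDiffOn ℝ (⊤ : ℕ∞) G U := by
    rw [contDiffOn_infty_iff_fderiv_of_isOpen U.isOpen]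
    refine ⟨fun b hb => (hGd b hb).differentiableAt.differentiableWithinAt, ?_⟩
    have hws : ContDiffOn ℝ (⊤ : ℕ∞) w U :=
      ContDiffOn.sum fun μ _ => ContDiffOn.smul (f μ).2 contDiffOn_const
    exact hws.congr fun b hb => (hGd b hb).fderiv
  refine ⟨⟨fun x => G x, mem_smoothFun_of _ G hGs fun _ => rfl⟩, fun μ => ?_⟩
  ext x
  rw [partialD_eq_of_hasFDerivAt μ _ G x (w x) (fun _ => rfl) (hGd x x.2), hw]
  simp [ext_apply _ x.1 x.2, Pi.single_apply]

/-- A function whose partial derivatives vanish is constant on a star-shaped set. -/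
theorem exists_eq_algebraMap {x₀ : Fin D → ℝ} (hx₀ : x₀ ∈ U)
    (hstar : StarConvex ℝ x₀ (U : Set (Fin D → ℝ))) (g : SmoothFun U)
    (hg : ∀ μ, partialD U μ g = 0) : ∃ r : ℝ, g = algebraMap ℝ _ r := by
  classical
  have h0 : ∀ x ∈ U, fderiv ℝ (ext g.1) x = 0 := by
    intro x hx
    refine ContinuousLinearMap.coe_injective ((Pi.basisFun ℝ (Fin D)).ext fun μ => ?_)
    have h := ext_partialD μ g x hx
    rw [hg μ, ext_apply _ x hx] at h
    simpa using h.symm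
  have hc : IsPreconnected (U : Set (Fin D → ℝ)) :=
    (hstar.isPathConnected hx₀).isConnected.isPreconnected
  refine ⟨(g : U → ℝ) (⟨x₀, hx₀⟩ : U), ?_⟩
  ext x
  have h := U.isOpen.is_const_of_fderiv_eq_zero hc
    (fun y hy => (differentiableAt_ext g ⟨y, hy⟩).differentiableWithinAt) (fun y hy => h0 y hy)
    x.2 hx₀
  rw [ext_apply _ x.1 x.2, ext_apply _ x₀ hx₀] at h
  exact h

/-! ### The representatives as normal forms -/

/-- The constant superfield `r`. -/
def constS (r : ℝ) : Superfield U := fun a b => if a || b then 0 else algebraMap ℝ _ r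

theorem eval_constS (r : ℝ) : (constS r : Superfield U).eval = algebraMap ℝ (LocalFun U) r := by
  simp only [Superfield.eval, constS, Bool.or_false, Bool.false_eq_true, if_false, Bool.or_true,
    if_true, ofX_zero, zero_mul, add_zero, ofX_algebraMap]

theorem partialD_algebraMap (μ : Fin D) (r : ℝ) :
    partialD U μ (algebraMap ℝ (SmoothFun U) r) = 0 := by
  rw [Algebra.algebraMap_eq_smul_one, map_smul, partialD_one, smul_zero]

theorem formDeriv_constS (α : Bool) (i : Option (Fin D)) (r : ℝ) :
    formDeriv α i (constS r : Superfield U) = 0 := by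
  funext a b
  rcases i with _ | μ
  · cases α <;> cases a <;> cases b <;> simp [formDeriv, sderiv, constS]
  · cases a <;> cases b <;> simp [formDeriv, sderiv, constS, partialD_algebraMap]

/-- The one-form coefficients of `a_{++} T^+ Θ^+ + a_{--} T^- Θ^-`. -/
def thetaForm (a : Bool → ℝ) (α : Bool) : Option (Fin D) → Superfield U
  | none => thetaMul α (constS (a α))
  | some _ => 0

/-- The `u^+_i u^-_j` coefficients of `-½ T^A T^B F_{BA} (-)^A + ½ R^μ T^ν N_{μν}`. -/
def twoFormCoeff (F : SIndex D → SIndex D → Superfield U) (N : Fin D → Fin D → Superfield U) :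
    Option (Fin D) → Option (Fin D) → Superfield U
  | some μ, some ν => F (Sum.inl μ) (Sum.inl ν) + N μ ν
  | none, some ν => F (Sum.inl ν) (Sum.inr true)
  | some μ, none => F (Sum.inl μ) (Sum.inr false)
  | none, none => F (Sum.inr true) (Sum.inr false)

theorem sum_T_mul_T (F : SIndex D → SIndex D → Superfield U) (hF : IsSuperTwoForm F) :
    ∑ i : SIndex D, ∑ j : SIndex D, sgn i • (T i * T j * (F j i).eval)
      = (-2 : ℝ) • ∑ i, ∑ j, oneForm true i * oneForm false j * (twoFormCoeff F 0 i j).eval := by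
  have hss : ∑ μ, ∑ ν,
        (T (Sum.inl μ) * T (Sum.inl ν) * (F (Sum.inl ν) (Sum.inl μ)).eval : LocalFun U)
      = (-2 : ℝ) • ∑ μ, ∑ ν, oneForm true (some μ) * oneForm false (some ν)
        * (F (Sum.inl μ) (Sum.inl ν)).eval := by
    have h : ∀ μ ν, (T (Sum.inl μ) * T (Sum.inl ν) * (F (Sum.inl ν) (Sum.inl μ)).eval : LocalFun U)
        = -(oneForm true (some μ) * oneForm false (some ν) * (F (Sum.inl μ) (Sum.inl ν)).eval)
          - oneForm true (some ν) * oneForm false (some μ) * (F (Sum.inl ν) (Sum.inl μ)).eval := by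
      intro μ ν
      have h1 : F (Sum.inl μ) (Sum.inl ν) = -F (Sum.inl ν) (Sum.inl μ) := by
        simpa [sgn₂] using hF.1 (Sum.inl μ) (Sum.inl ν)
      rw [T_inl, T_inl, add_mul, mul_add, mul_add, oneForm_mul_oneForm_self,
        oneForm_mul_oneForm_self, oneForm_comm false true, h1, eval_neg, exchangeSign]
      simp [add_mul, sub_eq_add_neg]
    simp only [h, Finset.sum_sub_distrib, Finset.sum_neg_distrib]
    rw [Finset.sum_comm (f := fun μ ν => oneForm true (some ν) * _ * _)]
    module
  have hst : ∀ μ α, (T (Sum.inl μ) * T (Sum.inr α) * (F (Sum.inr α) (Sum.inl μ)).eval : LocalFun U)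
      = -(T (Sum.inr α) * T (Sum.inl μ) * (F (Sum.inl μ) (Sum.inr α)).eval) := by
    intro μ α
    have h1 : F (Sum.inr α) (Sum.inl μ) = -F (Sum.inl μ) (Sum.inr α) := by
      simpa [sgn₂] using hF.1 (Sum.inr α) (Sum.inl μ)
    have h2 : (T (Sum.inl μ) * T (Sum.inr α) : LocalFun U) = T (Sum.inr α) * T (Sum.inl μ) := by
      rw [T_inl, T_inr, add_mul, mul_add, oneForm_comm true α, oneForm_comm false α]
      simp [exchangeSign]
    rw [h1, h2, eval_neg, mul_neg]
  have htp : ∀ μ, (T (Sum.inr true) * T (Sum.inl μ) : LocalFun U)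
      = oneForm true none * oneForm false (some μ) := by
    intro μ
    rw [T_inr, T_inl, mul_add, oneForm_mul_oneForm_self, zero_add]
  have htm : ∀ μ, (T (Sum.inr false) * T (Sum.inl μ) : LocalFun U)
      = oneForm true (some μ) * oneForm false none := by
    intro μ
    rw [T_inr, T_inl, mul_add, oneForm_mul_oneForm_self, add_zero, oneForm_comm]
    simp [exchangeSign]
  have htt : (T (Sum.inr false) * T (Sum.inr true) : LocalFun U)
      = oneForm true none * oneForm false none := by
    rw [T_inr, T_inr, oneForm_comm]
    simp [exchangeSign]
  have h3 : F (Sum.inr false) (Sum.inr true) = F (Sum.inr true) (Sum.inr false) := by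
    rw [hF.1, sgn₂]
    module
  simp only [Fintype.sum_sum_type, Fintype.sum_bool, Fintype.sum_option, sgn, one_smul, hF.2, h3,
    hst, htp, htm, htt, eval_zero, mul_zero, Finset.sum_add_distrib,
    Finset.sum_neg_distrib, ← Finset.smul_sum, hss, twoFormCoeff, Pi.zero_apply, add_zero]
  rw [T_inr, T_inr]
  module

theorem sum_R_mul_T (N : Fin D → Fin D → Superfield U) (hN : IsSymm N) :
    ∑ μ, ∑ ν, R μ * T (Sum.inl ν) * (N μ ν).eval
      = (2 : ℝ) • ∑ i, ∑ j, oneForm true i * oneForm false j * (twoFormCoeff 0 N i j).eval := by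
  have h : ∀ μ ν, (R μ * T (Sum.inl ν) * (N μ ν).eval : LocalFun U)
      = oneForm true (some μ) * oneForm false (some ν) * (N μ ν).eval
        + oneForm true (some ν) * oneForm false (some μ) * (N ν μ).eval := by
    intro μ ν
    rw [R_eq, T_inl, sub_mul, mul_add, mul_add, oneForm_mul_oneForm_self,
      oneForm_mul_oneForm_self, oneForm_comm false true, hN ν μ, exchangeSign]
    simp [add_mul]
  simp only [h, Finset.sum_add_distrib, Fintype.sum_option, twoFormCoeff, Pi.zero_apply, zero_add,
    eval_zero, mul_zero, Finset.sum_const_zero]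
  rw [Finset.sum_comm (f := fun μ ν => oneForm true (some ν) * _ * _)]
  module

theorem twoFormCoeff_add (F F' : SIndex D → SIndex D → Superfield U)
    (N N' : Fin D → Fin D → Superfield U) :
    twoFormCoeff (F + F') (N + N') = twoFormCoeff F N + twoFormCoeff F' N' := by
  funext i j
  rcases i with _ | μ <;> rcases j with _ | ν <;> simp only [twoFormCoeff, Pi.add_apply]
  abel

theorem representative_eq (ω₀ : ℝ) (a : Bool → ℝ) (F : SIndex D → SIndex D → Superfield U)
    (N : Fin D → Fin D → Superfield U) (hF : IsSuperTwoForm F) (hN : IsSymm N) :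
    representative ω₀ a F N
      = normalForm (constS ω₀) (thetaForm a) 0 (twoFormCoeff F N) := by
  have h : twoFormCoeff F N = twoFormCoeff F 0 + twoFormCoeff 0 N := by
    rw [← twoFormCoeff_add, add_zero, zero_add]
  have hθ : ∀ α, (T (Sum.inr α) * Theta α : LocalFun U) * algebraMap ℝ _ (a α)
      = oneForm α none * (thetaMul α (constS (a α))).eval := by
    intro α
    rw [T_inr, eval_thetaMul, eval_constS, mul_assoc]
  simp only [representative, normalForm, sum_T_mul_T F hF, sum_R_mul_T N hN, h, Pi.add_apply,
    eval_add, mul_add, Finset.sum_add_distrib, eval_constS, Fintype.sum_bool, Fintype.sum_option,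
    thetaForm, eval_zero, mul_zero, Finset.sum_const_zero, Pi.zero_apply, ← hθ, add_zero]
  simp only [← Algebra.commutes, ← Algebra.smul_def]
  module

/-! ### The differential on one-forms and super-curls -/

/-- The superspace index of the one-form `u^α_i`. -/
def superIndex (α : Bool) : Option (Fin D) → SIndex D
  | some μ => Sum.inl μ
  | none => Sum.inr α

theorem formDeriv_eq (α : Bool) (i : Option (Fin D)) (H : Superfield U) :
    formDeriv α i H = sderiv (superIndex α i) H := by
  cases i <;> rfl

theorem curlCoeff_superIndex (B : SIndex D → Superfield U) :
    curlCoeff (fun α i => B (superIndex α i)) = twoFormCoeff (superCurl B) 0 := by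
  funext i j
  rcases i with _ | μ <;> rcases j with _ | ν <;>
    simp only [curlCoeff, twoFormCoeff, superCurl, superIndex, formDeriv, formSign, exchangeSign,
      sgn₂, Pi.zero_apply, add_zero] <;> module

theorem superCurl_comm (B : SIndex D → Superfield U) (i j : SIndex D) :
    superCurl B i j = -(sgn₂ i j • superCurl B j i) := by
  rcases i with μ | α <;> rcases j with ν | β <;> simp only [superCurl, sgn₂] <;> module

theorem sderiv_add (i : SIndex D) (H K : Superfield U) :
    sderiv i (H + K) = sderiv i H + sderiv i K := by
  funext a b
  rcases i with μ | _ | _ <;> cases a <;> cases b <;> simp [sderiv, add_comm]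

theorem sderiv_sub (i : SIndex D) (H K : Superfield U) :
    sderiv i (H - K) = sderiv i H - sderiv i K := by
  have h := sderiv_add i (H - K) K
  rw [sub_add_cancel] at h
  rw [h, add_sub_cancel_right]

theorem sderiv_zero (i : SIndex D) : sderiv i (0 : Superfield U) = 0 := by
  simpa using sderiv_sub i (0 : Superfield U) 0

theorem sderiv_inl_inr (μ : Fin D) (α : Bool) (H : Superfield U) :
    sderiv (Sum.inl μ) (sderiv (Sum.inr α) H) = sderiv (Sum.inr α) (sderiv (Sum.inl μ) H) := by
  funext a b
  cases α <;> cases a <;> cases b <;> simp [sderiv]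

theorem sderiv_inr_inr (H : Superfield U) :
    sderiv (Sum.inr false) (sderiv (Sum.inr true) H)
      + sderiv (Sum.inr true) (sderiv (Sum.inr false) H) = 0 := by
  funext a b
  cases a <;> cases b <;> simp [sderiv]

/-! ### Exactness -/

/-- A superfield annihilated by all derivatives is constant. -/
theorem exists_eq_constS {x₀ : Fin D → ℝ} (hx₀ : x₀ ∈ U)
    (hstar : StarConvex ℝ x₀ (U : Set (Fin D → ℝ))) (H : Superfield U)
    (hH : ∀ α i, formDeriv α i H = 0) : ∃ r, H = constS r := by
  obtain ⟨r, hr⟩ := exists_eq_algebraMap hx₀ hstar (H false false) fun μ =>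
    congrFun (congrFun (hH true (some μ)) false) false
  refine ⟨r, ?_⟩
  funext a b
  cases a <;> cases b
  · simpa [constS] using hr
  · exact congrFun (congrFun (hH false none) false) false
  · exact congrFun (congrFun (hH true none) false) false
  · exact congrFun (congrFun (hH true none) false) true

/-- The super-Poincaré lemma for the one-forms in question. A family of coefficients whose even
components agree for `α = ±` and whose curl vanishes is an exact one-form, up to the multiples of
`T^α Θ^α`. The latter survive because `T^α T^α = 0`, so that the curl has no component along it. -/
theorem exists_formDeriv_eq {x₀ : Fin D → ℝ} (hx₀ : x₀ ∈ U)
    (hstar : StarConvex ℝ x₀ (U : Set (Fin D → ℝ))) (A : Bool → Option (Fin D) → Superfield U)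
    (hA : ∀ μ, A false (some μ) = A true (some μ)) (hc : curlCoeff A = 0) :
    ∃ (H : Superfield U) (a : Bool → ℝ),
      A = (fun α i => formDeriv α i H) + thetaForm a := by
  have hA' : ∀ α μ, A α (some μ) = A true (some μ) := by
    intro α μ
    cases α
    · exact hA μ
    · rfl
  have hss : ∀ μ ν, sderiv (Sum.inl μ) (A true (some ν))
      = sderiv (Sum.inl ν) (A true (some μ)) := by
    intro μ ν
    have h := congrFun (congrFun hc (some μ)) (some ν)
    simp only [curlCoeff, formDeriv, formSign, exchangeSign, hA, Pi.zero_apply] at h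
    rw [← sub_eq_zero, ← h]
    module
  have hst : ∀ α μ, sderiv (Sum.inl μ) (A α none) = sderiv (Sum.inr α) (A true (some μ)) := by
    intro α μ
    cases α
    · have h := congrFun (congrFun hc (some μ)) none
      simp only [curlCoeff, formDeriv, formSign, exchangeSign, Pi.zero_apply] at h
      rw [← sub_eq_zero, ← h]
      module
    · have h := congrFun (congrFun hc none) (some μ)
      simp only [curlCoeff, formDeriv, formSign, exchangeSign, hA, Pi.zero_apply] at h
      rw [← sub_eq_zero, ← h]
      module
  have htt : sderiv (Sum.inr false) (A true none) + sderiv (Sum.inr true) (A false none) = 0 := by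
    have h := congrFun (congrFun hc none) none
    simpa [curlCoeff, formDeriv, formSign, exchangeSign] using h
  choose H₀ hH₀ using fun a b => exists_partialD_eq hx₀ hstar (fun μ => A true (some μ) a b)
    fun μ ν => congrFun (congrFun (hss μ ν) a) b
  have hH₀' : ∀ μ, sderiv (Sum.inl μ) H₀ = A true (some μ) := by
    intro μ
    funext a b
    exact hH₀ a b μ
  set C : Bool → Superfield U := fun α => A α none - sderiv (Sum.inr α) H₀ with hC
  have hCμ : ∀ α μ, sderiv (Sum.inl μ) (C α) = 0 := by
    intro α μ
    rw [hC, sderiv_sub, hst, sderiv_inl_inr, hH₀', sub_self]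
  have hCC : sderiv (Sum.inr false) (C true) + sderiv (Sum.inr true) (C false) = 0 := by
    have h := sderiv_inr_inr H₀
    rw [hC, sderiv_sub, sderiv_sub, sub_add_sub_comm, htt, h, sub_self]
  have h1 : C true false true + C false true false = 0 := congrFun (congrFun hCC false) false
  have h2 : C true true true = 0 := by simpa [sderiv] using congrFun (congrFun hCC true) false
  have h3 : C false true true = 0 := by simpa [sderiv] using congrFun (congrFun hCC false) true
  choose k hk using fun α a b => exists_eq_algebraMap hx₀ hstar (C α a b)
    fun μ => congrFun (congrFun (hCμ α μ) a) b
  -- The superfield with constant coefficients whose `Θ`-derivatives are the `C α` up to the terms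
  -- proportional to `Θ^α` in `C α`, which have no primitive.
  set K : Superfield U := fun a b =>
    if a then (if b then C true false true else C true false false)
      else if b then C false false false else 0 with hK
  have hKμ : ∀ μ, sderiv (Sum.inl μ) K = 0 := by
    intro μ
    funext a b
    have h := fun α a b => (congrFun (congrFun (hCμ α μ) a) b : partialD U μ (C α a b) = 0)
    cases a <;> cases b
    exacts [map_zero _, h _ _ _, h _ _ _, h _ _ _]
  have hrest : ∀ α, C α = sderiv (Sum.inr α) K
      + thetaMul α (constS (k α α (!α))) := by
    intro α
    funext a b
    cases α <;> cases a <;> cases b <;>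
      simp [sderiv, hK, thetaMul, constS, h2, h3, ← hk, eq_neg_of_add_eq_zero_right h1]
  refine ⟨H₀ + K, fun α => k α α (!α), ?_⟩
  funext α i
  rcases i with _ | μ
  · have h := hrest α
    rw [hC, sub_eq_iff_eq_add] at h
    rw [h]
    simp only [Pi.add_apply, formDeriv, thetaForm, sderiv_add]
    abel
  · simp only [Pi.add_apply, formDeriv, thetaForm, sderiv_add, hH₀', hKμ, hA', add_zero]

/-! ### Splitting the two-form coefficients -/

/-- Every family of `u^+_i u^-_j` coefficients comes from a graded antisymmetric and a symmetric
part. -/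
theorem exists_twoFormCoeff_eq (G : Option (Fin D) → Option (Fin D) → Superfield U) :
    ∃ F N, IsSuperTwoForm F ∧ IsSymm N ∧ G = twoFormCoeff F N := by
  refine ⟨fun
    | Sum.inl μ, Sum.inl ν => (1 / 2 : ℝ) • (G (some μ) (some ν) - G (some ν) (some μ))
    | Sum.inl μ, Sum.inr true => G none (some μ)
    | Sum.inl μ, Sum.inr false => G (some μ) none
    | Sum.inr true, Sum.inl μ => -G none (some μ)
    | Sum.inr false, Sum.inl μ => -G (some μ) none
    | Sum.inr true, Sum.inr false => G none none
    | Sum.inr false, Sum.inr true => G none none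
    | Sum.inr true, Sum.inr true => 0
    | Sum.inr false, Sum.inr false => 0,
    fun μ ν => (1 / 2 : ℝ) • (G (some μ) (some ν) + G (some ν) (some μ)), ⟨?_, ?_⟩, ?_, ?_⟩
  · rintro (μ | _ | _) (ν | _ | _) <;> simp only [sgn₂] <;> module
  · rintro (_ | _) <;> rfl
  · intro μ ν
    exact congrArg _ (add_comm _ _)
  · funext i j
    rcases i with _ | μ <;> rcases j with _ | ν <;> simp only [twoFormCoeff]
    module

/-- The coefficients `F_{AB}`, `(A, B) ≠ (±, ±)`, and `N_{μν}` are determined by the `u^+_i u^-_j`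
coefficients: they are the graded antisymmetric and the symmetric part. -/
theorem twoFormCoeff_eq_zero (F : SIndex D → SIndex D → Superfield U)
    (N : Fin D → Fin D → Superfield U) (hF : ∀ i j, F i j = -(sgn₂ i j • F j i)) (hN : IsSymm N)
    (h : twoFormCoeff F N = 0) :
    N = 0 ∧ ∀ i j, (∀ α : Bool, ¬ (i = Sum.inr α ∧ j = Sum.inr α)) → F i j = 0 := by
  have hss : ∀ μ ν, F (Sum.inl μ) (Sum.inl ν) + N μ ν = 0 := fun μ ν =>
    congrFun (congrFun h (some μ)) (some ν)
  have hN0 : N = 0 := by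
    funext μ ν
    have h1 := hss μ ν
    have h2 := hss ν μ
    have h3 := hF (Sum.inl μ) (Sum.inl ν)
    rw [← hN μ ν] at h2
    simp only [sgn₂, one_smul] at h3
    have h4 : N μ ν = (1 / 2 : ℝ) • ((F (Sum.inl μ) (Sum.inl ν) + N μ ν)
        + (F (Sum.inl ν) (Sum.inl μ) + N μ ν)) := by
      rw [h3]
      module
    rw [h4, h1, h2, add_zero, smul_zero]
    rfl
  have hsp : ∀ μ α, F (Sum.inl μ) (Sum.inr α) = 0 := by
    intro μ α
    cases α
    · exact congrFun (congrFun h (some μ)) none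
    · exact congrFun (congrFun h none) (some μ)
  have hpm : F (Sum.inr true) (Sum.inr false) = 0 := congrFun (congrFun h none) none
  refine ⟨hN0, ?_⟩
  rintro (μ | α) (ν | β) hne
  · simpa [hN0] using hss μ ν
  · exact hsp μ β
  · rw [hF, hsp, smul_zero, neg_zero]
  · cases α <;> cases β
    · exact absurd ⟨rfl, rfl⟩ (hne false)
    · rw [hF, hpm, smul_zero, neg_zero]
    · exact hpm
    · exact absurd ⟨rfl, rfl⟩ (hne true)

theorem thetaForm_sub (a a' : Bool → ℝ) :
    (thetaForm (a - a') : Bool → Option (Fin D) → Superfield U) = thetaForm a - thetaForm a' := by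
  funext α i x y
  rcases i with _ | μ <;> cases α <;> cases x <;> cases y <;> simp [thetaForm, thetaMul, constS]

/-! ### The cohomology -/

theorem S_representative (ω₀ : ℝ) (a : Bool → ℝ) (F : SIndex D → SIndex D → Superfield U)
    (N : Fin D → Fin D → Superfield U) (hF : IsSuperTwoForm F) (hN : IsSymm N) :
    S (representative ω₀ a F N) = 0 := by
  rw [representative_eq _ _ _ _ hF hN, S_normalForm, ← normalForm_zero]
  congr 1
  · funext α i
    exact formDeriv_constS α i _
  · funext μ
    exact sub_self _
  · funext i j x y
    rcases i with _ | μ <;> rcases j with _ | ν <;> cases x <;> cases y <;>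
      simp [curlCoeff, thetaForm, formDeriv, sderiv, thetaMul, constS, partialD_algebraMap]

theorem normalForm_mem_CPhi (H : Superfield U) (A E F) : normalForm H A E F ∈ CPhi U :=
  (mem_CPhi_iff _).2 ⟨H, A, E, F, rfl⟩

/-- Part (i) of the result: the generators `c^+ c^- X^μ_{1,1}` are removed by the coboundary of
`u^-_μ E^μ`, the one-forms by the super-Poincaré lemma, and a superfield that is a cocycle is
constant. -/
theorem cocycle_iff {x₀ : Fin D → ℝ} (hx₀ : x₀ ∈ U)
    (hstar : StarConvex ℝ x₀ (U : Set (Fin D → ℝ))) (ω : LocalFun U) :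
    (ω ∈ CPhi U ∧ S ω = 0) ↔
      ∃ (ω₀ : ℝ) (a : Bool → ℝ) (F : SIndex D → SIndex D → Superfield U)
        (N : Fin D → Fin D → Superfield U), IsSuperTwoForm F ∧ IsSymm N ∧
          ∃ η ∈ CPhi U, ω = representative ω₀ a F N + S η := by
  constructor
  · rintro ⟨hω, hS⟩
    obtain ⟨H, A, E, G, rfl⟩ := (mem_CPhi_iff ω).1 hω
    rw [S_normalForm] at hS
    obtain ⟨-, h1, h2, h3⟩ := normalForm_eq_zero _ _ _ _ hS
    obtain ⟨ω₀, rfl⟩ := exists_eq_constS hx₀ hstar H fun α i => congrFun (congrFun h1 α) i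
    obtain ⟨K, a, hA⟩ := exists_formDeriv_eq hx₀ hstar A
      (fun μ => sub_eq_zero.1 (congrFun h2 μ)) h3
    set B : Bool → Option (Fin D) → Superfield U := fun α i =>
      if α then 0 else i.elim 0 E with hB
    obtain ⟨F, N, hF, hN, hG⟩ := exists_twoFormCoeff_eq (G - curlCoeff B)
    refine ⟨ω₀, a, F, N, hF, hN, normalForm K B 0 0, normalForm_mem_CPhi _ _ _ _, ?_⟩
    rw [representative_eq _ _ _ _ hF hN, S_normalForm, ← normalForm_add, ← hG, sub_add_cancel,
      add_zero, zero_add, add_comm (thetaForm a), ← hA]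
    congr 1
    funext μ
    simp [hB]
  · rintro ⟨ω₀, a, F, N, hF, hN, η, hη, rfl⟩
    obtain ⟨H, A, E, G, rfl⟩ := (mem_CPhi_iff η).1 hη
    refine ⟨?_, by rw [S_add, S_S, add_zero, S_representative _ _ _ _ hF hN]⟩
    rw [representative_eq _ _ _ _ hF hN, S_normalForm, ← normalForm_add]
    exact normalForm_mem_CPhi _ _ _ _

theorem twoFormCoeff_sub (F F' : SIndex D → SIndex D → Superfield U)
    (N N' : Fin D → Fin D → Superfield U) :
    twoFormCoeff (F - F') (N - N') = twoFormCoeff F N - twoFormCoeff F' N' := by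
  rw [eq_sub_iff_add_eq, ← twoFormCoeff_add, sub_add_cancel, sub_add_cancel]

/-- `a_α` is the coefficient of `Θ^α` in the component along `T^α`, to which no derivative
`∂/∂Θ^α` contributes. -/
theorem eq_zero_of_thetaForm_eq (hU : Nonempty U) (a : Bool → ℝ) (H : Superfield U)
    (h : ∀ α, thetaForm a α none = formDeriv α none H) : a = 0 := by
  obtain ⟨x⟩ := hU
  funext α
  have h1 := congrFun (congrFun (h α) α) (!α)
  have h2 : algebraMap ℝ (SmoothFun U) (a α) = 0 := by
    cases α <;> exact h1
  exact congrFun (congrArg Subtype.val h2) x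

/-- Part (ii) of the result: a primitive of the difference of two representatives is a one-form in
`T^A` up to degree two, and only its super-curl contributes to the two-form coefficients. -/
theorem representative_cohomologous_iff (hU : Nonempty U) (ω₀ ω₀' : ℝ) (a a' : Bool → ℝ)
    (F F' : SIndex D → SIndex D → Superfield U) (N N' : Fin D → Fin D → Superfield U)
    (hF : IsSuperTwoForm F) (hF' : IsSuperTwoForm F') (hN : IsSymm N) (hN' : IsSymm N') :
    (∃ η ∈ CPhi U, representative ω₀' a' F' N' = representative ω₀ a F N + S η) ↔
      ω₀' = ω₀ ∧ a' = a ∧ N' = N ∧ ∃ B : SIndex D → Superfield U, ∀ i j : SIndex D,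
        (∀ α : Bool, ¬ (i = Sum.inr α ∧ j = Sum.inr α)) → F' i j = F i j + superCurl B i j := by
  rw [representative_eq _ _ _ _ hF hN, representative_eq _ _ _ _ hF' hN']
  constructor
  · rintro ⟨η, hη, h⟩
    obtain ⟨H, A, E, G, rfl⟩ := (mem_CPhi_iff η).1 hη
    rw [S_normalForm, ← sub_eq_iff_eq_add', ← sub_eq_zero, ← normalForm_sub, ← normalForm_sub,
      ← thetaForm_sub, ← twoFormCoeff_sub] at h
    obtain ⟨h0, h1, h2, h3⟩ := normalForm_eq_zero _ _ _ _ h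
    have hω : algebraMap ℝ (SmoothFun U) ω₀' - algebraMap ℝ (SmoothFun U) ω₀ = 0 := by
      simpa [constS] using congrFun (congrFun h0 false) false
    have ha := eq_zero_of_thetaForm_eq hU (a' - a) H fun α =>
      sub_eq_zero.1 (congrFun (congrFun h1 α) none)
    have hA : A = fun α i => Sum.elim (fun μ => A true (some μ)) (fun α => A α none)
        (superIndex α i) := by
      have h4 : ∀ μ, A false (some μ) = A true (some μ) := by
        intro μ
        have h5 := congrFun h2 μ
        simp only [Pi.sub_apply, Pi.zero_apply, sub_self, zero_sub, neg_eq_zero] at h5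
        exact sub_eq_zero.1 h5
      funext α i
      rcases i with _ | μ
      · rfl
      · cases α
        · exact h4 μ
        · rfl
    set B : SIndex D → Superfield U := Sum.elim (fun μ => A true (some μ)) (fun α => A α none)
    rw [hA, curlCoeff_superIndex, ← twoFormCoeff_sub, sub_zero] at h3
    obtain ⟨h6, h7⟩ := twoFormCoeff_eq_zero _ _ (by
      intro i j
      simp only [Pi.sub_apply]
      rw [hF.1 i j, hF'.1 i j, superCurl_comm B i j]
      module) (by
      intro μ ν
      simp only [Pi.sub_apply]
      rw [hN μ ν, hN' μ ν]) h3
    refine ⟨?_, sub_eq_zero.1 ha, sub_eq_zero.1 h6, B, fun i j hij => ?_⟩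
    · obtain ⟨x⟩ := hU
      exact sub_eq_zero.1 (congrFun (congrArg Subtype.val hω) x)
    · have h8 := h7 i j hij
      simp only [Pi.sub_apply] at h8
      rw [sub_eq_zero, sub_eq_iff_eq_add'] at h8
      exact h8
  · rintro ⟨rfl, rfl, rfl, B, hB⟩
    refine ⟨normalForm 0 (fun α i => B (superIndex α i)) 0 0, normalForm_mem_CPhi _ _ _ _, ?_⟩
    rw [S_normalForm, ← normalForm_add, curlCoeff_superIndex, ← twoFormCoeff_add, add_zero,
      add_zero]
    congr 1
    · funext α i
      simp [formDeriv_eq, sderiv_zero]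
    · funext μ
      simp [superIndex]
    · funext i j
      rcases i with _ | μ <;> rcases j with _ | ν <;> simp only [twoFormCoeff, Pi.add_apply] <;>
        rw [hB _ _ (by simp)]

end

end BRST

theorem lemma7p2 (D : ℕ) (U : TopologicalSpace.Opens (Fin D → ℝ))
    (hU : ∃ x₀ ∈ U, StarConvex ℝ x₀ (U : Set (Fin D → ℝ))) :
    (∀ ω : BRST.LocalFun U,
      (ω ∈ BRST.CPhi U ∧ BRST.S ω = 0) ↔
        ∃ (ω₀ : ℝ) (a : Bool → ℝ) (F : BRST.SIndex D → BRST.SIndex D → BRST.Superfield U)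
          (N : Fin D → Fin D → BRST.Superfield U),
          BRST.IsSuperTwoForm F ∧ BRST.IsSymm N ∧
            ∃ η ∈ BRST.CPhi U, ω = BRST.representative ω₀ a F N + BRST.S η) ∧
    (∀ (ω₀ ω₀' : ℝ) (a a' : Bool → ℝ)
      (F F' : BRST.SIndex D → BRST.SIndex D → BRST.Superfield U)
      (N N' : Fin D → Fin D → BRST.Superfield U),
      BRST.IsSuperTwoForm F → BRST.IsSuperTwoForm F' → BRST.IsSymm N → BRST.IsSymm N' →
        ((∃ η ∈ BRST.CPhi U,
            BRST.representative ω₀' a' F' N' = BRST.representative ω₀ a F N + BRST.S η) ↔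
          ω₀' = ω₀ ∧ a' = a ∧ N' = N ∧
            ∃ B : BRST.SIndex D → BRST.Superfield U,
              ∀ i j : BRST.SIndex D,
                (∀ α : Bool, ¬ (i = Sum.inr α ∧ j = Sum.inr α)) →
                  F' i j = F i j + BRST.superCurl B i j)) := by
  obtain ⟨x₀, hx₀, hstar⟩ := hU
  exact ⟨BRST.cocycle_iff hx₀ hstar, fun ω₀ ω₀' a a' F F' N N' hF hF' hN hN' =>
    BRST.representative_cohomologous_iff ⟨⟨x₀, hx₀⟩⟩ ω₀ ω₀' a a' F F' N N' hF hF' hN hN'⟩
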